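/- **Setting.** A financial network consists of a set $V$ of $n$ banks, a set $E\subseteq V\times V$ of $m$ claims (directed edges $e=(u,w)$ with debtor $u$ and creditor $w$; no self-loops, no multi-edges), liabilities $\ell_e\ge 0$ and external assets $a^{(x)}_v\ge 0$. Let $E^+(v)$ and $E^-(v)$ be the sets of outgoing and incoming claims of $v$, and $L^+(v)=\sum_{e\in E^+(v)}\ell_e$. Each claim $e\in E^+(v)$ has a payment function $p_e$ with $p_e(a)\in[0,\ell_e]$, $p_e$ non-decreasing, and $\sum_{e\in E^+(v)}p_e(a)=\min\{a,L^+(v)\}$ for all $a\ge 0$. It is piecewise linear: there are $k_e\ge1$ and borders $0=x_{e,0}<x_{e,1}<\dots<x_{e,k_e}=L^+(v)<x_{e,k_e+1}=\infty$ such that $p_e$ is linear with slope $m_{e,i}\ge 0$ on $[x_{e,i},x_{e,i+1})$ for $0\le i\le k_e$. Let $k=\sum_{e}k_e$. There is no default cost: a clearing state is a vector $\mathbf a\ge 0$ with $a_v=a^{(x)}_v+\sum_{(u,v)\in E}p_{(u,v)}(a_u)$ for all $v$. The minimal clearing state is the coordinate-wise least one. For $\mathbf b\ge 0$ and $e=(u,w)$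 let $m_e(b_u)$ be the slope of $p_e$ on the interval $[x_{e,i},x_{e,i+1})$ that contains $b_u$, and let $\delta_e(b_u)=\min\{x_{e,i}-b_u : x_{e,i}>b_u\}$. The claim $e$ is active if $m_e(b_u)>0$; $E_{\mathbf b}$ is the set of active claims and $G_{\mathbf b}=(V,E_{\mathbf b})$ the active graph. **Algorithm.** Start with $\mathbf b^{(x)}=\mathbf b=\mathbf 0$. While there is a bank with $b^{(x)}_v<a^{(x)}_v$, choose such a bank $v$ and do the following. 1. While $G_{\mathbf b}$ has a strongly connected component $C$ that has at least two banks, is reachable from $v$ and has no active claims leaving it, choose such a $C$, let $\mathbf d$ be an optimal solution (extended by $0$ outside $C$) of the Flood-LP $$\max \sum_{w\in C}d_w\quad\text{s.t.}\quad d_w=\sum_{(u,w)\in E_{\mathbf b},\,u\in C}m_{(u,w)}(b_u)\,d_u,\quad d_w\ge 0\quad(w\in C),\qquad d_u\le\delta_e(b_u)\quad(e=(u,w)\in E_{\mathbf b},\ u\in C),$$ and set $\mathbf b\gets\mathbf b+\mathbf d$. 2. Let $(\delta,\mathbf d)$ be an optimal solution of the Increase-LP: maximize $\delta$ subject to $d_v=\delta+\sum_{(u,v)\in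 E_{\mathbf b}}m_{(u,v)}(b_u)d_u$; $d_w=\sum_{(u,w)\in E_{\mathbf b}}m_{(u,w)}(b_u)d_u$ for all $w\ne v$ reachable from $v$ in $G_{\mathbf b}$; $d_w=0$ for all $w\neq v$ not reachable from $v$; $d_u\le\delta_e(b_u)$ for all $e=(u,w)\in E_{\mathbf b}$; $\delta\le a^{(x)}_v-b^{(x)}_v$; and $\mathbf d\ge 0$. Set $b^{(x)}_v\gets b^{(x)}_v+\delta$ and $\mathbf b\gets\mathbf b+\mathbf d$. Return $\mathbf b$. **Theorem.** For every financial network with monotone piecewise-linear payment functions and without default cost, and for every choice of $v$, $C$ and of the optimal LP solutions, the algorithm is well defined (each linear program that occurs has an optimal solution), it terminates after $O(n+k)$ steps (choices of a bank and LP solutions), and it returns the minimal clearing state. Moreover, the algorithm can be carried out in time $O((n+k)(n^3+m))$: there are a single real-RAM program (unit-cost arithmetic operations and comparisons on reals; unit-cost addition, subtraction and comparison of natural numbers; arrays with indirect addressing) and a constant $c$ such that, on every such network with $n\ge 1$, given by its claims, liabilities, external assets, borders and slopes, the program performs a complete run of the algorithm, passing through all of its states, and halts within $c\,(n+k)(n^3+m)$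 elementary operations with the minimal clearing state in memory. -/

import Mathlib

/-! ## Financial networks -/

/-- A financial network with bank set `Fin n` and claims (directed edges) `Fin m`, without
self-loops and without multi-edges, with non-negative liabilities and external assets. -/
structure FinancialNetwork (n m : ℕ) where
  debtor : Fin m → Fin n
  creditor : Fin m → Fin n
  no_loops : ∀ e, debtor e ≠ creditor e
  no_multi : ∀ e e', debtor e = debtor e' → creditor e = creditor e' → e = e'
  liability : Fin m → ℝ
  liability_nonneg : ∀ e, 0 ≤ liability e
  extAssets : Fin n → ℝ
  extAssets_nonneg : ∀ v, 0 ≤ extAssets v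

namespace FinancialNetwork

variable {n m : ℕ}

/-- `L⁺(v)`, the total liability of the outgoing claims of `v`. -/
noncomputable def outLiability (N : FinancialNetwork n m) (v : Fin n) : ℝ :=
  ∑ e with N.debtor e = v, N.liability e

end FinancialNetwork

/-- Monotone piecewise-linear payment functions for the claims of a network `N`.
For each claim `e = (u, v)` the borders are `0 = x₀ < x₁ < ⋯ < x_{k_e} = L⁺(u)`, `k_e ≥ 1`, and
`slope e i` is the slope on `[x_i, x_{i+1})`, where `x_{k_e + 1} = ∞`. The values of `border e i`
and `slope e i` for `i > k_e` have no meaning. -/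
structure PiecewiseLinearPayments {n m : ℕ} (N : FinancialNetwork n m) where
  pay : Fin m → ℝ → ℝ
  numBorders : Fin m → ℕ
  border : Fin m → ℕ → ℝ
  slope : Fin m → ℕ → ℝ
  -- no claim is underpaid below zero or overpaid
  pay_mem : ∀ e a, 0 ≤ a → pay e a ∈ Set.Icc 0 (N.liability e)
  -- monotonicity
  pay_mono : ∀ e, MonotoneOn (pay e) (Set.Ici 0)
  -- no fraud
  no_fraud : ∀ u a, 0 ≤ a → ∑ e with N.debtor e = u, pay e a = min a (N.outLiability u)
  one_le_numBorders : ∀ e, 1 ≤ numBorders e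
  border_zero : ∀ e, border e 0 = 0
  border_lt : ∀ e i, i < numBorders e → border e i < border e (i + 1)
  border_last : ∀ e, border e (numBorders e) = N.outLiability (N.debtor e)
  slope_nonneg : ∀ e i, i ≤ numBorders e → 0 ≤ slope e i
  linear : ∀ e i, i < numBorders e → ∀ a ∈ Set.Ico (border e i) (border e (i + 1)),
    pay e a = slope e i * (a - border e i) + pay e (border e i)
  linear_last : ∀ e, ∀ a ∈ Set.Ici (border e (numBorders e)),
    pay e a = slope e (numBorders e) * (a - border e (numBorders e))
      + pay e (border e (numBorders e))

namespace PiecewiseLinearPayments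

variable {n m : ℕ} {N : FinancialNetwork n m}

/-- `k`, the total number of interval borders. -/
def totalBorders (P : PiecewiseLinearPayments N) : ℕ := ∑ e, P.numBorders e

/-- A clearing state (without default cost): non-negative total assets `a` such that the assets of
every bank are its external assets plus the incoming payments. -/
def IsClearing (P : PiecewiseLinearPayments N) (a : Fin n → ℝ) : Prop :=
  (∀ v, 0 ≤ a v) ∧
    ∀ v, a v = N.extAssets v + ∑ e with N.creditor e = v, P.pay e (a (N.debtor e))

/-- The coordinate-wise minimal clearing state. -/
def IsMinimalClearing (P : PiecewiseLinearPayments N) (a : Fin n → ℝ) : Prop :=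
  IsLeast {a | P.IsClearing a} a

/-! ## The active graph -/

open Classical in
/-- `m_e(a)`, the slope on the interval that contains `a ≥ 0`. -/
noncomputable def slopeAt (P : PiecewiseLinearPayments N) (e : Fin m) (a : ℝ) : ℝ :=
  P.slope e (Nat.findGreatest (fun i => P.border e i ≤ a) (P.numBorders e))

/-- `δ_e(a)`, the distance from `a` to the next interval border. It is only used for active claims,
for which a next border exists. -/
noncomputable def gap (P : PiecewiseLinearPayments N) (e : Fin m) (a : ℝ) : ℝ :=
  sInf {r | ∃ i, i ≤ P.numBorders e ∧ a < P.border e i ∧ r = P.border e i - a}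

/-- The slope of claim `e` when the total assets are `b`. -/
noncomputable def slopeIn (P : PiecewiseLinearPayments N) (b : Fin n → ℝ) (e : Fin m) : ℝ :=
  P.slopeAt e (b (N.debtor e))

/-- Claim `e` is active for the total assets `b`. -/
def Active (P : PiecewiseLinearPayments N) (b : Fin n → ℝ) (e : Fin m) : Prop :=
  0 < P.slopeIn b e

/-- Adjacency in the active graph `G_b`. -/
def ActiveAdj (P : PiecewiseLinearPayments N) (b : Fin n → ℝ) (u w : Fin n) : Prop :=
  ∃ e, P.Active b e ∧ N.debtor e = u ∧ N.creditor e = w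

/-- Reachability in the active graph `G_b`, by a path of length at least `0`. -/
def Reach (P : PiecewiseLinearPayments N) (b : Fin n → ℝ) : Fin n → Fin n → Prop :=
  Relation.ReflTransGen (P.ActiveAdj b)

/-- `C` is a strongly connected component of `G_b`. -/
def IsSCC (P : PiecewiseLinearPayments N) (b : Fin n → ℝ) (C : Finset (Fin n)) : Prop :=
  C.Nonempty ∧ ∀ u ∈ C, ∀ w, w ∈ C ↔ P.Reach b u w ∧ P.Reach b w u

/-- `C` is a non-singleton sink strongly connected component of `G_b`, reachable from `v`. -/
def IsFloodComponent (P : PiecewiseLinearPayments N) (b : Fin n → ℝ) (v : Fin n)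
    (C : Finset (Fin n)) : Prop :=
  P.IsSCC b C ∧ C.Nontrivial ∧ (∀ u ∈ C, ∀ w, P.ActiveAdj b u w → w ∈ C) ∧
    ∃ u ∈ C, P.Reach b v u

/-! ## The two linear programs -/

open Classical in
/-- Feasibility in the Flood-LP of the component `C`; `d` is extended by zero outside `C`. -/
def FloodFeasible (P : PiecewiseLinearPayments N) (b : Fin n → ℝ) (C : Finset (Fin n))
    (d : Fin n → ℝ) : Prop :=
  (∀ w ∈ C, d w = ∑ e with N.creditor e = w ∧ N.debtor e ∈ C ∧ P.Active b e,
      P.slopeIn b e * d (N.debtor e)) ∧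
  (∀ e, N.debtor e ∈ C → P.Active b e → d (N.debtor e) ≤ P.gap e (b (N.debtor e))) ∧
  (∀ w ∈ C, 0 ≤ d w) ∧
  (∀ w, w ∉ C → d w = 0)

/-- `d` is an optimal solution of the Flood-LP of `C`. -/
def FloodOptimal (P : PiecewiseLinearPayments N) (b : Fin n → ℝ) (C : Finset (Fin n))
    (d : Fin n → ℝ) : Prop :=
  P.FloodFeasible b C d ∧ ∀ d', P.FloodFeasible b C d' → ∑ w ∈ C, d' w ≤ ∑ w ∈ C, d w

open Classical in
/-- Feasibility in the Increase-LP of bank `v`. -/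
def IncreaseFeasible (P : PiecewiseLinearPayments N) (bx b : Fin n → ℝ) (v : Fin n)
    (δ : ℝ) (d : Fin n → ℝ) : Prop :=
  (d v = δ + ∑ e with N.creditor e = v ∧ P.Active b e, P.slopeIn b e * d (N.debtor e)) ∧
  (∀ w, w ≠ v → P.Reach b v w →
    d w = ∑ e with N.creditor e = w ∧ P.Active b e, P.slopeIn b e * d (N.debtor e)) ∧
  (∀ w, w ≠ v → ¬ P.Reach b v w → d w = 0) ∧
  (∀ e, P.Active b e → d (N.debtor e) ≤ P.gap e (b (N.debtor e))) ∧
  δ ≤ N.extAssets v - bx v ∧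
  (∀ w, 0 ≤ d w)

/-- `(δ, d)` is an optimal solution of the Increase-LP of `v`. -/
def IncreaseOptimal (P : PiecewiseLinearPayments N) (bx b : Fin n → ℝ) (v : Fin n)
    (δ : ℝ) (d : Fin n → ℝ) : Prop :=
  P.IncreaseFeasible bx b v δ d ∧ ∀ δ' d', P.IncreaseFeasible bx b v δ' d' → δ' ≤ δ

/-! ## The algorithm -/

/-- A state of the algorithm: the reduced external assets `bx`, the total assets `b`, and the bank
of the current iteration of the main loop (`none` at the head of the main loop). -/
structure AlgState (n : ℕ) where
  bx : Fin n → ℝ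
  b : Fin n → ℝ
  cur : Option (Fin n)

/-- The initial state. -/
def AlgState.init (n : ℕ) : AlgState n := ⟨0, 0, none⟩

/-- One step of the algorithm, which leaves open which eligible bank, component and optimal
solution is chosen. -/
inductive AlgStep (P : PiecewiseLinearPayments N) : AlgState n → AlgState n → Prop
  /-- Enter the main loop with a bank whose external assets are not yet fully injected. -/
  | choose (bx b : Fin n → ℝ) (v : Fin n) (hv : bx v < N.extAssets v) :
      AlgStep P ⟨bx, b, none⟩ ⟨bx, b, some v⟩
  /-- Flood a non-singleton sink component reachable from the current bank. -/
  | flood (bx b : Fin n → ℝ) (v : Fin n) (C : Finset (Fin n)) (d : Fin n → ℝ)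
      (hC : P.IsFloodComponent b v C) (hd : P.FloodOptimal b C d) :
      AlgStep P ⟨bx, b, some v⟩ ⟨bx, b + d, some v⟩
  /-- If there is no such component, raise the external assets of the current bank. -/
  | increase (bx b : Fin n → ℝ) (v : Fin n) (δ : ℝ) (d : Fin n → ℝ)
      (hC : ∀ C, ¬ P.IsFloodComponent b v C) (hd : P.IncreaseOptimal bx b v δ d) :
      AlgStep P ⟨bx, b, some v⟩ ⟨Function.update bx v (bx v + δ), b + d, none⟩

/-- The main loop has ended; the algorithm returns `s.b`. -/
def Finished (_P : PiecewiseLinearPayments N) (s : AlgState n) : Prop :=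
  s.cur = none ∧ ¬ ∃ v, s.bx v < N.extAssets v

/-- `s 0, …, s r` is a (not necessarily complete) run of the algorithm. -/
def IsRun (P : PiecewiseLinearPayments N) (r : ℕ) (s : ℕ → AlgState n) : Prop :=
  s 0 = AlgState.init n ∧ ∀ i < r, P.AlgStep (s i) (s (i + 1))

end PiecewiseLinearPayments

/-! ## Real RAM

Programs work on countably many arrays of natural numbers and countably many arrays of reals, with
indirect addressing. Natural numbers can be added, subtracted and compared; reals can be added,
subtracted, multiplied, divided and compared, each at unit cost. There are no other operations
(no rounding, and no real constants besides integers). -/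

namespace RealRAM

/-- Memory: `nat A i` and `real A i` are the entries with index `i` of the arrays number `A`. -/
structure Mem where
  nat : ℕ → ℕ → ℕ
  real : ℕ → ℕ → ℝ

/-- Expressions for natural numbers; `sub` is truncated subtraction. -/
inductive NatExp
  | lit (c : ℕ)
  | get (A : ℕ) (i : NatExp)
  | add (e f : NatExp)
  | sub (e f : NatExp)

/-- Expressions for reals; the result of a division by zero is zero. -/
inductive RealExp
  | lit (c : ℤ)
  | get (A : ℕ) (i : NatExp)
  | add (e f : RealExp)
  | sub (e f : RealExp)
  | mul (e f : RealExp)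
  | div (e f : RealExp)

/-- Tests. -/
inductive Test
  | natLt (e f : NatExp)
  | realLt (e f : RealExp)
  | neg (b : Test)
  | both (b c : Test)

/-- Programs. -/
inductive Cmd
  | setNat (A : ℕ) (i : NatExp) (e : NatExp)
  | setReal (A : ℕ) (i : NatExp) (e : RealExp)
  | seq (c d : Cmd)
  | ite (b : Test) (c d : Cmd)
  | loop (b : Test) (c : Cmd)

def NatExp.eval (μ : Mem) : NatExp → ℕ
  | lit c => c
  | get A i => μ.nat A (i.eval μ)
  | add e f => e.eval μ + f.eval μ
  | sub e f => e.eval μ - f.eval μ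

/-- The number of elementary operations in the evaluation of an expression. -/
def NatExp.cost : NatExp → ℕ
  | lit _ => 1
  | get _ i => 1 + i.cost
  | add e f => 1 + e.cost + f.cost
  | sub e f => 1 + e.cost + f.cost

noncomputable def RealExp.eval (μ : Mem) : RealExp → ℝ
  | lit c => (c : ℝ)
  | get A i => μ.real A (i.eval μ)
  | add e f => e.eval μ + f.eval μ
  | sub e f => e.eval μ - f.eval μ
  | mul e f => e.eval μ * f.eval μ
  | div e f => e.eval μ / f.eval μ

def RealExp.cost : RealExp → ℕ
  | lit _ => 1
  | get _ i => 1 + i.cost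
  | add e f => 1 + e.cost + f.cost
  | sub e f => 1 + e.cost + f.cost
  | mul e f => 1 + e.cost + f.cost
  | div e f => 1 + e.cost + f.cost

def Test.eval (μ : Mem) : Test → Prop
  | natLt e f => e.eval μ < f.eval μ
  | realLt e f => e.eval μ < f.eval μ
  | neg b => ¬ b.eval μ
  | both b c => b.eval μ ∧ c.eval μ

def Test.cost : Test → ℕ
  | natLt e f => 1 + e.cost + f.cost
  | realLt e f => 1 + e.cost + f.cost
  | neg b => 1 + b.cost
  | both b c => 1 + b.cost + c.cost

def Mem.setNat (μ : Mem) (A i x : ℕ) : Mem :=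
  { μ with nat := Function.update μ.nat A (Function.update (μ.nat A) i x) }

noncomputable def Mem.setReal (μ : Mem) (A i : ℕ) (x : ℝ) : Mem :=
  { μ with real := Function.update μ.real A (Function.update (μ.real A) i x) }

/-- A configuration: the commands still to be executed, the memory, and the number of elementary
operations performed so far. -/
structure Config where
  todo : List Cmd
  mem : Mem
  clock : ℕ

/-- One (deterministic) execution step. -/
inductive Step : Config → Config → Prop
  | setNat (A : ℕ) (i e : NatExp) (K : List Cmd) (μ : Mem) (t : ℕ) :
      Step ⟨.setNat A i e :: K, μ, t⟩
        ⟨K, μ.setNat A (i.eval μ) (e.eval μ), t + (1 + i.cost + e.cost)⟩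
  | setReal (A : ℕ) (i : NatExp) (e : RealExp) (K : List Cmd) (μ : Mem) (t : ℕ) :
      Step ⟨.setReal A i e :: K, μ, t⟩
        ⟨K, μ.setReal A (i.eval μ) (e.eval μ), t + (1 + i.cost + e.cost)⟩
  | seq (c d : Cmd) (K : List Cmd) (μ : Mem) (t : ℕ) :
      Step ⟨.seq c d :: K, μ, t⟩ ⟨c :: d :: K, μ, t + 1⟩
  | iteTrue (b : Test) (c d : Cmd) (K : List Cmd) (μ : Mem) (t : ℕ) (h : b.eval μ) :
      Step ⟨.ite b c d :: K, μ, t⟩ ⟨c :: K, μ, t + (1 + b.cost)⟩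
  | iteFalse (b : Test) (c d : Cmd) (K : List Cmd) (μ : Mem) (t : ℕ) (h : ¬ b.eval μ) :
      Step ⟨.ite b c d :: K, μ, t⟩ ⟨d :: K, μ, t + (1 + b.cost)⟩
  | loopTrue (b : Test) (c : Cmd) (K : List Cmd) (μ : Mem) (t : ℕ) (h : b.eval μ) :
      Step ⟨.loop b c :: K, μ, t⟩ ⟨c :: .loop b c :: K, μ, t + (1 + b.cost)⟩
  | loopFalse (b : Test) (c : Cmd) (K : List Cmd) (μ : Mem) (t : ℕ) (h : ¬ b.eval μ) :
      Step ⟨.loop b c :: K, μ, t⟩ ⟨K, μ, t + (1 + b.cost)⟩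

/-- The execution leads from the first to the second configuration. -/
def Steps : Config → Config → Prop := Relation.ReflTransGen Step

end RealRAM

namespace PiecewiseLinearPayments

variable {n m : ℕ} {N : FinancialNetwork n m}

/-- The input in memory. Natural arrays: `0` holds `n, m`; `1`, `2`, `3` hold the debtor, the
creditor and the number of borders of each claim. Real arrays: `0` holds the external assets,
`1` the liabilities, `2` the borders `x_{e,0}, …, x_{e,k_e}` of all claims one after the other,
`3` the slopes in the same order. All other entries are zero. -/
def inputMem (P : PiecewiseLinearPayments N) : RealRAM.Mem where
  nat := fun A i => match A with
    | 0 => [n, m].getD i 0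
    | 1 => (List.ofFn fun e => (N.debtor e : ℕ)).getD i 0
    | 2 => (List.ofFn fun e => (N.creditor e : ℕ)).getD i 0
    | 3 => (List.ofFn P.numBorders).getD i 0
    | _ => 0
  real := fun A i => match A with
    | 0 => (List.ofFn N.extAssets).getD i 0
    | 1 => (List.ofFn N.liability).getD i 0
    | 2 => ((List.finRange m).flatMap fun e =>
        (List.range (P.numBorders e + 1)).map (P.border e)).getD i 0
    | 3 => ((List.finRange m).flatMap fun e =>
        (List.range (P.numBorders e + 1)).map (P.slope e)).getD i 0
    | _ => 0

/-- The memory displays the state `s` of the algorithm: real array `4` holds the reduced external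
assets, real array `5` the total assets, and entry `0` of natural array `4` is `0` at the head of
the main loop, and `v + 1` if `v` is the current bank. -/
def Displays (μ : RealRAM.Mem) (s : AlgState n) : Prop :=
  (∀ v : Fin n, μ.real 4 v = s.bx v) ∧ (∀ v : Fin n, μ.real 5 v = s.b v) ∧
    μ.nat 4 0 = s.cur.elim 0 (fun v => (v : ℕ) + 1)

/-- Started on the given network, the program carries out a complete run of the algorithm: its
configurations display the states of the run one after the other, and it then halts, displaying
the last one, after at most `T` elementary operations. -/
def RunsWithin (P : PiecewiseLinearPayments N) (prog : RealRAM.Cmd) (T : ℕ) : Prop :=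
  ∃ (r : ℕ) (s : ℕ → AlgState n) (c : ℕ → RealRAM.Config),
    P.IsRun r s ∧ P.Finished (s r) ∧
    RealRAM.Steps ⟨[prog], P.inputMem, 0⟩ (c 0) ∧
    (∀ i < r, RealRAM.Steps (c i) (c (i + 1))) ∧
    (∀ i ≤ r, Displays (c i).mem (s i)) ∧
    (c r).todo = [] ∧ (c r).clock ≤ T

end PiecewiseLinearPayments

/-! The dynamics are locally linear. Below its total liability a bank passes on every additional
unit, split according to the slopes of its claims; from there on it passes on nothing
(`sum_slopeAt`). So the slope matrix M has column sums 1 or 0, and both programs move the assets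
along a flow d that stays inside the current linear pieces, end points included
(`pay_add_of_le_gap`).

Two restrictions of M let flow leak away from every bank: the columns of the banks reachable from v,
if no flood component is left (`increaseMatrix`), and a flood component with the flow into one bank
s cut (`floodMatrix`). For such a matrix Q, x ≥ 0 and x ≤ Qx force x = 0
(`IsTransient.eq_zero_of_le`). Hence y = e_s + Qy has exactly one solution; it is non-negative, and
positive on the banks reached from s. All feasible directions of either program are multiples t·y,
so an optimum exists, and at the optimum either a border is reached or the external assets of v are
used up.

Correctness rests on the invariant `IsSound`: b clears for the external assets injected so far, and
b ≤ a for every clearing state a. If a step along d overshoots a, the excess x = max(0, b + d − a)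
satisfies x ≤ Mx. In an increase step transience gives x = 0. A flood component conserves flow, so
one more fact is needed: as v still lacks external assets, a exceeds b strictly on everything
reachable from v (`lt_of_reach`), so under a the component receives strictly more from outside at
some bank s. Conservation then forces x_s = 0, and with s cut the matrix is transient. At the end
all external assets are injected, so b is itself a clearing state, and the least one.

The potential `rank` counts passed borders and completed banks, and bounds the number of steps by
3(n + k).

For the running time, one round of the program costs O(n³ + m): Warshall's algorithm gives
reachability, and Gauss–Jordan elimination solves (I − Q)y = e_s. Pivoting is unnecessary, since the
off-diagonal entries of I − Q are non-positive and some positive vector has a positive image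
(`IsEliminated`). The pointers to the current intervals advance by at most one border per round, so
keeping them up to date costs at most k additional rounds. -/

namespace PiecewiseLinearPayments

variable {n m : ℕ} {N : FinancialNetwork n m}

/-! ## Local structure of the payment functions -/

open Classical in
/-- The index of the interval that contains `a ≥ 0`. -/
noncomputable def pieceIndex (P : PiecewiseLinearPayments N) (e : Fin m) (a : ℝ) : ℕ :=
  Nat.findGreatest (fun i => P.border e i ≤ a) (P.numBorders e)

variable (P : PiecewiseLinearPayments N)

theorem slopeAt_eq (e : Fin m) (a : ℝ) : P.slopeAt e a = P.slope e (P.pieceIndex e a) := rfl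

theorem pieceIndex_le (e : Fin m) (a : ℝ) : P.pieceIndex e a ≤ P.numBorders e :=
  Nat.findGreatest_le _

theorem border_pieceIndex_le (e : Fin m) {a : ℝ} (ha : 0 ≤ a) :
    P.border e (P.pieceIndex e a) ≤ a := by
  classical
  refine Nat.findGreatest_spec (P := fun i => P.border e i ≤ a) (Nat.zero_le _) ?_
  simpa [P.border_zero] using ha

theorem lt_border_of_pieceIndex_lt (e : Fin m) {a : ℝ} {i : ℕ} (h : P.pieceIndex e a < i)
    (hi : i ≤ P.numBorders e) : a < P.border e i := by
  classical
  exact not_le.1 (Nat.findGreatest_is_greatest (P := fun i => P.border e i ≤ a) h hi)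

theorem border_strictMono (e : Fin m) {i j : ℕ} (hij : i < j) (hj : j ≤ P.numBorders e) :
    P.border e i < P.border e j := by
  induction j with
  | zero => omega
  | succ j ih =>
    rcases Nat.lt_succ_iff_lt_or_eq.1 hij with h | rfl
    · exact (ih h (by omega)).trans (P.border_lt e j (by omega))
    · exact P.border_lt e _ (by omega)

theorem border_mono (e : Fin m) {i j : ℕ} (hij : i ≤ j) (hj : j ≤ P.numBorders e) :
    P.border e i ≤ P.border e j := by
  rcases hij.eq_or_lt with rfl | h
  · exact le_rfl
  · exact (P.border_strictMono e h hj).le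

theorem pieceIndex_eq (e : Fin m) {a : ℝ} {i : ℕ} (hi : i ≤ P.numBorders e)
    (h1 : P.border e i ≤ a) (h2 : i < P.numBorders e → a < P.border e (i + 1)) :
    P.pieceIndex e a = i := by
  classical
  refine Nat.findGreatest_eq_iff.2 ⟨hi, fun _ => h1, fun j hij hj => ?_⟩
  exact not_le.2 ((h2 (by omega)).trans_le (P.border_mono e hij hj))

theorem pay_eq (e : Fin m) {a : ℝ} (ha : 0 ≤ a) :
    P.pay e a = P.slopeAt e a * (a - P.border e (P.pieceIndex e a))
      + P.pay e (P.border e (P.pieceIndex e a)) := by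
  rw [slopeAt_eq]
  have h1 := P.border_pieceIndex_le e ha
  rcases (P.pieceIndex_le e a).lt_or_eq with h | h
  · exact P.linear e _ h a ⟨h1, P.lt_border_of_pieceIndex_lt e (Nat.lt_succ_self _) h⟩
  · rw [h] at h1 ⊢
    exact P.linear_last e a h1

theorem pieceIndex_add (e : Fin m) {a h : ℝ} (ha : 0 ≤ a) (hh : 0 ≤ h)
    (hb : P.pieceIndex e a < P.numBorders e → a + h < P.border e (P.pieceIndex e a + 1)) :
    P.pieceIndex e (a + h) = P.pieceIndex e a :=
  P.pieceIndex_eq e (P.pieceIndex_le e a)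
    ((P.border_pieceIndex_le e ha).trans (by linarith)) hb

theorem pay_add (e : Fin m) {a h : ℝ} (ha : 0 ≤ a) (hh : 0 ≤ h)
    (hb : P.pieceIndex e a < P.numBorders e → a + h < P.border e (P.pieceIndex e a + 1)) :
    P.pay e (a + h) = P.pay e a + P.slopeAt e a * h := by
  rw [P.pay_eq e ha, P.pay_eq e (add_nonneg ha hh), slopeAt_eq, slopeAt_eq,
    P.pieceIndex_add e ha hh hb]
  ring

theorem slopeAt_nonneg (e : Fin m) (a : ℝ) : 0 ≤ P.slopeAt e a :=
  P.slope_nonneg e _ (P.pieceIndex_le e a)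

/-- Borders increase, so the infimum is attained at the next one. In the last interval the set is
empty and `sInf` has the default value 0, which is why that case is excluded. -/
theorem gap_eq (e : Fin m) {a : ℝ} (ha : 0 ≤ a) (h : P.pieceIndex e a < P.numBorders e) :
    P.gap e a = P.border e (P.pieceIndex e a + 1) - a := by
  refine IsLeast.csInf_eq ⟨⟨_, h, P.lt_border_of_pieceIndex_lt e (Nat.lt_succ_self _) h, rfl⟩, ?_⟩
  rintro r ⟨i, hi, hai, rfl⟩
  have : P.pieceIndex e a < i := by
    by_contra hc
    exact absurd ((P.border_mono e (not_lt.1 hc) (P.pieceIndex_le e a)).trans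
      (P.border_pieceIndex_le e ha)) (not_le.2 hai)
  linarith [P.border_mono e this hi]

theorem eventually_pay_add (e : Fin m) {a : ℝ} (ha : 0 ≤ a) :
    ∀ᶠ h in nhdsWithin (0 : ℝ) (Set.Ioi 0), P.pay e (a + h) = P.pay e a + P.slopeAt e a * h := by
  have h0 : ∀ᶠ h in nhdsWithin (0 : ℝ) (Set.Ioi 0), 0 < h := self_mem_nhdsWithin
  by_cases hi : P.pieceIndex e a < P.numBorders e
  · have hlt := P.lt_border_of_pieceIndex_lt e (Nat.lt_succ_self _) hi
    have : ∀ᶠ h in nhdsWithin (0 : ℝ) (Set.Ioi 0), h < P.border e (P.pieceIndex e a + 1) - a :=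
      nhdsWithin_le_nhds (Iio_mem_nhds (by linarith))
    filter_upwards [h0, this] with h h1 h2
    exact P.pay_add e ha h1.le fun _ => by linarith
  · filter_upwards [h0] with h h1
    exact P.pay_add e ha h1.le fun h => absurd h hi

/-- Compare right-hand increments in the no-fraud identity: for one small h > 0 that suits all of
the finitely many claims, each payment grows by its slope times h, while min a L grows by h below L
and by nothing from L on. -/
theorem sum_slopeAt (u : Fin n) {a : ℝ} (ha : 0 ≤ a) :
    ∑ e with N.debtor e = u, P.slopeAt e a = if a < N.outLiability u then 1 else 0 := by
  have h0 : ∀ᶠ h in nhdsWithin (0 : ℝ) (Set.Ioi 0), 0 < h := self_mem_nhdsWithin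
  have h1 : ∀ᶠ h in nhdsWithin (0 : ℝ) (Set.Ioi 0), a < N.outLiability u →
      h < N.outLiability u - a := by
    by_cases hL : a < N.outLiability u
    · have : ∀ᶠ h in nhdsWithin (0 : ℝ) (Set.Ioi 0), h < N.outLiability u - a :=
        nhdsWithin_le_nhds (Iio_mem_nhds (by linarith))
      filter_upwards [this] with h hh _ using hh
    · exact Filter.Eventually.of_forall fun _ h => absurd h hL
  have h2 := Filter.eventually_all.2 fun e => P.eventually_pay_add e ha
  obtain ⟨h, hpos, hL, hp⟩ := (h0.and (h1.and h2)).exists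
  have hs := P.no_fraud u (a + h) (by linarith)
  rw [Finset.sum_congr rfl fun e _ => hp e, Finset.sum_add_distrib, ← Finset.sum_mul,
    P.no_fraud u a ha] at hs
  split_ifs with hlt
  · have := hL hlt
    rw [min_eq_left hlt.le, min_eq_left (by linarith)] at hs
    have : (∑ e with N.debtor e = u, P.slopeAt e a - 1) * h = 0 := by linarith
    rcases mul_eq_zero.1 this with h | h <;> linarith
  · rw [min_eq_right (not_lt.1 hlt), min_eq_right (by linarith [not_lt.1 hlt])] at hs
    have : (∑ e with N.debtor e = u, P.slopeAt e a) * h = 0 := by linarith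
    rcases mul_eq_zero.1 this with h | h <;> linarith

/-- From L on the non-negative slopes sum to zero. So an active claim is never in its last,
unbounded interval, and its gap is a genuine positive distance. -/
theorem lt_outLiability (e : Fin m) {a : ℝ} (ha : 0 ≤ a) (h : 0 < P.slopeAt e a) :
    a < N.outLiability (N.debtor e) := by
  by_contra hc
  have hs := P.sum_slopeAt (N.debtor e) ha
  rw [if_neg hc, Finset.sum_eq_zero_iff_of_nonneg fun e _ => P.slopeAt_nonneg e a] at hs
  have := hs e (by simp)
  linarith

theorem pieceIndex_lt (e : Fin m) {a : ℝ} (ha : 0 ≤ a) (h : 0 < P.slopeAt e a) :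
    P.pieceIndex e a < P.numBorders e := by
  refine (P.pieceIndex_le e a).lt_of_ne fun hc => ?_
  have h1 := P.border_pieceIndex_le e ha
  rw [hc, P.border_last] at h1
  exact absurd (P.lt_outLiability e ha h) (not_lt.2 h1)

theorem gap_pos (e : Fin m) {a : ℝ} (ha : 0 ≤ a) (h : 0 < P.slopeAt e a) : 0 < P.gap e a := by
  have hi := P.pieceIndex_lt e ha h
  rw [P.gap_eq e ha hi]
  linarith [P.lt_border_of_pieceIndex_lt e (Nat.lt_succ_self _) hi]

theorem pay_add_of_lt_gap (e : Fin m) {a h : ℝ} (ha : 0 ≤ a) (hh : 0 ≤ h)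
    (hg : h < P.gap e a) :
    P.pay e (a + h) = P.pay e a + P.slopeAt e a * h := by
  refine P.pay_add e ha hh fun hi => ?_
  rw [P.gap_eq e ha hi] at hg
  linarith

theorem pay_le_of_le (e : Fin m) {a a' : ℝ} (ha : 0 ≤ a) (h : a ≤ a') : P.pay e a ≤ P.pay e a' :=
  P.pay_mono e ha (ha.trans h) h

/-- Pieces are half open and continuity is not assumed, so linearity alone misses the end point h =
gap. Monotonicity yields "at least" for each claim of u, as a limit from the left; no fraud yields
"at most" for the sum over these claims; hence equality holds for each of them. -/
theorem pay_add_of_le_gap (u : Fin n) {a h : ℝ} (ha : 0 ≤ a) (hh : 0 ≤ h)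
    (hg : ∀ e, N.debtor e = u → 0 < P.slopeAt e a → h ≤ P.gap e a) (e : Fin m)
    (he : N.debtor e = u) : P.pay e (a + h) = P.pay e a + P.slopeAt e a * h := by
  have hle : ∀ e ∈ Finset.univ.filter (fun e => N.debtor e = u),
      P.pay e a + P.slopeAt e a * h ≤ P.pay e (a + h) := by
    intro e he
    have he := (Finset.mem_filter.1 he).2
    rcases (P.slopeAt_nonneg e a).eq_or_lt with h0 | h0
    · rw [← h0, zero_mul, add_zero]
      exact P.pay_le_of_le e ha (by linarith)
    · rcases hh.eq_or_lt with rfl | hh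
      · simp
      refine le_of_forall_lt fun c hc => ?_
      obtain ⟨h', hh1, hh2, hh3⟩ : ∃ h', 0 ≤ h' ∧ h' < h ∧ c < P.pay e a + P.slopeAt e a * h' := by
        -- The second entry of the maximum makes the linear value the midpoint between c and the
        -- target; the maximum with 0 keeps h' non-negative.
        refine ⟨max 0 (h - (P.pay e a + P.slopeAt e a * h - c) / (2 * P.slopeAt e a)),
          le_max_left _ _, max_lt hh ?_, ?_⟩
        · have : 0 < (P.pay e a + P.slopeAt e a * h - c) / (2 * P.slopeAt e a) :=
            div_pos (by linarith) (by linarith)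
          linarith
        · have h3 := mul_le_mul_of_nonneg_left (le_max_right 0
            (h - (P.pay e a + P.slopeAt e a * h - c) / (2 * P.slopeAt e a))) h0.le
          have h4 : P.slopeAt e a * (h - (P.pay e a + P.slopeAt e a * h - c) / (2 * P.slopeAt e a))
              = P.slopeAt e a * h - (P.pay e a + P.slopeAt e a * h - c) / 2 := by
            field_simp
          linarith
      rw [← P.pay_add_of_lt_gap e ha hh1 (hh2.trans_le (hg e he h0))] at hh3
      exact hh3.trans_le (P.pay_le_of_le e (by linarith) (by linarith))
  have hsum : ∑ e with N.debtor e = u, P.pay e (a + h)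
      ≤ ∑ e with N.debtor e = u, (P.pay e a + P.slopeAt e a * h) := by
    rw [Finset.sum_add_distrib, ← Finset.sum_mul, P.sum_slopeAt u ha, P.no_fraud u a ha,
      P.no_fraud u _ (add_nonneg ha hh)]
    split_ifs with hlt
    · rw [min_eq_left hlt.le, one_mul]
      exact min_le_left _ _
    · rw [min_eq_right (not_lt.1 hlt), zero_mul, add_zero]
      exact min_le_right _ _
  have := (Finset.sum_eq_sum_iff_of_le hle).1 (le_antisymm (Finset.sum_le_sum hle) hsum)
  exact (this e (by simp [he])).symm

theorem pay_lt_pay (e : Fin m) {a a' : ℝ} (ha : 0 ≤ a) (h : a < a') (he : 0 < P.slopeAt e a) :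
    P.pay e a < P.pay e a' := by
  have h0 : ∀ᶠ h in nhdsWithin (0 : ℝ) (Set.Ioi 0), 0 < h := self_mem_nhdsWithin
  have h1 : ∀ᶠ h in nhdsWithin (0 : ℝ) (Set.Ioi 0), h < a' - a :=
    nhdsWithin_le_nhds (Iio_mem_nhds (by linarith))
  obtain ⟨h, hpos, hl, hp⟩ := (h0.and (h1.and (P.eventually_pay_add e ha))).exists
  have := mul_pos he hpos
  have := P.pay_le_of_le e (a := a + h) (a' := a') (by linarith) (by linarith)
  linarith

theorem outLiability_nonneg (N : FinancialNetwork n m) (u : Fin n) : 0 ≤ N.outLiability u :=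
  Finset.sum_nonneg fun e _ => N.liability_nonneg e

theorem pay_zero (e : Fin m) : P.pay e 0 = 0 := by
  have := P.no_fraud (N.debtor e) 0 le_rfl
  rw [min_eq_left (outLiability_nonneg N _),
    Finset.sum_eq_zero_iff_of_nonneg fun e _ => (P.pay_mem e 0 le_rfl).1] at this
  exact this e (by simp)

/-! ## The matrix of slopes -/

/-- The entry `(w, u)` is the total slope of the claims from `u` to `w`. -/
noncomputable def slopeMatrix (b : Fin n → ℝ) (w u : Fin n) : ℝ :=
  ∑ e with N.creditor e = w ∧ N.debtor e = u, P.slopeIn b e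

theorem slopeIn_nonneg (b : Fin n → ℝ) (e : Fin m) : 0 ≤ P.slopeIn b e := P.slopeAt_nonneg e _

theorem slopeMatrix_nonneg (b : Fin n → ℝ) (w u : Fin n) : 0 ≤ P.slopeMatrix b w u :=
  Finset.sum_nonneg fun e _ => P.slopeIn_nonneg b e

theorem slopeMatrix_pos {b : Fin n → ℝ} {w u : Fin n} :
    0 < P.slopeMatrix b w u ↔ P.ActiveAdj b u w := by
  constructor
  · intro h
    obtain ⟨e, he, h⟩ := Finset.exists_lt_of_sum_lt (f := fun _ => (0 : ℝ))
      (by simpa [slopeMatrix] using h)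
    simp only [Finset.mem_filter, Finset.mem_univ, true_and] at he
    exact ⟨e, h, he.2, he.1⟩
  · rintro ⟨e, he, h1, h2⟩
    exact Finset.sum_pos' (fun e _ => P.slopeIn_nonneg b e) ⟨e, by simp [h1, h2], he⟩

theorem sum_slopeMatrix {b : Fin n → ℝ} (u : Fin n) (hb : 0 ≤ b u) :
    ∑ w, P.slopeMatrix b w u = if b u < N.outLiability u then 1 else 0 := by
  rw [← P.sum_slopeAt u hb]
  simp only [slopeMatrix, Finset.sum_filter]
  rw [Finset.sum_comm]
  refine Finset.sum_congr rfl fun e _ => ?_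
  by_cases h : N.debtor e = u
  · subst h
    simp [slopeIn]
  · simp [h]

theorem sum_slopeMatrix_le_one {b : Fin n → ℝ} (u : Fin n) (hb : 0 ≤ b u) :
    ∑ w, P.slopeMatrix b w u ≤ 1 := by
  rw [P.sum_slopeMatrix u hb]
  split_ifs <;> norm_num

theorem sum_slopeMatrix_eq_one {b : Fin n → ℝ} {u w : Fin n} (hb : 0 ≤ b u)
    (h : P.ActiveAdj b u w) : ∑ w, P.slopeMatrix b w u = 1 := by
  obtain ⟨e, he, rfl, -⟩ := h
  rw [P.sum_slopeMatrix _ hb, if_pos (P.lt_outLiability e hb he)]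

theorem sum_slopeIn_mul (b d : Fin n → ℝ) (w : Fin n) :
    ∑ e with N.creditor e = w, P.slopeIn b e * d (N.debtor e)
      = ∑ u, P.slopeMatrix b w u * d u := by
  simp only [slopeMatrix, Finset.sum_mul, Finset.sum_filter]
  rw [Finset.sum_comm]
  refine Finset.sum_congr rfl fun e _ => ?_
  by_cases h : N.creditor e = w <;> simp [h, ite_mul]

open Classical in
theorem sum_active (b d : Fin n → ℝ) (w : Fin n) :
    ∑ e with N.creditor e = w ∧ P.Active b e, P.slopeIn b e * d (N.debtor e)
      = ∑ u, P.slopeMatrix b w u * d u := by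
  rw [← P.sum_slopeIn_mul, ← Finset.filter_filter]
  refine Finset.sum_filter_of_ne fun e _ h => ?_
  refine (P.slopeIn_nonneg b e).lt_of_ne fun hc => h ?_
  rw [← hc, zero_mul]

open Classical in
theorem sum_active_of_support (b d : Fin n → ℝ) (w : Fin n) (C : Finset (Fin n))
    (hd : ∀ u, u ∉ C → d u = 0) :
    ∑ e with N.creditor e = w ∧ N.debtor e ∈ C ∧ P.Active b e, P.slopeIn b e * d (N.debtor e)
      = ∑ u, P.slopeMatrix b w u * d u := by
  rw [← P.sum_active]
  refine Finset.sum_subset (fun e => by simp +contextual) fun e h1 h2 => ?_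
  simp only [Finset.mem_filter, Finset.mem_univ, true_and] at h1 h2
  rw [hd _ fun hc => h2 ⟨h1.1, hc, h1.2⟩, mul_zero]

end PiecewiseLinearPayments

/-! ## Transient substochastic systems -/

section Transient

variable {ι : Type*} [Fintype ι]

/-- `Q w u` is the flow from `u` to `w`: non-negative, at most one unit leaves each node, and
every node leads to a node that loses flow. -/
structure IsTransient (Q : ι → ι → ℝ) : Prop where
  nonneg : ∀ w u, 0 ≤ Q w u
  sum_le : ∀ u, ∑ w, Q w u ≤ 1
  exit : ∀ u, ∃ w, Relation.ReflTransGen (fun u w => 0 < Q w u) u w ∧ ∑ x, Q x w < 1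

namespace IsTransient

variable {Q : ι → ι → ℝ}

/-- Sum the inequalities: Σx ≤ Σ(column sum)·x ≤ Σx, so all of them are equalities. Thus x vanishes
at every node that loses flow, and x = Qx carries the zero backwards along positive entries, from an
exit to every node that leads to it. -/
theorem eq_zero_of_le (hQ : IsTransient Q) {x : ι → ℝ} (hx : ∀ w, 0 ≤ x w)
    (h : ∀ w, x w ≤ ∑ u, Q w u * x u) (w : ι) : x w = 0 := by
  have h1 : ∑ w, ∑ u, Q w u * x u = ∑ u, (∑ w, Q w u) * x u := by
    rw [Finset.sum_comm]
    simp only [Finset.sum_mul]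
  have h2 : ∀ u ∈ Finset.univ, (∑ w, Q w u) * x u ≤ x u := fun u _ =>
    mul_le_of_le_one_left (hx u) (hQ.sum_le u)
  have h3 : ∑ w, x w ≤ ∑ w, ∑ u, Q w u * x u := Finset.sum_le_sum fun w _ => h w
  have h4 : ∑ u, (∑ w, Q w u) * x u ≤ ∑ u, x u := Finset.sum_le_sum h2
  have h5 := (Finset.sum_eq_sum_iff_of_le h2).1 (by linarith)
  have h6 := (Finset.sum_eq_sum_iff_of_le fun w _ => h w).1 (by linarith)
  obtain ⟨z, hz, hlt⟩ := hQ.exit w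
  induction hz using Relation.ReflTransGen.head_induction_on with
  | refl =>
    have := h5 z (Finset.mem_univ _)
    have h7 : (1 - ∑ w, Q w z) * x z = 0 := by linarith
    rcases mul_eq_zero.1 h7 with h8 | h8
    · linarith
    · exact h8
  | @head u y huy _ ih =>
    have h7 := h6 y (Finset.mem_univ _)
    rw [ih, eq_comm, Finset.sum_eq_zero_iff_of_nonneg
      fun u _ => mul_nonneg (hQ.nonneg y u) (hx u)] at h7
    rcases mul_eq_zero.1 (h7 u (Finset.mem_univ _)) with h8 | h8
    · linarith
    · exact h8

theorem eq_zero (hQ : IsTransient Q) {x : ι → ℝ} (h : ∀ w, x w = ∑ u, Q w u * x u) (w : ι) :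
    x w = 0 := by
  refine abs_eq_zero.1 (hQ.eq_zero_of_le (x := fun w => |x w|) (fun w => abs_nonneg _)
    (fun w => ?_) w)
  calc |x w| = |∑ u, Q w u * x u| := by rw [← h w]
    _ ≤ ∑ u, |Q w u * x u| := Finset.abs_sum_le_sum_abs _ _
    _ = ∑ u, Q w u * |x u| :=
      Finset.sum_congr rfl fun u _ => by rw [abs_mul, abs_of_nonneg (hQ.nonneg w u)]

/-- I − Q is injective by `eq_zero`, hence surjective in finite dimension. -/
theorem exists_solution (hQ : IsTransient Q) (c : ι → ℝ) :
    ∃ y : ι → ℝ, ∀ w, y w = c w + ∑ u, Q w u * y u := by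
  let T : (ι → ℝ) →ₗ[ℝ] (ι → ℝ) := LinearMap.id - Matrix.mulVecLin (Matrix.of Q)
  have hT : ∀ y w, T y w = y w - ∑ u, Q w u * y u := fun y w => by
    simp [T, Matrix.mulVec, dotProduct]
  have hinj : Function.Injective T := by
    refine (injective_iff_map_eq_zero T).2 fun y hy => funext fun w => ?_
    refine hQ.eq_zero (fun w => ?_) w
    have := congrFun hy w
    rw [hT] at this
    exact sub_eq_zero.1 this
  obtain ⟨y, hy⟩ := LinearMap.injective_iff_surjective.1 hinj c
  refine ⟨y, fun w => ?_⟩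
  rw [← hy, hT]
  ring

/-- The negative part of y satisfies the inequality of `eq_zero_of_le`. -/
theorem nonneg_solution (hQ : IsTransient Q) {c y : ι → ℝ} (hc : ∀ w, 0 ≤ c w)
    (hy : ∀ w, y w = c w + ∑ u, Q w u * y u) (w : ι) : 0 ≤ y w := by
  have := hQ.eq_zero_of_le (x := fun w => max 0 (-y w)) (fun w => le_max_left _ _) (fun w => ?_) w
  · have h2 := le_max_right 0 (-y w)
    linarith
  · refine max_le (Finset.sum_nonneg fun u _ => mul_nonneg (hQ.nonneg w u) (le_max_left _ _)) ?_
    have : -∑ u, Q w u * y u ≤ ∑ u, Q w u * max 0 (-y u) := by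
      rw [← Finset.sum_neg_distrib]
      refine Finset.sum_le_sum fun u _ => ?_
      rw [← mul_neg]
      exact mul_le_mul_of_nonneg_left (le_max_right _ _) (hQ.nonneg w u)
    linarith [hy w, hc w]

theorem unique (hQ : IsTransient Q) {c y z : ι → ℝ} (hy : ∀ w, y w = c w + ∑ u, Q w u * y u)
    (hz : ∀ w, z w = c w + ∑ u, Q w u * z u) : z = y := by
  funext w
  refine sub_eq_zero.1 (hQ.eq_zero (x := fun w => z w - y w) (fun w => ?_) w)
  simp only [mul_sub, Finset.sum_sub_distrib]
  linarith [hy w, hz w]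

/-- This reduces both linear programs to one variable: a feasible direction is determined by the
amount t injected at the source. -/
theorem eq_smul [DecidableEq ι] (hQ : IsTransient Q) {s : ι} {y z : ι → ℝ} {t : ℝ}
    (hy : ∀ w, y w = (if w = s then 1 else 0) + ∑ u, Q w u * y u)
    (hz : ∀ w, z w = (if w = s then t else 0) + ∑ u, Q w u * z u) (w : ι) : z w = t * y w := by
  refine congrFun (hQ.unique (y := fun w => t * y w)
    (c := fun w => if w = s then t else 0) (fun w => ?_) hz) w
  rw [hy w, mul_add, Finset.mul_sum]
  congr 1
  · split_ifs <;> simp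
  · exact Finset.sum_congr rfl fun u _ => by ring

/-- The source has value at least 1, and positivity spreads along edges. Edges back into s are
exempt, since the flood matrix has a zero row there. -/
theorem pos_of_reach [DecidableEq ι] (hQ : IsTransient Q) {s : ι} {y : ι → ℝ}
    (hy : ∀ w, y w = (if w = s then 1 else 0) + ∑ u, Q w u * y u) {r : ι → ι → Prop}
    (hr : ∀ u w, Relation.ReflTransGen r s u → r u w → w ≠ s → 0 < Q w u) {w : ι}
    (h : Relation.ReflTransGen r s w) : 0 < y w := by
  have h0 : ∀ w, 0 ≤ y w := hQ.nonneg_solution (fun w => by split_ifs <;> simp) hy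
  have h1 : ∀ w u, 0 ≤ Q w u * y u := fun w u => mul_nonneg (hQ.nonneg w u) (h0 u)
  have hs : ∀ w, w = s → 0 < y w := by
    intro w hw
    have := Finset.sum_nonneg fun u (_ : u ∈ Finset.univ) => h1 w u
    rw [hy w, if_pos hw]
    linarith
  induction h with
  | refl => exact hs s rfl
  | @tail u w hu huw ih =>
    by_cases hw : w = s
    · exact hs w hw
    · have := Finset.single_le_sum (fun u _ => h1 w u) (Finset.mem_univ u)
      have h3 := mul_pos (hr u w hu huw hw) ih
      rw [hy w, if_neg hw]
      linarith

end IsTransient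

end Transient

namespace PiecewiseLinearPayments

variable {n m : ℕ} {N : FinancialNetwork n m} (P : PiecewiseLinearPayments N)

/-! ## The linear systems of the two programs -/

theorem ne_of_activeAdj {b : Fin n → ℝ} {u w : Fin n} (h : P.ActiveAdj b u w) : u ≠ w := by
  obtain ⟨e, -, rfl, rfl⟩ := h
  exact N.no_loops e

theorem reach_refl (b : Fin n → ℝ) (v : Fin n) : P.Reach b v v := Relation.ReflTransGen.refl

variable {P} in
theorem Reach.trans {b : Fin n → ℝ} {u v w : Fin n} (h : P.Reach b u v) (h' : P.Reach b v w) :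
    P.Reach b u w := Relation.ReflTransGen.trans h h'

variable {P} in
theorem Reach.tail {b : Fin n → ℝ} {u v w : Fin n} (h : P.Reach b u v) (h' : P.ActiveAdj b v w) :
    P.Reach b u w := Relation.ReflTransGen.tail h h'

/-- Among the banks reachable from v, take w with the fewest reachable banks. Whatever w reaches has
the same reachable set, so that set is a sink component; an outgoing claim of w makes it
non-trivial. -/
theorem exists_floodComponent {b : Fin n → ℝ} {v : Fin n}
    (h : ∀ w, P.Reach b v w → ∃ x, P.ActiveAdj b w x) : ∃ C, P.IsFloodComponent b v C := by
  classical
  obtain ⟨w, hw, hmin⟩ := Finset.exists_min_image (Finset.univ.filter fun w => P.Reach b v w)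
    (fun w => (Finset.univ.filter fun x => P.Reach b w x).card)
    ⟨v, by simpa using P.reach_refl b v⟩
  simp only [Finset.mem_filter, Finset.mem_univ, true_and] at hw hmin
  have hback : ∀ x, P.Reach b w x → P.Reach b x w := by
    intro x hx
    have hsub : (Finset.univ.filter fun z => P.Reach b x z) ⊆
        Finset.univ.filter fun z => P.Reach b w z := fun z => by
      simpa using fun hz : P.Reach b x z => hx.trans hz
    have heq := Finset.eq_of_subset_of_card_le hsub (hmin x (hw.trans hx))
    have : w ∈ Finset.univ.filter fun z => P.Reach b x z := by
      rw [heq]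
      simpa using P.reach_refl b w
    simpa using this
  have hww := P.reach_refl b w
  refine ⟨Finset.univ.filter fun x => P.Reach b w x, ⟨⟨w, by simpa using hww⟩, ?_⟩, ?_, ?_, w, ?_⟩
  · intro u hu x
    simp only [Finset.mem_filter, Finset.mem_univ, true_and] at hu ⊢
    exact ⟨fun hx => ⟨(hback u hu).trans hx, (hback x hx).trans hu⟩, fun hx => hu.trans hx.1⟩
  · obtain ⟨x, hx⟩ := h w hw
    exact ⟨w, by simpa using hww, x, by simpa using hww.tail hx,
      P.ne_of_activeAdj hx⟩
  · intro u hu x hx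
    simp only [Finset.mem_filter, Finset.mem_univ, true_and] at hu ⊢
    exact hu.tail hx
  · simpa using ⟨hww, hw⟩

variable {P}

namespace IsFloodComponent

variable {b : Fin n → ℝ} {v : Fin n} {C : Finset (Fin n)}

theorem mem_iff_reach (hC : P.IsFloodComponent b v C) {s : Fin n} (hs : s ∈ C) (w : Fin n) :
    w ∈ C ↔ P.Reach b s w := by
  refine ⟨fun hw => ((hC.1.2 s hs w).1 hw).1, fun h => ?_⟩
  induction h with
  | refl => exact hs
  | tail _ h ih => exact hC.2.2.1 _ ih _ h

theorem reach (hC : P.IsFloodComponent b v C) {s w : Fin n} (hs : s ∈ C) (hw : w ∈ C) :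
    P.Reach b s w := (hC.mem_iff_reach hs w).1 hw

theorem exists_activeAdj (hC : P.IsFloodComponent b v C) {s : Fin n} (hs : s ∈ C) :
    ∃ w ∈ C, P.ActiveAdj b s w := by
  obtain ⟨w, hw, hne⟩ := hC.2.1.exists_ne s
  rcases (hC.reach hs hw).cases_head with h | ⟨x, hx, -⟩
  · exact absurd h.symm hne
  · exact ⟨x, hC.2.2.1 s hs x hx, hx⟩

end IsFloodComponent

variable (P)

open Classical in
/-- The coefficients of the Increase-LP of `v`. -/
noncomputable def increaseMatrix (b : Fin n → ℝ) (v w u : Fin n) : ℝ :=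
  if P.Reach b v u then P.slopeMatrix b w u else 0

open Classical in
/-- The coefficients of the Flood-LP of the component of `s`, where `s` is a source. -/
noncomputable def floodMatrix (b : Fin n → ℝ) (s w u : Fin n) : ℝ :=
  if P.Reach b s u ∧ w ≠ s then P.slopeMatrix b w u else 0

/-- Columns of banks not reached from v are zero, and so are those of banks without active outgoing
claims. If a reached bank led to no such bank, `exists_floodComponent` would produce a flood
component reachable from v. -/
theorem isTransient_increaseMatrix {b : Fin n → ℝ} (hb : ∀ w, 0 ≤ b w) {v : Fin n}
    (hC : ∀ C, ¬ P.IsFloodComponent b v C) : IsTransient (P.increaseMatrix b v) := by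
  have hcol : ∀ u, ¬ P.Reach b v u ∨ (¬ ∃ w, P.ActiveAdj b u w) →
      ∑ w, P.increaseMatrix b v w u < 1 := by
    intro u hu
    rw [Finset.sum_eq_zero]
    · norm_num
    · intro w _
      unfold increaseMatrix
      split_ifs with h
      · refine le_antisymm (not_lt.1 fun hpos => ?_) (P.slopeMatrix_nonneg b w u)
        exact hu.elim (fun h' => h' h) fun h' => h' ⟨w, P.slopeMatrix_pos.1 hpos⟩
      · rfl
  refine ⟨fun w u => ?_, fun u => ?_, fun u => ?_⟩
  · unfold increaseMatrix
    split_ifs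
    exacts [P.slopeMatrix_nonneg b w u, le_rfl]
  · by_cases h : P.Reach b v u
    · simp only [increaseMatrix, if_pos h]
      exact P.sum_slopeMatrix_le_one u (hb u)
    · exact (hcol u (Or.inl h)).le
  · by_cases h : P.Reach b v u
    · by_contra! hne
      obtain ⟨C, hC'⟩ := P.exists_floodComponent (b := b) (v := u) fun w hw => by
        by_contra hcon
        refine absurd (hcol w (Or.inr hcon)) (not_lt.2 (hne w ?_))
        clear hne hcon
        induction hw with
        | refl => exact Relation.ReflTransGen.refl
        | @tail x y hx hxy ih =>
          refine ih.tail ?_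
          rw [increaseMatrix, if_pos (h.trans (show P.Reach b u x from hx))]
          exact P.slopeMatrix_pos.2 hxy
      obtain ⟨h1, h2, h3, x, hx, hux⟩ := hC'
      exact hC C ⟨h1, h2, h3, x, hx, h.trans hux⟩
    · exact ⟨u, Relation.ReflTransGen.refl, hcol u (Or.inl h)⟩

/-- Cutting the flow into s creates the leak: a predecessor of s loses the share that it would send
to s, and every bank of the component has a path to s. -/
theorem isTransient_floodMatrix {b : Fin n → ℝ} (hb : ∀ w, 0 ≤ b w) {v : Fin n}
    {C : Finset (Fin n)} (hC : P.IsFloodComponent b v C) {s : Fin n} (hs : s ∈ C) :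
    IsTransient (P.floodMatrix b s) := by
  have hnn : ∀ w u, 0 ≤ P.floodMatrix b s w u := fun w u => by
    unfold floodMatrix
    split_ifs
    exacts [P.slopeMatrix_nonneg b w u, le_rfl]
  have hle : ∀ w u, P.floodMatrix b s w u ≤ P.slopeMatrix b w u := fun w u => by
    unfold floodMatrix
    split_ifs
    exacts [le_rfl, P.slopeMatrix_nonneg b w u]
  have hreach : ∀ u, P.Reach b u s → P.Reach b s u → u ≠ s →
      ∃ w, Relation.ReflTransGen (fun u w => 0 < P.floodMatrix b s w u) u w ∧
        ∑ x, P.floodMatrix b s x w < 1 := by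
    intro u hu
    induction hu using Relation.ReflTransGen.head_induction_on with
    | refl => exact fun _ h => absurd rfl h
    | @head u w huw _ ih =>
      intro hsu hne
      by_cases hw : w = s
      · refine ⟨u, Relation.ReflTransGen.refl, ?_⟩
        refine (Finset.sum_lt_sum (fun x _ => hle x u) ⟨s, Finset.mem_univ _, ?_⟩).trans_le
          (P.sum_slopeMatrix_le_one u (hb u))
        subst hw
        simpa [floodMatrix] using P.slopeMatrix_pos.2 huw
      · obtain ⟨x, hx, hlt⟩ := ih (hsu.tail huw) hw
        refine ⟨x, Relation.ReflTransGen.head ?_ hx, hlt⟩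
        simpa [floodMatrix, hsu, hw] using P.slopeMatrix_pos.2 huw
  refine ⟨hnn, fun u => ?_, fun u => ?_⟩
  · exact (Finset.sum_le_sum fun w _ => hle w u).trans (P.sum_slopeMatrix_le_one u (hb u))
  · by_cases hsu : P.Reach b s u
    · by_cases hne : u = s
      · subst hne
        -- A path from s to s may be empty, so s first moves to a successor.
        obtain ⟨w, hw, hadj⟩ := hC.exists_activeAdj hs
        have hwu := (P.ne_of_activeAdj hadj).symm
        obtain ⟨x, hx, hlt⟩ := hreach w (hC.reach hw hs) (hC.reach hs hw) hwu
        refine ⟨x, Relation.ReflTransGen.head ?_ hx, hlt⟩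
        simpa [floodMatrix, hsu, hwu] using P.slopeMatrix_pos.2 hadj
      · exact hreach u (hC.reach ((hC.mem_iff_reach hs u).2 hsu) hs) hsu hne
    · exact ⟨u, Relation.ReflTransGen.refl, by simp [floodMatrix, hsu]⟩

theorem increaseMatrix_mul {b d : Fin n → ℝ} {v : Fin n} (hd : ∀ u, ¬ P.Reach b v u → d u = 0)
    (w : Fin n) : ∑ u, P.increaseMatrix b v w u * d u = ∑ u, P.slopeMatrix b w u * d u := by
  refine Finset.sum_congr rfl fun u _ => ?_
  by_cases h : P.Reach b v u
  · rw [increaseMatrix, if_pos h]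
  · rw [hd u h, mul_zero, mul_zero]

theorem floodMatrix_mul {b d : Fin n → ℝ} {s w : Fin n} (hd : ∀ u, ¬ P.Reach b s u → d u = 0)
    (hw : w ≠ s) : ∑ u, P.floodMatrix b s w u * d u = ∑ u, P.slopeMatrix b w u * d u := by
  refine Finset.sum_congr rfl fun u _ => ?_
  by_cases h : P.Reach b s u
  · rw [floodMatrix, if_pos ⟨h, hw⟩]
  · rw [hd u h, mul_zero, mul_zero]

theorem slopeMatrix_eq_zero {b : Fin n → ℝ} {v w u : Fin n} (hw : ¬ P.Reach b v w)
    (hu : P.Reach b v u) : P.slopeMatrix b w u = 0 :=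
  le_antisymm (not_lt.1 fun h => hw (hu.tail (P.slopeMatrix_pos.1 h)))
    (P.slopeMatrix_nonneg b w u)

end PiecewiseLinearPayments

namespace PiecewiseLinearPayments

variable {n m : ℕ} {N : FinancialNetwork n m} (P : PiecewiseLinearPayments N)

/-! ## Solutions of the Flood-LP -/

section Flood

variable {P} {b d : Fin n → ℝ} {v s : Fin n} {C : Finset (Fin n)} {y : Fin n → ℝ} {t : ℝ}

/-- No active claim leaves C, so the flow equation also holds outside C, with both sides zero. -/
theorem FloodFeasible.eq_slopeMatrix_mul (hC : P.IsFloodComponent b v C)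
    (hd : P.FloodFeasible b C d) (w : Fin n) : d w = ∑ u, P.slopeMatrix b w u * d u := by
  by_cases hw : w ∈ C
  · rw [hd.1 w hw, P.sum_active_of_support b d w C hd.2.2.2]
  · rw [hd.2.2.2 w hw, Finset.sum_eq_zero]
    intro u _
    by_cases hu : u ∈ C
    · rw [P.slopeMatrix_eq_zero (fun h => hw ((hC.mem_iff_reach hu w).2 h)) (P.reach_refl b u),
        zero_mul]
    · rw [hd.2.2.2 u hu, mul_zero]

theorem FloodFeasible.nonneg (hd : P.FloodFeasible b C d) (w : Fin n) : 0 ≤ d w := by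
  by_cases hw : w ∈ C
  · exact hd.2.2.1 w hw
  · exact (hd.2.2.2 w hw).ge

/-- Outside C the flow is zero and gaps are positive; thus both programs give the same bound on all
active claims. -/
theorem FloodFeasible.le_gap (hb : ∀ w, 0 ≤ b w) (hd : P.FloodFeasible b C d) (e : Fin m)
    (he : P.Active b e) : d (N.debtor e) ≤ P.gap e (b (N.debtor e)) := by
  by_cases hw : N.debtor e ∈ C
  · exact hd.2.1 e hw he
  · rw [hd.2.2.2 _ hw]
    exact (P.gap_pos e (hb _) he).le

theorem FloodFeasible.eq_floodMatrix_mul (hC : P.IsFloodComponent b v C) (hs : s ∈ C)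
    (hd : P.FloodFeasible b C d) (w : Fin n) :
    d w = (if w = s then d s else 0) + ∑ u, P.floodMatrix b s w u * d u := by
  by_cases hw : w = s
  · subst hw
    simp [floodMatrix]
  · rw [if_neg hw, zero_add, P.floodMatrix_mul _ hw]
    · exact hd.eq_slopeMatrix_mul hC w
    · exact fun u hu => hd.2.2.2 u fun h => hu ((hC.mem_iff_reach hs u).1 h)

theorem floodMatrix_solution_eq_zero
    (hy : ∀ w, y w = (if w = s then 1 else 0) + ∑ u, P.floodMatrix b s w u * y u) {w : Fin n}
    (hw : ¬ P.Reach b s w) : y w = 0 := by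
  have hws : w ≠ s := fun h => hw (h ▸ P.reach_refl b s)
  rw [hy w, if_neg hws, zero_add]
  refine Finset.sum_eq_zero fun u _ => ?_
  unfold floodMatrix
  split_ifs with h
  · rw [P.slopeMatrix_eq_zero hw h.1, zero_mul]
  · rw [zero_mul]

/-- The normalization y_s = 1 replaced the equation at s. That equation is implied by the others:
inside the component all columns of the slope matrix sum to 1, so the sum of all equations is an
identity. -/
theorem floodMatrix_solution_circulates (hb : ∀ w, 0 ≤ b w) (hC : P.IsFloodComponent b v C)
    (hs : s ∈ C) (hy : ∀ w, y w = (if w = s then 1 else 0) + ∑ u, P.floodMatrix b s w u * y u)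
    (w : Fin n) : y w = ∑ u, P.slopeMatrix b w u * y u := by
  have h0 : ∀ u, ¬ P.Reach b s u → y u = 0 := fun u => floodMatrix_solution_eq_zero hy
  have h1 : ∀ w, w ≠ s → y w = ∑ u, P.slopeMatrix b w u * y u := fun w hw => by
    rw [← P.floodMatrix_mul h0 hw]
    simpa [hw] using hy w
  by_cases hw : w = s
  · subst hw
    have h2 : ∑ w, ∑ u, P.slopeMatrix b w u * y u = ∑ w, y w := by
      rw [Finset.sum_comm]
      refine Finset.sum_congr rfl fun u _ => ?_
      rw [← Finset.sum_mul]
      by_cases hu : P.Reach b w u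
      · obtain ⟨x, -, hx⟩ := hC.exists_activeAdj ((hC.mem_iff_reach hs u).2 hu)
        rw [P.sum_slopeMatrix_eq_one (hb u) hx, one_mul]
      · rw [h0 u hu, mul_zero]
    rw [← Finset.add_sum_erase _ _ (Finset.mem_univ w),
      ← Finset.add_sum_erase _ y (Finset.mem_univ w),
      Finset.sum_congr rfl fun x hx => (h1 x (Finset.ne_of_mem_erase hx)).symm] at h2
    linarith
  · exact h1 w hw

theorem floodMatrix_solution_pos (hb : ∀ w, 0 ≤ b w) (hC : P.IsFloodComponent b v C)
    (hs : s ∈ C) (hy : ∀ w, y w = (if w = s then 1 else 0) + ∑ u, P.floodMatrix b s w u * y u)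
    {w : Fin n} (hw : P.Reach b s w) : 0 < y w := by
  refine (P.isTransient_floodMatrix hb hC hs).pos_of_reach hy (fun u w hu huw hw => ?_) hw
  rw [floodMatrix, if_pos ⟨hu, hw⟩]
  exact P.slopeMatrix_pos.2 huw

/-- Feasible points are multiples of y, which is positive on the component. The tight constraint
therefore bounds the multiplier of every competitor by t. -/
theorem floodOptimal_smul (hb : ∀ w, 0 ≤ b w) (hC : P.IsFloodComponent b v C) (hs : s ∈ C)
    (hy : ∀ w, y w = (if w = s then 1 else 0) + ∑ u, P.floodMatrix b s w u * y u)
    (hle : ∀ e, P.Active b e → P.Reach b s (N.debtor e) →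
      t * y (N.debtor e) ≤ P.gap e (b (N.debtor e)))
    (htight : ∃ e, P.Active b e ∧ P.Reach b s (N.debtor e) ∧
      t * y (N.debtor e) = P.gap e (b (N.debtor e))) :
    P.FloodOptimal b C (fun w => t * y w) := by
  have hpos := fun w => floodMatrix_solution_pos (w := w) hb hC hs hy
  have hmem := hC.mem_iff_reach hs
  have h0 : ∀ u, ¬ P.Reach b s u → y u = 0 := fun u => floodMatrix_solution_eq_zero hy
  obtain ⟨e, he, hr, hte⟩ := htight
  have ht : 0 < t := pos_of_mul_pos_left (hte ▸ P.gap_pos e (hb _) he) (hpos _ hr).le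
  refine ⟨⟨fun w _ => ?_, fun e hC he => hle e he ((hmem _).1 hC), fun w hw => ?_,
    fun w hw => ?_⟩, fun d' hd' => ?_⟩
  · rw [P.sum_active_of_support b (fun w => t * y w) w C fun u hu => by
      rw [h0 u fun h => hu ((hmem u).2 h), mul_zero]]
    beta_reduce
    rw [floodMatrix_solution_circulates hb hC hs hy w, Finset.mul_sum]
    exact Finset.sum_congr rfl fun u _ => by ring
  · exact mul_nonneg ht.le (hpos w ((hmem w).1 hw)).le
  · beta_reduce
    rw [h0 w fun h => hw ((hmem w).2 h), mul_zero]
  · have hd := (P.isTransient_floodMatrix hb hC hs).eq_smul hy (hd'.eq_floodMatrix_mul hC hs)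
    have h1 := hd'.2.1 e ((hmem _).2 hr) he
    rw [hd, ← hte] at h1
    have h2 := le_of_mul_le_mul_right h1 (hpos _ hr)
    refine Finset.sum_le_sum fun w hw => ?_
    rw [hd]
    exact mul_le_mul_of_nonneg_right h2 (hpos w ((hmem w).1 hw)).le

theorem exists_floodOptimal_tight (hb : ∀ w, 0 ≤ b w) (hC : P.IsFloodComponent b v C) :
    ∃ s ∈ C, ∃ (y : Fin n → ℝ) (t : ℝ),
      (∀ w, y w = (if w = s then 1 else 0) + ∑ u, P.floodMatrix b s w u * y u) ∧
      P.FloodOptimal b C (fun w => t * y w) ∧ ∃ e, P.Active b e ∧ P.Reach b s (N.debtor e) ∧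
        t * y (N.debtor e) = P.gap e (b (N.debtor e)) := by
  classical
  obtain ⟨s, hs⟩ := hC.1.1
  obtain ⟨y, hy⟩ := (P.isTransient_floodMatrix hb hC hs).exists_solution
    (fun w => if w = s then 1 else 0)
  have hpos := fun w => floodMatrix_solution_pos (w := w) hb hC hs hy
  obtain ⟨x, -, e, he, hes, -⟩ := hC.exists_activeAdj hs
  -- Ratio test: the largest admissible multiplier is the least quotient of gap and y.
  obtain ⟨e', he', hmin⟩ := Finset.exists_min_image
    (Finset.univ.filter fun e => P.Active b e ∧ P.Reach b s (N.debtor e))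
    (fun e => P.gap e (b (N.debtor e)) / y (N.debtor e))
    ⟨e, by simpa using ⟨he, hes ▸ P.reach_refl b s⟩⟩
  simp only [Finset.mem_filter, Finset.mem_univ, true_and, and_imp] at he' hmin
  have ht := div_mul_cancel₀ (P.gap e' (b (N.debtor e'))) (hpos _ he'.2).ne'
  refine ⟨s, hs, y, _, hy, floodOptimal_smul hb hC hs hy (fun e he hr => ?_)
    ⟨e', he'.1, he'.2, ht⟩, e', he'.1, he'.2, ht⟩
  exact (le_div_iff₀ (hpos _ hr)).1 (hmin e he hr)

/-- The given optimum need not be the constructed one, but both are multiples of y. Comparing the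
objectives bounds its multiplier from below by t, so it meets the same border. -/
theorem FloodOptimal.exists_tight (hb : ∀ w, 0 ≤ b w) (hC : P.IsFloodComponent b v C)
    (hd : P.FloodOptimal b C d) :
    ∃ e, P.Active b e ∧ d (N.debtor e) = P.gap e (b (N.debtor e)) := by
  obtain ⟨s, hs, y, t, hy, ho, e, he, hr, ht⟩ := exists_floodOptimal_tight hb hC
  have hpos := fun w => floodMatrix_solution_pos (w := w) hb hC hs hy
  have hd' := (P.isTransient_floodMatrix hb hC hs).eq_smul hy (hd.1.eq_floodMatrix_mul hC hs)
  refine ⟨e, he, le_antisymm (hd.1.le_gap hb e he) ?_⟩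
  rw [← ht, hd']
  refine mul_le_mul_of_nonneg_right ?_ (hpos _ hr).le
  have h1 := hd.2 _ ho.1
  rw [Finset.sum_congr rfl fun w _ => hd' w, ← Finset.mul_sum, ← Finset.mul_sum] at h1
  exact le_of_mul_le_mul_right h1
    (Finset.sum_pos (fun w hw => hpos w ((hC.mem_iff_reach hs w).1 hw)) ⟨s, hs⟩)

end Flood

/-! ## Solutions of the Increase-LP -/

section Increase

variable {P} {bx b d : Fin n → ℝ} {v : Fin n} {y : Fin n → ℝ} {t δ : ℝ}

theorem IncreaseFeasible.eq_slopeMatrix_mul (hd : P.IncreaseFeasible bx b v δ d) (w : Fin n) :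
    d w = (if w = v then δ else 0) + ∑ u, P.slopeMatrix b w u * d u := by
  rw [← P.sum_active]
  by_cases hw : w = v
  · subst hw
    rw [if_pos rfl]
    exact hd.1
  · rw [if_neg hw, zero_add]
    by_cases hr : P.Reach b v w
    · exact hd.2.1 w hw hr
    · rw [hd.2.2.1 w hw hr, P.sum_active, Finset.sum_eq_zero]
      intro u _
      by_cases hu : P.Reach b v u
      · rw [P.slopeMatrix_eq_zero hr hu, zero_mul]
      · rw [hd.2.2.1 u (fun h => hu (h ▸ P.reach_refl b v)) hu, mul_zero]

theorem IncreaseFeasible.eq_zero (hd : P.IncreaseFeasible bx b v δ d) {w : Fin n}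
    (hw : ¬ P.Reach b v w) : d w = 0 :=
  hd.2.2.1 w (fun h => hw (h ▸ P.reach_refl b v)) hw

theorem IncreaseFeasible.eq_increaseMatrix_mul (hd : P.IncreaseFeasible bx b v δ d) (w : Fin n) :
    d w = (if w = v then δ else 0) + ∑ u, P.increaseMatrix b v w u * d u := by
  rw [P.increaseMatrix_mul fun u hu => hd.eq_zero hu]
  exact hd.eq_slopeMatrix_mul w

theorem increaseMatrix_solution_eq_zero
    (hy : ∀ w, y w = (if w = v then 1 else 0) + ∑ u, P.increaseMatrix b v w u * y u) {w : Fin n}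
    (hw : ¬ P.Reach b v w) : y w = 0 := by
  have hwv : w ≠ v := fun h => hw (h ▸ P.reach_refl b v)
  rw [hy w, if_neg hwv, zero_add]
  refine Finset.sum_eq_zero fun u _ => ?_
  unfold increaseMatrix
  split_ifs with h
  · rw [P.slopeMatrix_eq_zero hw h, zero_mul]
  · rw [zero_mul]

theorem increaseMatrix_solution_pos (hb : ∀ w, 0 ≤ b w) (hC : ∀ C, ¬ P.IsFloodComponent b v C)
    (hy : ∀ w, y w = (if w = v then 1 else 0) + ∑ u, P.increaseMatrix b v w u * y u)
    {w : Fin n} (hw : P.Reach b v w) : 0 < y w := by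
  refine (P.isTransient_increaseMatrix hb hC).pos_of_reach hy (fun u w hu huw hw => ?_) hw
  rw [increaseMatrix, if_pos (show P.Reach b v u from hu)]
  exact P.slopeMatrix_pos.2 huw

theorem IncreaseFeasible.eq_smul (hb : ∀ w, 0 ≤ b w) (hC : ∀ C, ¬ P.IsFloodComponent b v C)
    (hy : ∀ w, y w = (if w = v then 1 else 0) + ∑ u, P.increaseMatrix b v w u * y u)
    (hd : P.IncreaseFeasible bx b v δ d) (w : Fin n) : d w = δ * y w :=
  (P.isTransient_increaseMatrix hb hC).eq_smul hy hd.eq_increaseMatrix_mul w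

/-- The multiplier of y is now the objective itself, so one tight constraint, a border or the
remaining external assets, proves optimality. -/
theorem increaseOptimal_smul (hb : ∀ w, 0 ≤ b w) (hC : ∀ C, ¬ P.IsFloodComponent b v C)
    (hy : ∀ w, y w = (if w = v then 1 else 0) + ∑ u, P.increaseMatrix b v w u * y u)
    (hv : bx v ≤ N.extAssets v) (ht : t ≤ N.extAssets v - bx v)
    (hle : ∀ e, P.Active b e → P.Reach b v (N.debtor e) →
      t * y (N.debtor e) ≤ P.gap e (b (N.debtor e)))
    (htight : t = N.extAssets v - bx v ∨ ∃ e, P.Active b e ∧ P.Reach b v (N.debtor e) ∧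
      t * y (N.debtor e) = P.gap e (b (N.debtor e))) :
    P.IncreaseOptimal bx b v t (fun w => t * y w) := by
  have hpos := fun w => increaseMatrix_solution_pos (w := w) hb hC hy
  have h0 : ∀ u, ¬ P.Reach b v u → y u = 0 := fun u => increaseMatrix_solution_eq_zero hy
  have hnn : ∀ w, 0 ≤ y w := fun w => by
    by_cases h : P.Reach b v w
    · exact (hpos w h).le
    · exact (h0 w h).ge
  have ht0 : 0 ≤ t := by
    rcases htight with rfl | ⟨e, he, hr, hte⟩
    · linarith
    · exact (pos_of_mul_pos_left (hte ▸ P.gap_pos e (hb _) he) (hpos _ hr).le).le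
  have heq : ∀ w, t * y w = (if w = v then t else 0) + ∑ u, P.slopeMatrix b w u * (t * y u) := by
    intro w
    conv_lhs => rw [hy w, P.increaseMatrix_mul h0, mul_add, Finset.mul_sum]
    congr 1
    · split_ifs <;> simp
    · exact Finset.sum_congr rfl fun u _ => by ring
  refine ⟨⟨?_, fun w hw _ => ?_, fun w _ hr => ?_, fun e he => ?_, ht,
    fun w => mul_nonneg ht0 (hnn w)⟩, fun δ' d' hd' => ?_⟩
  · rw [P.sum_active b (fun w => t * y w)]
    simpa using heq v
  · rw [P.sum_active b (fun w => t * y w)]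
    simpa [hw] using heq w
  · beta_reduce
    rw [h0 w hr, mul_zero]
  · by_cases hr : P.Reach b v (N.debtor e)
    · exact hle e he hr
    · beta_reduce
      rw [h0 _ hr, mul_zero]
      exact (P.gap_pos e (hb _) he).le
  · rcases htight with rfl | ⟨e, he, hr, hte⟩
    · exact hd'.2.2.2.2.1
    · have h1 := hd'.2.2.2.1 e he
      rw [hd'.eq_smul hb hC hy, ← hte] at h1
      exact le_of_mul_le_mul_right h1 (hpos _ hr)

theorem exists_increaseOptimal_tight (hb : ∀ w, 0 ≤ b w) (hC : ∀ C, ¬ P.IsFloodComponent b v C)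
    (hv : bx v ≤ N.extAssets v) :
    ∃ (y : Fin n → ℝ) (t : ℝ),
      (∀ w, y w = (if w = v then 1 else 0) + ∑ u, P.increaseMatrix b v w u * y u) ∧
      P.IncreaseOptimal bx b v t (fun w => t * y w) ∧
      (t = N.extAssets v - bx v ∨ ∃ e, P.Active b e ∧ P.Reach b v (N.debtor e) ∧
        t * y (N.debtor e) = P.gap e (b (N.debtor e))) := by
  classical
  obtain ⟨y, hy⟩ := (P.isTransient_increaseMatrix hb hC).exists_solution
    (fun w => if w = v then 1 else 0)
  have hpos := fun w => increaseMatrix_solution_pos (w := w) hb hC hy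
  obtain ⟨t, ht, hle, htight⟩ : ∃ t, t ≤ N.extAssets v - bx v ∧
      (∀ e, P.Active b e → P.Reach b v (N.debtor e) →
        t * y (N.debtor e) ≤ P.gap e (b (N.debtor e))) ∧
      (t = N.extAssets v - bx v ∨ ∃ e, P.Active b e ∧ P.Reach b v (N.debtor e) ∧
        t * y (N.debtor e) = P.gap e (b (N.debtor e))) := by
    -- Either all remaining external assets can be injected without crossing a border, or the ratio
    -- test decides; in the second case the violated constraint shows that the least ratio is below
    -- the remaining amount.
    by_cases hall : ∀ e, P.Active b e → P.Reach b v (N.debtor e) →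
        (N.extAssets v - bx v) * y (N.debtor e) ≤ P.gap e (b (N.debtor e))
    · exact ⟨_, le_rfl, hall, Or.inl rfl⟩
    · push Not at hall
      obtain ⟨e, he, hr, hlt⟩ := hall
      obtain ⟨e', he', hmin⟩ := Finset.exists_min_image
        (Finset.univ.filter fun e => P.Active b e ∧ P.Reach b v (N.debtor e))
        (fun e => P.gap e (b (N.debtor e)) / y (N.debtor e)) ⟨e, by simpa using ⟨he, hr⟩⟩
      simp only [Finset.mem_filter, Finset.mem_univ, true_and, and_imp] at he' hmin
      refine ⟨_, (hmin e he hr).trans ((div_le_iff₀ (hpos _ hr)).2 hlt.le), fun e he hr =>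
        (le_div_iff₀ (hpos _ hr)).1 (hmin e he hr),
        Or.inr ⟨e', he'.1, he'.2, div_mul_cancel₀ _ (hpos _ he'.2).ne'⟩⟩
  exact ⟨y, t, hy, increaseOptimal_smul hb hC hy hv ht hle htight, htight⟩

theorem IncreaseOptimal.tight (hb : ∀ w, 0 ≤ b w) (hC : ∀ C, ¬ P.IsFloodComponent b v C)
    (hv : bx v ≤ N.extAssets v) (hd : P.IncreaseOptimal bx b v δ d) :
    δ = N.extAssets v - bx v ∨ ∃ e, P.Active b e ∧ d (N.debtor e) = P.gap e (b (N.debtor e)) := by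
  obtain ⟨y, t, hy, ho, htight⟩ := exists_increaseOptimal_tight hb hC hv
  have hδ : δ = t := le_antisymm (ho.2 _ _ hd.1) (hd.2 _ _ ho.1)
  subst hδ
  refine htight.imp id fun ⟨e, he, _, ht⟩ => ⟨e, he, ?_⟩
  rw [← ht, hd.1.eq_smul hb hC hy]

theorem IncreaseOptimal.nonneg (hb : ∀ w, 0 ≤ b w) (hv : bx v ≤ N.extAssets v)
    (hd : P.IncreaseOptimal bx b v δ d) : 0 ≤ δ := by
  refine hd.2 0 0 ⟨by simp, by simp, by simp, fun e he => ?_, by linarith, by simp⟩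
  exact (P.gap_pos e (hb _) he).le

end Increase

end PiecewiseLinearPayments

namespace PiecewiseLinearPayments

variable {n m : ℕ} {N : FinancialNetwork n m} (P : PiecewiseLinearPayments N)

/-! ## The algorithm stays below every clearing state -/

/-- `b ≥ 0` is a clearing state for the external assets `bx`. -/
def ClearsFor (bx b : Fin n → ℝ) : Prop :=
  (∀ w, 0 ≤ b w) ∧
    ∀ w, b w = bx w + ∑ e with N.creditor e = w, P.pay e (b (N.debtor e))

variable {P}

section Domination

variable {bx b d a : Fin n → ℝ} {v : Fin n}

/-- The bound on d is used for all active claims of the debtor, since linearity at the end of a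
piece comes from the sum of their payments. -/
theorem pay_add_eq (hb : ∀ w, 0 ≤ b w)
    (hg : ∀ e, P.Active b e → d (N.debtor e) ≤ P.gap e (b (N.debtor e))) (e : Fin m) {h : ℝ}
    (h0 : 0 ≤ h) (hh : h ≤ d (N.debtor e)) :
    P.pay e (b (N.debtor e) + h) = P.pay e (b (N.debtor e)) + P.slopeIn b e * h := by
  refine P.pay_add_of_le_gap (N.debtor e) (hb _) h0 (fun e' he' hs => hh.trans ?_) e rfl
  have := hg e'
  rw [he'] at this
  refine this ?_
  rwa [Active, slopeIn, he']

theorem sum_pay_add (hb : ∀ w, 0 ≤ b w)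
    (hg : ∀ e, P.Active b e → d (N.debtor e) ≤ P.gap e (b (N.debtor e))) {h : Fin n → ℝ}
    (h0 : ∀ w, 0 ≤ h w) (hh : ∀ w, h w ≤ d w) (w : Fin n) :
    ∑ e with N.creditor e = w, P.pay e (b (N.debtor e) + h (N.debtor e))
      = ∑ e with N.creditor e = w, P.pay e (b (N.debtor e))
        + ∑ u, P.slopeMatrix b w u * h u := by
  rw [← P.sum_slopeIn_mul, ← Finset.sum_add_distrib]
  exact Finset.sum_congr rfl fun e _ => pay_add_eq hb hg e (h0 _) (hh _)

/-- Incoming payments grow by Md, so the external assets must account for d − Md. This is 0 in a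
flood step and δ·e_v in an increase step. -/
theorem ClearsFor.add (hb : P.ClearsFor bx b) (hd : ∀ w, 0 ≤ d w)
    (hg : ∀ e, P.Active b e → d (N.debtor e) ≤ P.gap e (b (N.debtor e))) :
    P.ClearsFor (fun w => bx w + (d w - ∑ u, P.slopeMatrix b w u * d u)) (b + d) := by
  refine ⟨fun w => add_nonneg (hb.1 w) (hd w), fun w => ?_⟩
  simp only [Pi.add_apply]
  rw [sum_pay_add hb.1 hg hd fun _ => le_rfl]
  linarith [hb.2 w]

/-- The excess over a clearing state `a ≥ b` after a step along `d`. -/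
theorem excess_eq (hb : P.ClearsFor bx b) (ha : P.IsClearing a) (hba : ∀ w, b w ≤ a w)
    (hd : ∀ w, 0 ≤ d w)
    (hg : ∀ e, P.Active b e → d (N.debtor e) ≤ P.gap e (b (N.debtor e))) (w : Fin n) :
    b w + d w - a w = ∑ u, P.slopeMatrix b w u * max 0 (b u + d u - a u)
      - (N.extAssets w - bx w - (d w - ∑ u, P.slopeMatrix b w u * d u))
      - ∑ e with N.creditor e = w, (P.pay e (a (N.debtor e))
        - P.pay e (min (a (N.debtor e)) (b (N.debtor e) + d (N.debtor e)))) := by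
  -- The truncated state is b plus an increment between 0 and d, so payments are linear up to it;
  -- what a pays beyond it is the last sum.
  have h1 : ∀ u, min (a u) (b u + d u) = b u + (d u - max 0 (b u + d u - a u)) := fun u => by
    rcases le_total (a u) (b u + d u) with h | h
    · rw [min_eq_left h, max_eq_right (by linarith)]
      ring
    · rw [min_eq_right h, max_eq_left (by linarith)]
      ring
  have h2 := sum_pay_add hb.1 hg (h := fun u => d u - max 0 (b u + d u - a u))
    (fun u => by
      have : max 0 (b u + d u - a u) ≤ d u := max_le (hd u) (by linarith [hba u])
      linarith)
    (fun u => by linarith [le_max_left 0 (b u + d u - a u)]) w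
  rw [Finset.sum_sub_distrib]
  simp only [h1]
  simp only [mul_sub, Finset.sum_sub_distrib] at h2
  linarith [ha.2 w, hb.2 w]

/-- The missing external assets make b strictly smaller than a at v. Along an active claim, strictly
larger assets of the debtor give a strictly larger payment. -/
theorem lt_of_reach (hb : P.ClearsFor bx b) (ha : P.IsClearing a) (hba : ∀ w, b w ≤ a w)
    (hbx : ∀ w, bx w ≤ N.extAssets w) (hv : bx v < N.extAssets v) {w : Fin n}
    (h : P.Reach b v w) : b w < a w := by
  have hpay : ∀ e, P.pay e (b (N.debtor e)) ≤ P.pay e (a (N.debtor e)) := fun e =>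
    P.pay_le_of_le e (hb.1 _) (hba _)
  induction h with
  | refl =>
    rw [hb.2 v, ha.2 v]
    exact add_lt_add_of_lt_of_le hv (Finset.sum_le_sum fun e _ => hpay e)
  | @tail u w _ huw ih =>
    obtain ⟨e, he, rfl, rfl⟩ := huw
    rw [hb.2 (N.creditor e), ha.2 (N.creditor e)]
    exact add_lt_add_of_le_of_lt (hbx _) (Finset.sum_lt_sum (fun e _ => hpay e)
      ⟨e, by simp, P.pay_lt_pay e (hb.1 _) ih he⟩)

/-- The positive excess over a lives on banks reachable from v, and it is at most M times itself:
the injection δ stays within the external assets, and a pays at least as much as the truncated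
state. Transience makes the excess vanish. -/
theorem IncreaseFeasible.add_le {δ : ℝ} (hd : P.IncreaseFeasible bx b v δ d)
    (hC : ∀ C, ¬ P.IsFloodComponent b v C) (hb : P.ClearsFor bx b) (ha : P.IsClearing a)
    (hba : ∀ w, b w ≤ a w) (hbx : ∀ w, bx w ≤ N.extAssets w) (w : Fin n) :
    b w + d w ≤ a w := by
  have hd0 := hd.2.2.2.2.2
  have hx0 : ∀ u, ¬ P.Reach b v u → max 0 (b u + d u - a u) = 0 := fun u hu => by
    rw [hd.eq_zero hu, max_eq_left (by linarith [hba u])]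
  have := (P.isTransient_increaseMatrix hb.1 hC).eq_zero_of_le
    (x := fun w => max 0 (b w + d w - a w)) (fun w => le_max_left _ _) (fun w => ?_) w
  · linarith [le_max_right 0 (b w + d w - a w)]
  · rw [P.increaseMatrix_mul hx0]
    refine max_le (Finset.sum_nonneg fun u _ =>
      mul_nonneg (P.slopeMatrix_nonneg b w u) (le_max_left _ _)) ?_
    rw [excess_eq hb ha hba hd0 hd.2.2.2.1 w]
    have h1 : 0 ≤ ∑ e with N.creditor e = w, (P.pay e (a (N.debtor e))
        - P.pay e (min (a (N.debtor e)) (b (N.debtor e) + d (N.debtor e)))) :=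
      Finset.sum_nonneg fun e _ => sub_nonneg.2 (P.pay_le_of_le e
        (le_min (ha.1 _) (add_nonneg (hb.1 _) (hd0 _))) (min_le_left _ _))
    have h2 := hd.eq_slopeMatrix_mul w
    have h3 : (if w = v then δ else 0) ≤ N.extAssets w - bx w := by
      split_ifs with h
      · exact h ▸ hd.2.2.2.2.1
      · linarith [hbx w]
    linarith

theorem exists_entry {C : Finset (Fin n)} {u : Fin n} (h : P.Reach b v u) (hu : u ∈ C) :
    v ∈ C ∨ ∃ x s, x ∉ C ∧ s ∈ C ∧ P.Reach b v x ∧ P.ActiveAdj b x s := by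
  induction h with
  | refl => exact Or.inl hu
  | @tail x s hx hxs ih =>
    by_cases hxC : x ∈ C
    · exact ih hxC
    · exact Or.inr ⟨x, s, hxC, hu, hx, hxs⟩

/-- In the component x ≤ Mx does not suffice, because M conserves flow there and x could circulate.
A strict inequality at one bank s, from money that a brings in from outside, excludes this. -/
theorem FloodFeasible.add_le {C : Finset (Fin n)} (hd : P.FloodFeasible b C d)
    (hC : P.IsFloodComponent b v C) (hb : P.ClearsFor bx b) (ha : P.IsClearing a)
    (hba : ∀ w, b w ≤ a w) (hbx : ∀ w, bx w ≤ N.extAssets w) (hv : bx v < N.extAssets v)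
    (w : Fin n) : b w + d w ≤ a w := by
  have hd0 := hd.nonneg
  have hg := hd.le_gap hb.1
  have hflow := hd.eq_slopeMatrix_mul hC
  set x : Fin n → ℝ := fun w => max 0 (b w + d w - a w) with hx
  have hx0 : ∀ u, 0 ≤ x u := fun u => le_max_left _ _
  have hxC : ∀ u, u ∉ C → x u = 0 := fun u hu => by
    simp only [hx]
    rw [hd.2.2.2 u hu, max_eq_left (by linarith [hba u])]
  have hMx : ∀ w, 0 ≤ ∑ u, P.slopeMatrix b w u * x u := fun w =>
    Finset.sum_nonneg fun u _ => mul_nonneg (P.slopeMatrix_nonneg b w u) (hx0 u)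
  have hpay : ∀ e, 0 ≤ P.pay e (a (N.debtor e))
      - P.pay e (min (a (N.debtor e)) (b (N.debtor e) + d (N.debtor e))) := fun e =>
    sub_nonneg.2 (P.pay_le_of_le e (le_min (ha.1 _) (add_nonneg (hb.1 _) (hd0 _)))
      (min_le_left _ _))
  have hle : ∀ w, b w + d w - a w ≤ ∑ u, P.slopeMatrix b w u * x u := fun w => by
    rw [excess_eq hb ha hba hd0 hg w]
    linarith [hbx w, hflow w, Finset.sum_nonneg fun e (_ : e ∈ Finset.univ.filter
      fun e => N.creditor e = w) => hpay e]
  -- If v lies in C, the money is its missing external assets; otherwise it comes through an active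
  -- claim by which a path from v enters C, whose debtor is strictly richer under a.
  obtain ⟨s, hs, hlt⟩ : ∃ s ∈ C, b s + d s - a s < ∑ u, P.slopeMatrix b s u * x u := by
    obtain ⟨u, hu, hvu⟩ := hC.2.2.2
    rcases exists_entry hvu hu with hvC | ⟨z, s, hz, hs, hvz, e, he, rfl, rfl⟩
    · refine ⟨v, hvC, ?_⟩
      rw [excess_eq hb ha hba hd0 hg v]
      linarith [hflow v, Finset.sum_nonneg fun e (_ : e ∈ Finset.univ.filter
        fun e => N.creditor e = v) => hpay e]
    · refine ⟨_, hs, ?_⟩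
      rw [excess_eq hb ha hba hd0 hg (N.creditor e)]
      have hlt := lt_of_reach hb ha hba hbx hv hvz
      have : 0 < ∑ e' with N.creditor e' = N.creditor e, (P.pay e' (a (N.debtor e'))
          - P.pay e' (min (a (N.debtor e')) (b (N.debtor e') + d (N.debtor e')))) := by
        refine Finset.sum_pos' (fun e _ => hpay e) ⟨e, by simp, sub_pos.2 ?_⟩
        rw [hd.2.2.2 _ hz, add_zero, min_eq_right hlt.le]
        exact P.pay_lt_pay e (hb.1 _) hlt he
      linarith [hbx (N.creditor e), hflow (N.creditor e)]
  have hxle : ∀ w, x w ≤ ∑ u, P.slopeMatrix b w u * x u := fun w => max_le (hMx w) (hle w)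
  -- If x_s were positive, Σx < ΣMx would follow, but the two sums agree since x is supported on
  -- columns with sum 1.
  have hxs : x s = 0 := by
    by_contra hne
    have hpos : 0 < b s + d s - a s := by
      by_contra hc
      exact hne (max_eq_left (not_lt.1 hc))
    have h1 : ∑ w, x w < ∑ w, ∑ u, P.slopeMatrix b w u * x u :=
      Finset.sum_lt_sum (fun w _ => hxle w) ⟨s, Finset.mem_univ _, by
        simpa only [hx, max_eq_right hpos.le] using hlt⟩
    rw [Finset.sum_comm] at h1
    refine h1.ne (Finset.sum_congr rfl fun u _ => ?_)
    rw [← Finset.sum_mul]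
    by_cases hu : u ∈ C
    · obtain ⟨z, -, hz⟩ := hC.exists_activeAdj hu
      rw [P.sum_slopeMatrix_eq_one (hb.1 u) hz, one_mul]
    · rw [hxC u hu, mul_zero]
  have := (P.isTransient_floodMatrix hb.1 hC hs).eq_zero_of_le hx0 (fun w => ?_) w
  · linarith [le_max_right 0 (b w + d w - a w)]
  · by_cases hw : w = s
    · subst hw
      simp [hxs, floodMatrix]
    · rw [P.floodMatrix_mul (fun u hu => hxC u fun h => hu ((hC.mem_iff_reach hs u).1 h)) hw]
      exact hxle w

end Domination

variable (P)

/-- The invariant of the algorithm. -/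
structure IsSound (s : AlgState n) : Prop where
  bx_le : ∀ w, s.bx w ≤ N.extAssets w
  clears : P.ClearsFor s.bx s.b
  le : ∀ a, P.IsClearing a → ∀ w, s.b w ≤ a w
  cur_lt : ∀ v, s.cur = some v → s.bx v < N.extAssets v

theorem isSound_init : P.IsSound (AlgState.init n) where
  bx_le w := by simpa [AlgState.init] using N.extAssets_nonneg w
  clears := ⟨fun w => by simp [AlgState.init], fun w => by simp [AlgState.init, P.pay_zero]⟩
  le a ha w := by simpa [AlgState.init] using ha.1 w
  cur_lt v h := by simp [AlgState.init] at h

variable {P}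

theorem IsSound.step {s s' : AlgState n} (hs : P.IsSound s) (h : P.AlgStep s s') :
    P.IsSound s' := by
  cases h with
  | choose bx b v hv =>
    refine ⟨hs.bx_le, hs.clears, hs.le, fun w hw => ?_⟩
    obtain rfl : v = w := by simpa using hw
    exact hv
  | flood bx b v C d hC hd =>
    have hb := hs.clears
    refine ⟨hs.bx_le, ?_, fun a ha w => ?_, hs.cur_lt⟩
    · have := hb.add hd.1.nonneg (hd.1.le_gap hb.1)
      simp only [← hd.1.eq_slopeMatrix_mul hC, sub_self, add_zero] at this
      exact this
    · exact hd.1.add_le hC hb ha (hs.le a ha) hs.bx_le (hs.cur_lt v rfl) w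
  | increase bx b v δ d hC hd =>
    have hb := hs.clears
    refine ⟨fun w => ?_, ?_, fun a ha w => ?_, by simp⟩
    · by_cases hw : w = v
      · subst hw
        simpa using (by linarith [hd.1.2.2.2.2.1] : bx w + δ ≤ N.extAssets w)
      · simpa [hw] using hs.bx_le w
    · have := hb.add hd.1.2.2.2.2.2 hd.1.2.2.2.1
      convert this using 1
      funext w
      have h1 := hd.1.eq_slopeMatrix_mul w
      by_cases hw : w = v
      · subst hw
        rw [if_pos rfl] at h1
        simp only [Function.update_self]
        linarith
      · rw [if_neg hw] at h1
        simp only [Function.update_of_ne hw]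
        linarith
    · exact hd.1.add_le hC hb ha (hs.le a ha) hs.bx_le w

/-- Existence of a clearing state is a conclusion here: once everything is injected, the invariant
makes b one. -/
theorem IsSound.isMinimalClearing {s : AlgState n} (hs : P.IsSound s) (h : P.Finished s) :
    P.IsMinimalClearing s.b := by
  have hbx : s.bx = N.extAssets := funext fun w =>
    le_antisymm (hs.bx_le w) (not_lt.1 fun hw => h.2 ⟨w, hw⟩)
  have hc := hs.clears
  rw [hbx] at hc
  exact ⟨hc, fun a ha w => hs.le a ha w⟩

theorem IsSound.exists_step {s : AlgState n} (hs : P.IsSound s) (h : ¬ P.Finished s) :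
    ∃ s', P.AlgStep s s' := by
  obtain ⟨bx, b, cur⟩ := s
  cases cur with
  | none =>
    obtain ⟨v, hv⟩ : ∃ v, bx v < N.extAssets v := by
      by_contra hc
      exact h ⟨rfl, hc⟩
    exact ⟨_, .choose bx b v hv⟩
  | some v =>
    by_cases hC : ∃ C, P.IsFloodComponent b v C
    · obtain ⟨C, hC⟩ := hC
      obtain ⟨s, -, y, t, -, ho, -⟩ := exists_floodOptimal_tight hs.clears.1 hC
      exact ⟨_, .flood bx b v C _ hC ho⟩
    · push Not at hC
      obtain ⟨y, t, -, ho, -⟩ := exists_increaseOptimal_tight hs.clears.1 hC (hs.bx_le v)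
      exact ⟨_, .increase bx b v t _ hC ho⟩

/-! ## The number of steps -/

variable (P)

open Classical in
/-- The number of borders up to `b`. -/
noncomputable def bordersPassed (b : Fin n → ℝ) : ℕ :=
  ∑ e, ((Finset.range (P.numBorders e)).filter
    fun i => P.border e (i + 1) ≤ b (N.debtor e)).card

open Classical in
/-- The number of banks whose external assets are fully injected. -/
noncomputable def banksDone (_P : PiecewiseLinearPayments N) (bx : Fin n → ℝ) : ℕ :=
  (Finset.univ.filter fun v => N.extAssets v ≤ bx v).card

/-- A potential that every step of the algorithm increases. -/
noncomputable def rank (s : AlgState n) : ℕ :=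
  2 * (P.bordersPassed s.b + P.banksDone s.bx) + s.cur.elim 0 fun _ => 1

theorem bordersPassed_mono {b b' : Fin n → ℝ} (h : ∀ w, b w ≤ b' w) :
    P.bordersPassed b ≤ P.bordersPassed b' := by
  refine Finset.sum_le_sum fun e _ => Finset.card_le_card fun i hi => ?_
  rw [Finset.mem_filter] at hi ⊢
  exact ⟨hi.1, hi.2.trans (h _)⟩

/-- A tight gap puts the debtor exactly on the next border of e, which was strictly above its assets
before. -/
theorem bordersPassed_lt {b b' : Fin n → ℝ} (hb : ∀ w, 0 ≤ b w) (h : ∀ w, b w ≤ b' w) {e : Fin m}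
    (he : P.Active b e) (heq : b' (N.debtor e) = b (N.debtor e) + P.gap e (b (N.debtor e))) :
    P.bordersPassed b < P.bordersPassed b' := by
  refine Finset.sum_lt_sum (fun _ _ => Finset.card_le_card fun i hi => ?_)
    ⟨e, Finset.mem_univ _, Finset.card_lt_card ⟨fun i hi => ?_, fun hsub => ?_⟩⟩
  · rw [Finset.mem_filter] at hi ⊢
    exact ⟨hi.1, hi.2.trans (h _)⟩
  · rw [Finset.mem_filter] at hi ⊢
    exact ⟨hi.1, hi.2.trans (h _)⟩
  · have hi := P.pieceIndex_lt e (hb _) he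
    rw [P.gap_eq e (hb _) hi] at heq
    have := @hsub (P.pieceIndex e (b (N.debtor e))) (by
      rw [Finset.mem_filter, Finset.mem_range]
      exact ⟨hi, by linarith⟩)
    rw [Finset.mem_filter] at this
    exact absurd (P.lt_border_of_pieceIndex_lt e (Nat.lt_succ_self _) hi) (not_lt.2 this.2)

theorem bordersPassed_le (b : Fin n → ℝ) : P.bordersPassed b ≤ P.totalBorders :=
  Finset.sum_le_sum fun _ _ => (Finset.card_filter_le _ _).trans (Finset.card_range _).le

theorem banksDone_le (bx : Fin n → ℝ) : P.banksDone bx ≤ n :=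
  (Finset.card_filter_le _ _).trans (by simp)

theorem banksDone_mono {bx bx' : Fin n → ℝ} (h : ∀ w, bx w ≤ bx' w) :
    P.banksDone bx ≤ P.banksDone bx' := by
  refine Finset.card_le_card fun v hv => ?_
  rw [Finset.mem_filter] at hv ⊢
  exact ⟨hv.1, hv.2.trans (h v)⟩

theorem banksDone_lt {bx bx' : Fin n → ℝ} (h : ∀ w, bx w ≤ bx' w) {v : Fin n}
    (hv : bx v < N.extAssets v) (hv' : N.extAssets v ≤ bx' v) :
    P.banksDone bx < P.banksDone bx' := by
  refine Finset.card_lt_card ⟨fun v hv => ?_, fun hsub => ?_⟩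
  · rw [Finset.mem_filter] at hv ⊢
    exact ⟨hv.1, hv.2.trans (h v)⟩
  · have := @hsub v (by simpa using hv')
    rw [Finset.mem_filter] at this
    linarith [this.2]

theorem rank_le (s : AlgState n) : P.rank s ≤ 3 * (n + P.totalBorders) := by
  have h1 := P.bordersPassed_le s.b
  have h2 := P.banksDone_le s.bx
  unfold rank
  cases h : s.cur with
  | none => simp; omega
  | some v =>
    -- A current bank exists, so n ≥ 1 absorbs the summand 1 from 2(n + k) + 1.
    have := v.pos
    simp; omega

variable {P}

/-- An increase step leaves the inner phase and loses 1, but a passed border or a completed bank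
counts 2. The other two steps lose nothing. -/
theorem IsSound.rank_lt {s s' : AlgState n} (hs : P.IsSound s) (h : P.AlgStep s s') :
    P.rank s < P.rank s' := by
  cases h with
  | choose bx b v hv => simp [rank]
  | flood bx b v C d hC hd =>
    have hb : ∀ w, 0 ≤ b w := hs.clears.1
    obtain ⟨e, he, heq⟩ := hd.exists_tight hb hC
    have := P.bordersPassed_lt (b' := b + d) hb (fun w => by simpa using hd.1.nonneg w) he
      (by simp [heq])
    simp only [rank]
    omega
  | increase bx b v δ d hC hd =>
    have hb : ∀ w, 0 ≤ b w := hs.clears.1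
    have hv : bx v < N.extAssets v := hs.cur_lt v rfl
    have hδ := hd.nonneg hb hv.le
    have hle : ∀ w, b w ≤ (b + d) w := fun w => by simpa using hd.1.2.2.2.2.2 w
    have hle' : ∀ w, bx w ≤ Function.update bx v (bx v + δ) w := fun w => by
      by_cases hw : w = v
      · subst hw
        simpa using hδ
      · simp [hw]
    have h1 := P.bordersPassed_mono hle
    have h2 := P.banksDone_mono hle'
    simp only [rank, Option.elim]
    rcases hd.tight hb hC hv.le with h | ⟨e, he, heq⟩
    · have := P.banksDone_lt hle' hv (by simp [h])
      omega
    · have := P.bordersPassed_lt hb hle he (by simp [heq])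
      omega

theorem IsRun.isSound {r : ℕ} {s : ℕ → AlgState n} (h : P.IsRun r s) {i : ℕ} (hi : i ≤ r) :
    P.IsSound (s i) ∧ i ≤ P.rank (s i) := by
  induction i with
  | zero => exact ⟨h.1 ▸ P.isSound_init, Nat.zero_le _⟩
  | succ i ih =>
    obtain ⟨h1, h2⟩ := ih (by omega)
    have hstep := h.2 i hi
    exact ⟨h1.step hstep, h2.trans_lt (h1.rank_lt hstep)⟩

theorem run_correct {r : ℕ} {s : ℕ → AlgState n} (h : P.IsRun r s) :
    r ≤ 3 * (n + P.totalBorders) ∧ (¬ P.Finished (s r) → ∃ s', P.AlgStep (s r) s') ∧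
      (P.Finished (s r) → P.IsMinimalClearing (s r).b) := by
  obtain ⟨h1, h2⟩ := h.isSound le_rfl
  exact ⟨h2.trans (P.rank_le _), h1.exists_step, h1.isMinimalClearing⟩

end PiecewiseLinearPayments

namespace RealRAM

/-! ## Structured programs -/

namespace Mem

variable (μ : Mem)

@[simp] theorem setNat_real (A i x : ℕ) : (μ.setNat A i x).real = μ.real := rfl

@[simp] theorem setReal_nat (A i : ℕ) (x : ℝ) : (μ.setReal A i x).nat = μ.nat := rfl

@[simp] theorem setNat_nat_self (A i x : ℕ) :
    (μ.setNat A i x).nat A = Function.update (μ.nat A) i x := by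
  simp [setNat]

@[simp] theorem setReal_real_self (A i : ℕ) (x : ℝ) :
    (μ.setReal A i x).real A = Function.update (μ.real A) i x := by
  simp [setReal]

@[simp] theorem setNat_nat_of_ne {A B : ℕ} (h : B ≠ A) (i x : ℕ) :
    (μ.setNat A i x).nat B = μ.nat B := by
  simp [setNat, Function.update_of_ne h]

@[simp] theorem setReal_real_of_ne {A B : ℕ} (h : B ≠ A) (i : ℕ) (x : ℝ) :
    (μ.setReal A i x).real B = μ.real B := by
  simp [setReal, Function.update_of_ne h]

end Mem

/-- Programs whose only loops are counting loops: `rep x j c` executes `c` with entry `0` of the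
natural array `x` running through all numbers below entry `j` of the natural array `0`. -/
inductive Block
  | setNat (A : ℕ) (i : NatExp) (e : NatExp)
  | setReal (A : ℕ) (i : NatExp) (e : RealExp)
  | seq (c d : Block)
  | ite (b : Test) (c d : Block)
  | rep (x j : ℕ) (c : Block)

namespace Block

/-- The translation to real RAM programs. -/
def toCmd : Block → Cmd
  | setNat A i e => .setNat A i e
  | setReal A i e => .setReal A i e
  | seq c d => .seq c.toCmd d.toCmd
  | ite b c d => .ite b c.toCmd d.toCmd
  | rep x j c => .seq (.setNat x (.lit 0) (.lit 0))
      (.loop (.natLt (.get x (.lit 0)) (.get 0 (.lit j)))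
        (.seq c.toCmd (.setNat x (.lit 0) (.add (.get x (.lit 0)) (.lit 1)))))

open Classical in
/-- The effect on the memory. -/
noncomputable def run : Block → Mem → Mem
  | setNat A i e, μ => μ.setNat A (i.eval μ) (e.eval μ)
  | setReal A i e, μ => μ.setReal A (i.eval μ) (e.eval μ)
  | seq c d, μ => d.run (c.run μ)
  | ite b c d, μ => if b.eval μ then c.run μ else d.run μ
  | rep x j c, μ => (fun μ => (c.run μ).setNat x 0 ((c.run μ).nat x 0 + 1))^[μ.nat 0 j]
      (μ.setNat x 0 0)

theorem run_ite_pos {b : Test} {c d : Block} {μ : Mem} (h : b.eval μ) :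
    (ite b c d).run μ = c.run μ := if_pos h

theorem run_ite_neg {b : Test} {c d : Block} {μ : Mem} (h : ¬ b.eval μ) :
    (ite b c d).run μ = d.run μ := if_neg h

/-- A bound for the number of elementary operations, where `N j` is entry `j` of the natural
array `0`. -/
def cost (N : ℕ → ℕ) : Block → ℕ
  | setNat _ i e => 1 + i.cost + e.cost
  | setReal _ i e => 1 + i.cost + e.cost
  | seq c d => 1 + c.cost N + d.cost N
  | ite b c d => 1 + b.cost + c.cost N + d.cost N
  | rep _ j c => N j * (c.cost N + 13) + 10

/-- The natural arrays that are written. -/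
def natWrites : Block → List ℕ
  | setNat A _ _ => [A]
  | setReal _ _ _ => []
  | seq c d => c.natWrites ++ d.natWrites
  | ite _ c d => c.natWrites ++ d.natWrites
  | rep x _ c => x :: c.natWrites

/-- The real arrays that are written. -/
def realWrites : Block → List ℕ
  | setNat _ _ _ => []
  | setReal A _ _ => [A]
  | seq c d => c.realWrites ++ d.realWrites
  | ite _ c d => c.realWrites ++ d.realWrites
  | rep _ _ c => c.realWrites

/-- No loop body changes the loop variable. -/
def ok : Block → Bool
  | setNat _ _ _ => true
  | setReal _ _ _ => true
  | seq c d => c.ok && d.ok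
  | ite _ c d => c.ok && d.ok
  | rep x _ c => c.ok && !(c.natWrites.contains x)

/-- The two memories agree on all arrays that `c` does not write. -/
def Frame (c : Block) (μ μ' : Mem) : Prop :=
  (∀ A, A ∉ c.natWrites → μ'.nat A = μ.nat A) ∧ ∀ A, A ∉ c.realWrites → μ'.real A = μ.real A

theorem frame_run (c : Block) (μ : Mem) : c.Frame μ (c.run μ) := by
  induction c generalizing μ with
  | setNat A i e => exact ⟨fun B hB => by simp_all [run, natWrites], fun B _ => rfl⟩
  | setReal A i e => exact ⟨fun B _ => rfl, fun B hB => by simp_all [run, realWrites]⟩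
  | seq c d hc hd =>
    simp only [Frame, natWrites, realWrites, List.mem_append, not_or, run]
    exact ⟨fun A hA => ((hd _).1 A hA.2).trans ((hc μ).1 A hA.1),
      fun A hA => ((hd _).2 A hA.2).trans ((hc μ).2 A hA.1)⟩
  | ite b c d hc hd =>
    simp only [Frame, natWrites, realWrites, List.mem_append, not_or, run]
    split_ifs
    · exact ⟨fun A hA => (hc μ).1 A hA.1, fun A hA => (hc μ).2 A hA.1⟩
    · exact ⟨fun A hA => (hd μ).1 A hA.2, fun A hA => (hd μ).2 A hA.2⟩
  | rep x j c hc =>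
    simp only [run]
    generalize μ.nat 0 j = k
    induction k with
    | zero => exact ⟨fun A hA => by simp_all [natWrites], fun A _ => rfl⟩
    | succ k ih =>
      rw [Function.iterate_succ_apply']
      refine ⟨fun A hA => ?_, fun A hA => ((hc _).2 A hA).trans (ih.2 A hA)⟩
      have h := hA
      simp only [natWrites, List.mem_cons, not_or] at h
      rw [Mem.setNat_nat_of_ne _ h.1, (hc _).1 A h.2, ih.1 A hA]

/-- Induction for counting loops. -/
theorem rep_induction {x j : ℕ} {c : Block} {μ : Mem} (h : (rep x j c).ok = true)
    (I : ℕ → Mem → Prop) (hI : ∀ i μ' k, I i μ' → I i (μ'.setNat x 0 k)) (h0 : I 0 μ)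
    (hstep : ∀ i < μ.nat 0 j, ∀ μ', (rep x j c).Frame μ μ' → μ'.nat x 0 = i → I i μ' →
      I (i + 1) (c.run μ')) :
    I (μ.nat 0 j) ((rep x j c).run μ) := by
  simp only [ok, Bool.and_eq_true, Bool.not_eq_true', List.contains_eq_mem,
    decide_eq_false_iff_not] at h
  obtain ⟨-, hx⟩ := h
  have key : ∀ k ≤ μ.nat 0 j,
      (rep x j c).Frame μ ((fun μ => (c.run μ).setNat x 0 ((c.run μ).nat x 0 + 1))^[k]
        (μ.setNat x 0 0)) ∧
      ((fun μ => (c.run μ).setNat x 0 ((c.run μ).nat x 0 + 1))^[k] (μ.setNat x 0 0)).nat x 0 = k ∧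
      I k ((fun μ => (c.run μ).setNat x 0 ((c.run μ).nat x 0 + 1))^[k] (μ.setNat x 0 0)) := by
    intro k
    induction k with
    | zero =>
      exact fun _ => ⟨⟨fun A hA => by simp_all [natWrites], fun A _ => rfl⟩, by simp, hI _ _ _ h0⟩
    | succ k ih =>
      intro hk
      obtain ⟨h1, h2, h3⟩ := ih (by omega)
      rw [Function.iterate_succ_apply']
      set μ' := (fun μ => (c.run μ).setNat x 0 ((c.run μ).nat x 0 + 1))^[k] (μ.setNat x 0 0)
      refine ⟨⟨fun A hA => ?_, fun A hA => ((frame_run c _).2 A hA).trans (h1.2 A hA)⟩, ?_,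
        hI _ _ _ (hstep k hk μ' h1 h2 h3)⟩
      · have h := hA
        simp only [natWrites, List.mem_cons, not_or] at h
        rw [Mem.setNat_nat_of_ne _ h.1, (frame_run c _).1 A h.2, h1.1 A hA]
      · simp [(frame_run c μ').1 x hx, h2]
  exact (key _ le_rfl).2.2

/-- The numbers of iterations are read from natural array 0, which `c` does not write, so the cost
is fixed in advance. It is only a bound, because both branches of a test are charged. -/
theorem exec (c : Block) (h : c.ok = true) (h0 : 0 ∉ c.natWrites) (μ : Mem) (K : List Cmd)
    (t : ℕ) :
    ∃ t', t' ≤ t + c.cost (μ.nat 0) ∧ Steps ⟨c.toCmd :: K, μ, t⟩ ⟨K, c.run μ, t'⟩ := by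
  induction c generalizing μ K t with
  | setNat A i e => exact ⟨_, le_rfl, .single (.setNat A i e K μ t)⟩
  | setReal A i e => exact ⟨_, le_rfl, .single (.setReal A i e K μ t)⟩
  | seq c d hc hd =>
    simp only [ok, Bool.and_eq_true] at h
    simp only [natWrites, List.mem_append, not_or] at h0
    obtain ⟨t1, ht1, h1⟩ := hc h.1 h0.1 μ (d.toCmd :: K) (t + 1)
    obtain ⟨t2, ht2, h2⟩ := hd h.2 h0.2 (c.run μ) K t1
    rw [(frame_run c μ).1 0 h0.1] at ht2
    refine ⟨t2, ?_, .head (.seq _ _ K μ t) (h1.trans h2)⟩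
    simp only [cost]
    omega
  | ite b c d hc hd =>
    simp only [ok, Bool.and_eq_true] at h
    simp only [natWrites, List.mem_append, not_or] at h0
    by_cases hb : b.eval μ
    · obtain ⟨t1, ht1, h1⟩ := hc h.1 h0.1 μ K (t + (1 + b.cost))
      simp only [run, if_pos hb, cost]
      exact ⟨t1, by omega, .head (.iteTrue b _ _ K μ t hb) h1⟩
    · obtain ⟨t1, ht1, h1⟩ := hd h.2 h0.2 μ K (t + (1 + b.cost))
      simp only [run, if_neg hb, cost]
      exact ⟨t1, by omega, .head (.iteFalse b _ _ K μ t hb) h1⟩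
  | rep x j c hc =>
    simp only [ok, Bool.and_eq_true, Bool.not_eq_true', List.contains_eq_mem,
      decide_eq_false_iff_not] at h
    simp only [natWrites, List.mem_cons, not_or] at h0
    obtain ⟨hok, hx⟩ := h
    -- Each iteration adds 13 to the body: 6 for the test, 1 for the sequencing, 6 for the
    -- increment. The failing test costs 6; with 4 for the initialization this is the 10 in `cost`.
    have hloop : ∀ k μ t, μ.nat x 0 + k = μ.nat 0 j →
        ∃ t', t' ≤ t + (k * (c.cost (μ.nat 0) + 13) + 6) ∧
        Steps ⟨.loop (.natLt (.get x (.lit 0)) (.get 0 (.lit j)))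
          (.seq c.toCmd (.setNat x (.lit 0) (.add (.get x (.lit 0)) (.lit 1)))) :: K, μ, t⟩
          ⟨K, (fun μ => (c.run μ).setNat x 0 ((c.run μ).nat x 0 + 1))^[k] μ, t'⟩ := by
      intro k
      induction k with
      | zero =>
        intro μ t hk
        refine ⟨_, ?_, .single (.loopFalse _ _ K μ t ?_)⟩
        · simp [Test.cost, NatExp.cost]
        · simpa [Test.eval, NatExp.eval] using by omega
      | succ k ih =>
        intro μ t hk
        have hb : (Test.natLt (.get x (.lit 0)) (.get 0 (.lit j))).eval μ := by
          simp only [Test.eval, NatExp.eval]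
          omega
        obtain ⟨t1, ht1, h1⟩ := hc hok h0.2 μ (.setNat x (.lit 0) (.add (.get x (.lit 0)) (.lit 1))
          :: .loop (.natLt (.get x (.lit 0)) (.get 0 (.lit j)))
            (.seq c.toCmd (.setNat x (.lit 0) (.add (.get x (.lit 0)) (.lit 1)))) :: K)
          (t + (1 + (Test.natLt (.get x (.lit 0)) (.get 0 (.lit j))).cost) + 1)
        have hn0 := (frame_run c μ).1 0 h0.2
        have hnx := (frame_run c μ).1 x hx
        obtain ⟨t2, ht2, h2⟩ := ih ((c.run μ).setNat x 0 ((c.run μ).nat x 0 + 1)) (t1 + 6) (by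
          rw [Mem.setNat_nat_of_ne _ h0.1, hn0, Mem.setNat_nat_self, Function.update_self, hnx]
          omega)
        rw [Mem.setNat_nat_of_ne _ h0.1, hn0] at ht2
        refine ⟨t2, ?_, .head (.loopTrue _ _ K μ t hb) (.head (.seq _ _ _ μ _)
          (h1.trans (.head (.setNat x _ _ _ _ _) ?_)))⟩
        · simp only [Test.cost, NatExp.cost] at ht1
          rw [Nat.succ_mul]
          omega
        · rw [Function.iterate_succ_apply]
          exact h2
    obtain ⟨t1, ht1, h1⟩ := hloop (μ.nat 0 j) (μ.setNat x 0 0)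
      (t + 1 + (1 + (NatExp.lit 0).cost + (NatExp.lit 0).cost)) (by
        rw [Mem.setNat_nat_of_ne _ h0.1]
        simp)
    rw [Mem.setNat_nat_of_ne _ h0.1] at ht1
    refine ⟨t1, ?_, .head (.seq _ _ K μ t) (.head (.setNat x _ _ _ μ _) h1)⟩
    simp only [NatExp.cost] at ht1
    simp only [cost]
    omega

end Block

end RealRAM

/-! ## Elimination without pivoting -/

section Elimination

variable {n : ℕ}

/-- The solution of the linear system `A x = c`. -/
def SolvesSystem (A : Fin n → Fin n → ℝ) (c x : Fin n → ℝ) : Prop :=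
  ∀ i, ∑ j, A i j * x j = c i

/-- `A x = c` is a system in which the first `k` unknowns are eliminated, whose solutions have the
property `S`; it has non-positive entries off the diagonal and a positive vector with positive
image. -/
structure IsEliminated (S : (Fin n → ℝ) → Prop) (k : ℕ) (A : Fin n → Fin n → ℝ)
    (c : Fin n → ℝ) : Prop where
  offDiag : ∀ i j, i ≠ j → A i j ≤ 0
  eliminated : ∀ i j : Fin n, (j : ℕ) < k → i ≠ j → A i j = 0
  pos : ∃ x : Fin n → ℝ, (∀ i, 0 < x i) ∧ ∀ i, 0 < ∑ j, A i j * x j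
  solves : ∀ x, SolvesSystem A c x → S x

namespace IsEliminated

variable {S : (Fin n → ℝ) → Prop} {k : ℕ} {A : Fin n → Fin n → ℝ} {c : Fin n → ℝ}

/-- In the row sum against the positive vector the off-diagonal part is non-positive, while the
total is positive. Hence no pivot vanishes. -/
theorem diag_pos (h : IsEliminated S k A c) (i : Fin n) : 0 < A i i := by
  obtain ⟨x, hx, hA⟩ := h.pos
  have h1 := hA i
  rw [← Finset.add_sum_erase _ _ (Finset.mem_univ i)] at h1
  have h2 : ∑ j ∈ Finset.univ.erase i, A i j * x j ≤ 0 := Finset.sum_nonpos fun j hj =>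
    mul_nonpos_of_nonpos_of_nonneg (h.offDiag i j (Finset.ne_of_mem_erase hj).symm) (hx j).le
  exact pos_of_mul_pos_left (by linarith) (hx i).le

/-- The factor A_ik / A_kk is non-positive, so other rows receive a non-negative multiple of the
pivot row: off-diagonal signs persist, and the images under the same positive vector do not
decrease. -/
theorem step {k : Fin n} (h : IsEliminated S k A c) :
    IsEliminated S (k + 1)
      (fun i j => if i = k then A i j else A i j - A i k / A k k * A k j)
      (fun i => if i = k then c i else c i - A i k / A k k * c k) := by
  have hk := h.diag_pos k
  have hf : ∀ i, i ≠ k → A i k / A k k ≤ 0 := fun i hi =>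
    div_nonpos_of_nonpos_of_nonneg (h.offDiag i k hi) hk.le
  have hsum : ∀ (i : Fin n) (x : Fin n → ℝ),
      ∑ j, (if i = k then A i j else A i j - A i k / A k k * A k j) * x j
        = if i = k then ∑ j, A i j * x j
          else ∑ j, A i j * x j - A i k / A k k * ∑ j, A k j * x j := by
    intro i x
    split_ifs
    · rfl
    · rw [Finset.mul_sum, ← Finset.sum_sub_distrib]
      exact Finset.sum_congr rfl fun j _ => by ring
  refine ⟨fun i j hij => ?_, fun i j hj hij => ?_, ?_, fun x hx => h.solves x fun i => ?_⟩
  · split_ifs with hi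
    · exact h.offDiag i j hij
    · by_cases hjk : j = k
      · subst hjk
        rw [div_mul_cancel₀ _ hk.ne', sub_self]
      · have := mul_nonneg_of_nonpos_of_nonpos (hf i hi) (h.offDiag k j (Ne.symm hjk))
        linarith [h.offDiag i j hij]
  · split_ifs with hi
    · subst hi
      refine h.eliminated i j (lt_of_le_of_ne (Nat.lt_succ_iff.1 hj) ?_) hij
      exact fun hc => hij (Fin.ext hc.symm)
    · by_cases hjk : j = k
      · subst hjk
        rw [div_mul_cancel₀ _ hk.ne', sub_self]
      · have hlt : (j : ℕ) < k :=
          lt_of_le_of_ne (Nat.lt_succ_iff.1 hj) fun hc => hjk (Fin.ext hc)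
        rw [h.eliminated i j hlt hij, h.eliminated k j hlt (Ne.symm hjk), mul_zero, sub_zero]
  · obtain ⟨x, hx, hA⟩ := h.pos
    refine ⟨x, hx, fun i => ?_⟩
    rw [hsum]
    split_ifs with hi
    · exact hA i
    · have := mul_nonpos_of_nonpos_of_nonneg (hf i hi) (hA k).le
      linarith [hA i]
  · have hxk := hx k
    have hxi := hx i
    rw [hsum] at hxk hxi
    simp only [if_true] at hxk hxi
    split_ifs at hxi with hi
    · exact hxi
    · rw [hxk] at hxi
      linarith

theorem solves_div (h : IsEliminated S n A c) : S fun i => c i / A i i := by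
  refine h.solves _ fun i => ?_
  rw [Finset.sum_eq_single i]
  · exact mul_div_cancel₀ _ (h.diag_pos i).ne'
  · intro j _ hj
    rw [h.eliminated i j j.2 hj.symm, zero_mul]
  · simp

end IsEliminated

theorem IsTransient.isEliminated {Q : Fin n → Fin n → ℝ} (hQ : IsTransient Q) (c : Fin n → ℝ) :
    IsEliminated (fun y => ∀ w, y w = c w + ∑ u, Q w u * y u) 0
      (fun w u => (if w = u then 1 else 0) - Q w u) c := by
  have hsum : ∀ (w : Fin n) (x : Fin n → ℝ),
      ∑ u, ((if w = u then 1 else 0) - Q w u) * x u = x w - ∑ u, Q w u * x u := fun w x => by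
    simp [sub_mul, Finset.sum_sub_distrib]
  refine ⟨fun i j hij => ?_, fun i j hj => absurd hj (Nat.not_lt_zero _), ?_, fun x hx w => ?_⟩
  · simpa [hij] using hQ.nonneg i j
  -- The positive vector is the solution of x = 1 + Qx, whose image under I − Q is the all-ones
  -- vector.
  · obtain ⟨x, hx⟩ := hQ.exists_solution fun _ => 1
    have h0 := hQ.nonneg_solution (fun _ => zero_le_one) hx
    refine ⟨x, fun i => ?_, fun i => ?_⟩
    · rw [hx i]
      have := Finset.sum_nonneg fun u (_ : u ∈ Finset.univ) => mul_nonneg (hQ.nonneg i u) (h0 u)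
      linarith
    · rw [hsum]
      linarith [hx i]
  · have := hx w
    rw [hsum] at this
    linarith

end Elimination

namespace RealRAM

/-! ## Matrix programs

Square matrices with `n` rows are stored row by row; entry `w` of the natural array `7` is the
position of the first entry of row `w`. -/

/-- The first entry of an array, used as a variable. -/
abbrev var (x : ℕ) : NatExp := .get x (.lit 0)

/-- The position of a matrix entry. -/
abbrev pos (i j : NatExp) : NatExp := .add (.get 7 i) j

/-- The test whether two natural numbers are equal. -/
abbrev natEq (e f : NatExp) : Test := .both (.neg (.natLt e f)) (.neg (.natLt f e))

/-- A command without effect on the arrays in use. -/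
abbrev skip : Block := .setNat 19 (.lit 0) (.lit 0)

/-- The rows of `n × n` matrices are addressed by the natural array `7`. -/
structure HasRows (n : ℕ) (μ : Mem) : Prop where
  size : μ.nat 0 0 = n
  row : ∀ w : Fin n, μ.nat 7 w = w * n

theorem HasRows.frame {n : ℕ} {μ μ' : Mem} {c : Block} (h : HasRows n μ) (hf : c.Frame μ μ')
    (h0 : 0 ∉ c.natWrites) (h7 : 7 ∉ c.natWrites) : HasRows n μ' :=
  ⟨by rw [hf.1 0 h0, h.size], fun w => by rw [hf.1 7 h7, h.row]⟩

theorem pos_inj {n : ℕ} {w u w' u' : Fin n} :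
    (w : ℕ) * n + u = w' * n + u' ↔ w = w' ∧ u = u' := by
  refine ⟨fun h => ?_, fun ⟨h1, h2⟩ => by rw [h1, h2]⟩
  have h1 : (w : ℕ) = w' := by
    have := congrArg (· / n) h
    simpa [Nat.add_comm, Nat.add_mul_div_right _ _ w.pos, Nat.div_eq_of_lt] using this
  exact ⟨Fin.ext h1, Fin.ext (by rw [h1] at h; omega)⟩

theorem natEq_eval {μ : Mem} {e f : NatExp} : (natEq e f).eval μ ↔ e.eval μ = f.eval μ := by
  simp only [Test.eval]
  omega

theorem rep_induction_fin {x j N : ℕ} {B c : Block} {μ : Mem} (hB : B = .rep x j c)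
    (h : B.ok = true) (hN : μ.nat 0 j = N) (I : ℕ → Mem → Prop) (h0 : I 0 μ)
    (hstep : ∀ (i : Fin N) (μ' : Mem), B.Frame μ μ' → μ'.nat x 0 = i → I i μ' →
      I (i + 1) (c.run μ'))
    (hI : ∀ i μ' k, I i μ' → I i (μ'.setNat x 0 k) := by exact fun _ _ _ h => h) :
    I N (B.run μ) := by
  subst hB hN
  exact Block.rep_induction h I hI h0 fun i hi μ' => hstep ⟨i, hi⟩ μ'

theorem val_lt_add_one {n : ℕ} {w j : Fin n} : (w : ℕ) < j + 1 ↔ (w : ℕ) < j ∨ w = j := by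
  rw [Fin.ext_iff]
  omega

attribute [local simp] Block.run NatExp.eval RealExp.eval Test.eval Function.update_apply pos_inj

/-- Overwrite a row of the real array `7` and of the natural array `9` by zeros. -/
def clearRow : Block :=
  .rep 21 0 (.seq (.setReal 7 (pos (var 20) (var 21)) (.lit 0))
      (.setNat 9 (pos (var 20) (var 21)) (.lit 0)))

/-- Overwrite the real array `7` by the zero matrix and the natural array `9` by the identity
matrix. -/
def clearB : Block :=
  .rep 20 0 (.seq clearRow (.setNat 9 (pos (var 20) (var 20)) (.lit 1)))

variable {n : ℕ} {μ : Mem}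

theorem clearB_spec (h : HasRows n μ) : ∀ w u : Fin n, (clearB.run μ).real 7 (w * n + u) = 0 ∧
      (clearB.run μ).nat 9 (w * n + u) = if w = u then 1 else 0 := by
  have key := rep_induction_fin (B := clearB) rfl (by decide) h.size
    (fun i μ' => ∀ w u : Fin n, (w : ℕ) < i → μ'.real 7 (w * n + u) = 0 ∧
      μ'.nat 9 (w * n + u) = if w = u then 1 else 0)
    (fun w u hw => absurd hw (Nat.not_lt_zero _)) (fun i μ' hf hi hI => ?_)
  · exact fun w u => key w u w.2
  have h' := h.frame hf (by decide) (by decide)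
  have key := rep_induction_fin (B := clearRow) rfl (by decide) h'.size
    (fun j μ'' => (∀ w u : Fin n, (w : ℕ) < i → μ''.real 7 (w * n + u) = 0 ∧
      μ''.nat 9 (w * n + u) = if w = u then 1 else 0) ∧
      ∀ u : Fin n, (u : ℕ) < j → μ''.real 7 (i * n + u) = 0 ∧ μ''.nat 9 (i * n + u) = 0)
    ⟨hI, fun u hu => absurd hu (Nat.not_lt_zero _)⟩ (fun j μ'' hf' hj hI' => ?_)
  · have hf' := clearRow.frame_run μ'
    have hi' := (congrFun (hf'.1 20 (by decide)) 0).trans hi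
    have h'' := h'.frame hf' (by decide) (by decide)
    intro w u hw
    have h1 := key.1 w u
    have h2 := key.2 u u.2
    simp [hi', h''.row]
    grind
  · have h'' := h'.frame hf' (by decide) (by decide)
    have hi' := (congrFun (hf'.1 20 (by decide)) 0).trans hi
    simp [hi', hj, h''.row]
    grind

/-- The innermost loop of the computation of the transitive closure. -/
def closeEntries : Block :=
  .rep 22 0 (.ite (.both (.natLt (.lit 0) (.get 9 (pos (var 21) (var 20))))
      (.natLt (.lit 0) (.get 9 (pos (var 20) (var 22)))))
    (.setNat 9 (pos (var 21) (var 22)) (.lit 1)) skip)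

/-- Close the relation in the natural array `9` under composition at a given node. -/
def closeRow : Block := .rep 21 0 closeEntries

/-- The transitive closure of the relation in the natural array `9`. -/
def closeB : Block := .rep 20 0 closeRow

/-- Working in place is harmless: a new entry in row k or column k would require that same entry to
be present already, so the values read keep their sign. -/
theorem closeRow_spec (h : HasRows n μ) {k : Fin n} (hk : μ.nat 20 0 = k) (u w : Fin n) :
    0 < (closeRow.run μ).nat 9 (u * n + w) ↔ 0 < μ.nat 9 (u * n + w) ∨
      0 < μ.nat 9 (u * n + k) ∧ 0 < μ.nat 9 (k * n + w) := by
  have key := rep_induction_fin (B := closeRow) rfl (by decide) h.size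
    (fun i μ' => ∀ u w : Fin n, 0 < μ'.nat 9 (u * n + w) ↔ 0 < μ.nat 9 (u * n + w) ∨
      (u : ℕ) < i ∧ 0 < μ.nat 9 (u * n + k) ∧ 0 < μ.nat 9 (k * n + w))
    (fun u w => by simp) (fun i μ' hf hi hI => ?_)
  · simpa using key u w
  have h' := h.frame hf (by decide) (by decide)
  have hk' := (congrFun (hf.1 20 (by decide)) 0).trans hk
  have key := rep_induction_fin (B := closeEntries) rfl (by decide) h'.size
    (fun j μ'' => ∀ u w : Fin n, 0 < μ''.nat 9 (u * n + w) ↔ 0 < μ.nat 9 (u * n + w) ∨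
      ((u : ℕ) < i ∨ u = i ∧ (w : ℕ) < j) ∧
        0 < μ.nat 9 (u * n + k) ∧ 0 < μ.nat 9 (k * n + w))
    (fun u w => by simpa using hI u w) (fun j μ'' hf' hj hI' => ?_)
  · intro u w
    rw [key u w]
    have := w.2
    grind
  · have h'' := h'.frame hf' (by decide) (by decide)
    have hk'' := (congrFun (hf'.1 20 (by decide)) 0).trans hk'
    have hi'' := (congrFun (hf'.1 21 (by decide)) 0).trans hi
    intro u w
    have h1 := hI' u w
    have h2 := hI' i k
    have h3 := hI' k j
    rw [val_lt_add_one]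
    simp [hi'', hj, hk'', h''.row]
    split_ifs <;> simp <;> grind

/-- Warshall's algorithm: after k rounds the relation lies between the initial one and its closure,
and is closed under composition at nodes below k. The last property survives the round at k. -/
theorem closeB_spec (h : HasRows n μ) {r : Fin n → Fin n → Prop}
    (hr : ∀ u w : Fin n, 0 < μ.nat 9 (u * n + w) ↔ u = w ∨ r u w) (u w : Fin n) :
    0 < (closeB.run μ).nat 9 (u * n + w) ↔ Relation.ReflTransGen r u w := by
  have key := rep_induction_fin (B := closeB) rfl (by decide) h.size
    (fun k μ' => (∀ u w : Fin n, 0 < μ.nat 9 (u * n + w) → 0 < μ'.nat 9 (u * n + w)) ∧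
      (∀ u w : Fin n, 0 < μ'.nat 9 (u * n + w) → Relation.ReflTransGen r u w) ∧
      ∀ u x w : Fin n, (x : ℕ) < k → 0 < μ'.nat 9 (u * n + x) → 0 < μ'.nat 9 (x * n + w) →
        0 < μ'.nat 9 (u * n + w))
    ⟨fun _ _ h => h, fun u w h => ?_, fun u x w hx => absurd hx (Nat.not_lt_zero _)⟩
    (fun k μ' hf hk ⟨h1, h2, h3⟩ => ?_)
  · obtain ⟨h1, h2, h3⟩ := key
    refine ⟨h2 u w, fun h => ?_⟩
    induction h with
    | refl => exact h1 u u ((hr u u).2 (Or.inl rfl))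
    | @tail x w _ hxw ih => exact h3 u x w x.2 ih (h1 x w ((hr x w).2 (Or.inr hxw)))
  · rcases (hr u w).1 h with rfl | h
    · exact .refl
    · exact .single h
  · have hs := closeRow_spec (h.frame hf (by decide) (by decide)) hk
    refine ⟨fun u w h => (hs u w).2 (Or.inl (h1 u w h)), fun u w h => ?_, fun u x w hx => ?_⟩
    · rcases (hs u w).1 h with h | ⟨h, h'⟩
      · exact h2 u w h
      · exact (h2 u k h).trans (h2 k w h')
    · rw [hs, hs, hs]
      by_cases hxk : x = k
      · subst hxk
        grind
      · have hx : (x : ℕ) < k := by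
          have : (x : ℕ) ≠ k := fun h => hxk (Fin.ext h)
          omega
        have := h3 u x w hx
        have := h3 u x k hx
        have := h3 k x w hx
        grind

/-- Subtract a multiple of the pivot row from another row of the matrix in the real array `6`. -/
def elimEntries : Block :=
  .rep 22 0 (.setReal 6 (pos (var 21) (var 22)) (.sub (.get 6 (pos (var 21) (var 22)))
    (.mul (.get 11 (.lit 0)) (.get 6 (pos (var 20) (var 22))))))

/-- Eliminate an unknown from all but one equation of the linear system with matrix in the real
array `6` and right-hand side in the real array `8`. -/
def elimRow : Block :=
  .rep 21 0 (.ite (natEq (var 21) (var 20)) skip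
    (.seq (.setReal 11 (.lit 0) (.div (.get 6 (pos (var 21) (var 20)))
      (.get 6 (pos (var 20) (var 20)))))
    (.seq elimEntries (.setReal 8 (var 21) (.sub (.get 8 (var 21))
      (.mul (.get 11 (.lit 0)) (.get 8 (var 20))))))))

/-- Diagonalize the linear system. -/
def elimB : Block := .rep 20 0 elimRow

/-- Solve the diagonal linear system; the solution is stored in the real array `9`. -/
def solveB : Block :=
  .rep 20 0 (.setReal 9 (var 20) (.div (.get 8 (var 20)) (.get 6 (pos (var 20) (var 20)))))

/-- Since i ≠ k, the pivot row still has its old entries when they are read. -/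
theorem elimEntries_spec (h : HasRows n μ) {i k : Fin n} (hi : μ.nat 21 0 = i)
    (hk : μ.nat 20 0 = k) (hik : i ≠ k) (w u : Fin n) :
    (elimEntries.run μ).real 6 (w * n + u) = if w = i then
      μ.real 6 (w * n + u) - μ.real 11 0 * μ.real 6 (k * n + u) else μ.real 6 (w * n + u) := by
  have key := rep_induction_fin (B := elimEntries) rfl (by decide) h.size
    (fun j μ' => ∀ w u : Fin n, μ'.real 6 (w * n + u) = if w = i ∧ (u : ℕ) < j then
      μ.real 6 (w * n + u) - μ.real 11 0 * μ.real 6 (k * n + u) else μ.real 6 (w * n + u))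
    (fun u w => by simp) (fun j μ' hf hj hI => ?_)
  · simpa using key w u
  · have h' := h.frame hf (by decide) (by decide)
    have hk' := (congrFun (hf.1 20 (by decide)) 0).trans hk
    have hi' := (congrFun (hf.1 21 (by decide)) 0).trans hi
    have hf' := congrFun (hf.2 11 (by decide)) 0
    intro w u
    have h1 := hI w u
    have h2 := hI i j
    have h3 := hI k j
    simp [hi', hj, hk', h'.row, hf', h1, h2, h3, hik.symm]
    grind

theorem elimRow_spec (h : HasRows n μ) {k : Fin n} (hk : μ.nat 20 0 = k) (w : Fin n) :
    (∀ u : Fin n, (elimRow.run μ).real 6 (w * n + u) = if w = k then μ.real 6 (w * n + u) else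
      μ.real 6 (w * n + u) - μ.real 6 (w * n + k) / μ.real 6 (k * n + k)
        * μ.real 6 (k * n + u)) ∧
    (elimRow.run μ).real 8 w = if w = k then μ.real 8 w else
      μ.real 8 w - μ.real 6 (w * n + k) / μ.real 6 (k * n + k) * μ.real 8 k := by
  have key := rep_induction_fin (B := elimRow) rfl (by decide) h.size
    (fun i μ' => ∀ w : Fin n,
      (∀ u : Fin n, μ'.real 6 (w * n + u) = if w = k ∨ i ≤ (w : ℕ) then μ.real 6 (w * n + u) else
        μ.real 6 (w * n + u) - μ.real 6 (w * n + k) / μ.real 6 (k * n + k)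
          * μ.real 6 (k * n + u)) ∧
      μ'.real 8 w = if w = k ∨ i ≤ (w : ℕ) then μ.real 8 w else
        μ.real 8 w - μ.real 6 (w * n + k) / μ.real 6 (k * n + k) * μ.real 8 k)
    (fun w => by simp) (fun i μ' hf hi hI => ?_)
  · simpa [w.2.not_ge] using key w
  have h' := h.frame hf (by decide) (by decide)
  have hk' := (congrFun (hf.1 20 (by decide)) 0).trans hk
  simp only [Block.run, natEq_eval]
  simp only [NatExp.eval, hi, hk', Fin.val_inj]
  split_ifs with hik
  · intro w
    have := hI w
    simp
    grind
  -- The factor is stored beforehand: the loop over row i overwrites the entry in column k from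
  -- which it was computed, and the right-hand side still needs it.
  · obtain ⟨μ₁, hμ₁⟩ : ∃ μ₁, μ₁ = μ'.setReal 11 0 (μ'.real 6 (i * n + k) / μ'.real 6 (k * n + k)) :=
      ⟨_, rfl⟩
    have h1 : HasRows n μ₁ := hμ₁ ▸ ⟨h'.size, h'.row⟩
    have hs := elimEntries_spec (μ := μ₁) h1 (by simpa [hμ₁] using hi)
      (by simpa [hμ₁] using hk') hik
    have hf1 := elimEntries.frame_run μ₁
    have hi1 : (elimEntries.run μ₁).nat 21 0 = i := by rw [hf1.1 21 (by decide), hμ₁]; exact hi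
    have hk1 : (elimEntries.run μ₁).nat 20 0 = k := by rw [hf1.1 20 (by decide), hμ₁]; exact hk'
    have hr1 : (elimEntries.run μ₁).real 11 0
        = μ'.real 6 (i * n + k) / μ'.real 6 (k * n + k) := by
      rw [hf1.2 11 (by decide), hμ₁]
      simp
    have hr2 : (elimEntries.run μ₁).real 8 = μ'.real 8 := by
      rw [hf1.2 8 (by decide), hμ₁]
      simp
    have hr3 : μ₁.real 6 = μ'.real 6 := by simp [hμ₁]
    have hr4 : μ₁.real 11 0 = μ'.real 6 (i * n + k) / μ'.real 6 (k * n + k) := by simp [hμ₁]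
    simp only [RealExp.eval, NatExp.eval, hi, hk', h'.row, ← hμ₁]
    generalize elimEntries.run μ₁ = ν at *
    intro w
    have h2 := hI w
    have h3 := hI k
    have h4 := hI i
    have hwi : i + 1 ≤ (w : ℕ) ↔ (i : ℕ) ≤ w ∧ w ≠ i := by
      rw [Ne, Fin.ext_iff]
      omega
    simp only [hwi, hi1, hk1, hr1, Mem.setReal_real_self, hr2, Mem.setReal_real_of_ne, ne_eq,
      Nat.reduceEqDiff, not_false_eq_true, Function.update_apply, hs, hr3, hr4,
      Fin.val_inj]
    grind

theorem elimB_spec (h : HasRows n μ) {S : (Fin n → ℝ) → Prop}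
    (hS : IsEliminated S 0 (fun w u => μ.real 6 (w * n + u)) fun w => μ.real 8 w) :
    IsEliminated S n (fun w u => (elimB.run μ).real 6 (w * n + u))
      fun w => (elimB.run μ).real 8 w := by
  refine rep_induction_fin (B := elimB) rfl (by decide) h.size
    (fun k μ' => IsEliminated S k (fun w u => μ'.real 6 (w * n + u)) fun w => μ'.real 8 w)
    hS (fun k μ' hf hk hI => ?_)
  have hs := elimRow_spec (h.frame hf (by decide) (by decide)) hk
  simp only [(hs _).1, (hs _).2]
  exact hI.step

theorem solveB_spec (h : HasRows n μ) (w : Fin n) :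
    (solveB.run μ).real 9 w = μ.real 8 w / μ.real 6 (w * n + w) := by
  have key := rep_induction_fin (B := solveB) rfl (by decide) h.size
    (fun k μ' => ∀ w : Fin n, (w : ℕ) < k → μ'.real 9 w = μ.real 8 w / μ.real 6 (w * n + w))
    (fun w hw => absurd hw (Nat.not_lt_zero _)) (fun k μ' hf hk hI w hw => ?_)
  · exact key w w.2
  have h' := h.frame hf (by decide) (by decide)
  have := hI w
  simp [hk, h'.row, hf.2 6 (by decide), hf.2 8 (by decide)]
  grind

/-- Solve the linear system. -/
def linearB : Block := .seq elimB solveB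

theorem linearB_spec (h : HasRows n μ) {S : (Fin n → ℝ) → Prop}
    (hS : IsEliminated S 0 (fun w u => μ.real 6 (w * n + u)) fun w => μ.real 8 w) :
    S fun w => (linearB.run μ).real 9 w := by
  have h' := h.frame (elimB.frame_run μ) (by decide) (by decide)
  simp only [linearB, Block.run, solveB_spec h']
  exact (elimB_spec h hS).solves_div

end RealRAM

/-- Partial sums over claims are written as conditional sums over all claims; one round of a loop
adds one term. -/
theorem sum_ite_lt_add_one {M : Type*} [AddCommMonoid M] {m : ℕ} (f : Fin m → M) (i : Fin m) :
    ∑ e : Fin m, (if (e : ℕ) < i + 1 then f e else 0)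
      = ∑ e : Fin m, (if (e : ℕ) < i then f e else 0) + f i := by
  have h : f i = ∑ e, if e = i then f e else 0 := by simp
  rw [h, ← Finset.sum_add_distrib]
  refine Finset.sum_congr rfl fun e _ => ?_
  simp only [RealRAM.val_lt_add_one]
  by_cases h1 : e = i
  · subst h1; simp
  · simp [h1]

namespace PiecewiseLinearPayments

open RealRAM

variable {n m : ℕ} {N : FinancialNetwork n m} (P : PiecewiseLinearPayments N)

/-! ## The representation of the network in memory -/

/-- The position of the first border of the claim number `i`. -/
def start (i : ℕ) : ℕ := ∑ e : Fin m, if (e : ℕ) < i then P.numBorders e + 1 else 0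

theorem start_zero : P.start 0 = 0 := by simp [start]

theorem start_add_one (e : Fin m) : P.start (e + 1) = P.start e + (P.numBorders e + 1) :=
  sum_ite_lt_add_one _ e

/-- The memory holds the network and displays the state `s`. The natural array `6` holds the
positions of the last borders. -/
structure Stores (s : AlgState n) (μ : Mem) : Prop extends HasRows n μ where
  claims : μ.nat 0 1 = m
  debtor : ∀ e : Fin m, μ.nat 1 e = N.debtor e
  creditor : ∀ e : Fin m, μ.nat 2 e = N.creditor e
  last : ∀ e : Fin m, μ.nat 6 e = P.start e + P.numBorders e
  ext : ∀ v : Fin n, μ.real 0 v = N.extAssets v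
  border : ∀ (e : Fin m) (i : ℕ), i ≤ P.numBorders e → μ.real 2 (P.start e + i) = P.border e i
  slope : ∀ (e : Fin m) (i : ℕ), i ≤ P.numBorders e → μ.real 3 (P.start e + i) = P.slope e i
  displays : Displays μ s

/-- The natural array `5` points to borders that are not above the total assets. -/
def PointsBelow (s : AlgState n) (μ : Mem) : Prop :=
  ∀ e : Fin m, ∃ p ≤ P.numBorders e, μ.nat 5 e = P.start e + p ∧
    P.border e p ≤ s.b (N.debtor e)

/-- The natural array `5` points to the intervals that contain the total assets. -/
def PointsAt (s : AlgState n) (μ : Mem) : Prop :=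
  ∀ e : Fin m, μ.nat 5 e = P.start e + P.pieceIndex e (s.b (N.debtor e))

/-- Entry `0` of the natural array `8` is `v + 1` for a bank `v` whose external assets are not
fully injected, and `0` if there is none. -/
def PointsNext (_P : PiecewiseLinearPayments N) (s : AlgState n) (μ : Mem) : Prop :=
  (μ.nat 8 0 = 0 ∧ ∀ v, ¬ s.bx v < N.extAssets v) ∨
    ∃ v : Fin n, μ.nat 8 0 = v + 1 ∧ s.bx v < N.extAssets v

variable {P} {s : AlgState n} {μ μ' : Mem}

theorem Stores.redisplay {c : Block} {s' : AlgState n} (h : P.Stores s μ) (hf : c.Frame μ μ')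
    (hn : ∀ A ∈ [0, 1, 2, 6, 7], A ∉ c.natWrites) (hr : ∀ A ∈ [0, 2, 3], A ∉ c.realWrites)
    (hs : Displays μ' s') : P.Stores s' μ' where
  toHasRows := h.toHasRows.frame hf (hn 0 (by simp)) (hn 7 (by simp))
  claims := by rw [hf.1 0 (hn 0 (by simp)), h.claims]
  debtor e := by rw [hf.1 1 (hn 1 (by simp)), h.debtor]
  creditor e := by rw [hf.1 2 (hn 2 (by simp)), h.creditor]
  last e := by rw [hf.1 6 (hn 6 (by simp)), h.last]
  ext v := by rw [hf.2 0 (hr 0 (by simp)), h.ext]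
  border e i hi := by rw [hf.2 2 (hr 2 (by simp)), h.border e i hi]
  slope e i hi := by rw [hf.2 3 (hr 3 (by simp)), h.slope e i hi]
  displays := hs

theorem Stores.frame {c : Block} (h : P.Stores s μ) (hf : c.Frame μ μ')
    (hn : ∀ A ∈ [0, 1, 2, 4, 6, 7], A ∉ c.natWrites)
    (hr : ∀ A ∈ [0, 2, 3, 4, 5], A ∉ c.realWrites) : P.Stores s μ' := by
  refine h.redisplay hf (fun A hA => hn A ?_) (fun A hA => hr A ?_) ?_
  · simp only [List.mem_cons, List.not_mem_nil, or_false] at hA ⊢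
    tauto
  · simp only [List.mem_cons, List.not_mem_nil, or_false] at hA ⊢
    tauto
  · rw [Displays, hf.2 4 (hr 4 (by simp)), hf.2 5 (hr 5 (by simp)), hf.1 4 (hn 4 (by simp))]
    exact h.displays

theorem PointsAt.frame {c : Block} (h : P.PointsAt s μ) (hf : c.Frame μ μ')
    (hn : 5 ∉ c.natWrites) : P.PointsAt s μ' := fun e => by rw [hf.1 5 hn, h e]

theorem PointsBelow.frame {c : Block} (h : P.PointsBelow s μ) (hf : c.Frame μ μ')
    (hn : 5 ∉ c.natWrites) : P.PointsBelow s μ' := fun e => by rw [hf.1 5 hn]; exact h e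

/-- After a step the assets have only grown, so pointers that were exact may lag behind but never
overshoot. -/
theorem PointsAt.pointsBelow (h : P.PointsAt s μ) (hb : ∀ w, 0 ≤ s.b w) {s' : AlgState n}
    (hs : ∀ w, s.b w ≤ s'.b w) : P.PointsBelow s' μ := fun e =>
  ⟨_, P.pieceIndex_le e _, h e, (P.border_pieceIndex_le e (hb _)).trans (hs _)⟩

theorem Stores.slopeIn (h : P.Stores s μ) (hp : P.PointsAt s μ) (e : Fin m) :
    μ.real 3 (μ.nat 5 e) = P.slopeIn s.b e := by
  rw [hp e, h.slope e _ (P.pieceIndex_le e _)]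
  rfl

theorem Stores.gap (h : P.Stores s μ) (hp : P.PointsAt s μ) (hb : ∀ w, 0 ≤ s.b w) {e : Fin m}
    (he : P.Active s.b e) :
    μ.real 2 (μ.nat 5 e + 1) - μ.real 5 (N.debtor e) = P.gap e (s.b (N.debtor e)) := by
  have hi := P.pieceIndex_lt e (hb _) he
  rw [hp e, add_assoc, h.border e _ hi, h.displays.2.1, P.gap_eq e (hb _) hi]

end PiecewiseLinearPayments

namespace RealRAM

open PiecewiseLinearPayments

attribute [local simp] Block.run NatExp.eval RealExp.eval Test.eval Function.update_apply pos_inj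
  Fin.val_inj

variable {n m : ℕ} {N : FinancialNetwork n m} {P : PiecewiseLinearPayments N} {s : AlgState n}
  {μ : Mem}

/-! ## The parts of the program -/

/-- Look for a bank whose external assets are not fully injected. -/
def nextB : Block :=
  .seq (.setNat 8 (.lit 0) (.lit 0))
    (.rep 20 0 (.ite (.realLt (.get 4 (var 20)) (.get 0 (var 20)))
      (.setNat 8 (.lit 0) (.add (var 20) (.lit 1))) skip))

theorem nextB_spec (h : P.Stores s μ) : P.PointsNext s (nextB.run μ) := by
  have h1 := h.frame (Block.frame_run (.setNat 8 (.lit 0) (.lit 0)) μ) (by decide) (by decide)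
  have key := rep_induction_fin (μ := μ.setNat 8 0 0) (x := 20) (j := 0) rfl (by decide) h1.size
    (c := .ite (.realLt (.get 4 (var 20)) (.get 0 (var 20)))
      (.setNat 8 (.lit 0) (.add (var 20) (.lit 1))) skip)
    (fun i μ' => (μ'.nat 8 0 = 0 ∧ ∀ v : Fin n, (v : ℕ) < i → ¬ s.bx v < N.extAssets v) ∨
      ∃ v : Fin n, μ'.nat 8 0 = v + 1 ∧ s.bx v < N.extAssets v)
    (Or.inl ⟨by simp, fun v hv => absurd hv (Nat.not_lt_zero _)⟩) (fun i μ' hf hi hI => ?_)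
  · exact key.imp (fun h => ⟨h.1, fun v => h.2 v v.2⟩) id
  · have h2 := h1.frame hf (by decide) (by decide)
    simp only [val_lt_add_one]
    simp [hi, h2.ext, h2.displays.1]
    split_ifs with hlt
    · exact Or.inr ⟨i, by simp, hlt⟩
    · simp
      grind

/-- Advance the pointers in the natural array `5` by at most one, and indicate a change in entry
`0` of the natural array `11`. -/
def advanceB : Block :=
  .seq (.setNat 11 (.lit 0) (.lit 0))
    (.rep 20 1 (.ite (.both (.natLt (.get 5 (var 20)) (.get 6 (var 20)))
        (.neg (.realLt (.get 5 (.get 1 (var 20))) (.get 2 (.add (.get 5 (var 20)) (.lit 1))))))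
      (.seq (.setNat 5 (var 20) (.add (.get 5 (var 20)) (.lit 1))) (.setNat 11 (.lit 0) (.lit 1)))
      skip))

/-- If no pointer moves, each one is at its last border or before a border above the assets, hence
exact. Otherwise some pointer has moved strictly, which pays for the round. -/
theorem advanceB_spec (h : P.Stores s μ) (hp : P.PointsBelow s μ) :
    P.PointsBelow s (advanceB.run μ) ∧ (∀ e : Fin m, μ.nat 5 e ≤ (advanceB.run μ).nat 5 e) ∧
      (((advanceB.run μ).nat 11 0 = 0 ∧ P.PointsAt s (advanceB.run μ)) ∨
        (0 < (advanceB.run μ).nat 11 0 ∧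
          ∃ e : Fin m, μ.nat 5 e < (advanceB.run μ).nat 5 e)) := by
  have hf1 := Block.frame_run (.setNat 11 (.lit 0) (.lit 0)) μ
  have h1 := h.frame hf1 (by decide) (by decide)
  have key := rep_induction_fin (μ := μ.setNat 11 0 0) (x := 20) (j := 1) rfl (by decide) h1.claims
    (c := .ite (.both (.natLt (.get 5 (var 20)) (.get 6 (var 20)))
        (.neg (.realLt (.get 5 (.get 1 (var 20))) (.get 2 (.add (.get 5 (var 20)) (.lit 1))))))
      (.seq (.setNat 5 (var 20) (.add (.get 5 (var 20)) (.lit 1))) (.setNat 11 (.lit 0) (.lit 1)))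
      skip)
    (fun i μ' => P.PointsBelow s μ' ∧ (∀ e : Fin m, μ.nat 5 e ≤ μ'.nat 5 e) ∧
      ((μ'.nat 11 0 = 0 ∧ ∀ e : Fin m, (e : ℕ) < i →
        μ'.nat 5 e = P.start e + P.pieceIndex e (s.b (N.debtor e))) ∨
        (0 < μ'.nat 11 0 ∧ ∃ e : Fin m, μ.nat 5 e < μ'.nat 5 e)))
    ⟨hp.frame hf1 (by decide), fun e => by simp,
      Or.inl ⟨by simp, fun v hv => absurd hv (Nat.not_lt_zero _)⟩⟩ (fun i μ' hf hi hI => ?_)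
  · exact ⟨key.1, key.2.1, key.2.2.imp (fun h => ⟨h.1, fun e => h.2 e e.2⟩) id⟩
  · obtain ⟨hI1, hI2, hI3⟩ := hI
    have h2 := h1.frame hf (by decide) (by decide)
    obtain ⟨p, hp1, hp2, hp3⟩ := hI1 i
    have hb : ∀ (hlt : p < P.numBorders i),
        μ'.real 2 (P.start i + p + 1) = P.border i (p + 1) := fun hlt => by
      rw [add_assoc, h2.border i _ hlt]
    simp only [Block.run, Test.eval, NatExp.eval, RealExp.eval, hi, hp2, h2.last, h2.debtor,
      h2.displays.2.1, add_lt_add_iff_left]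
    split_ifs with hc
    · obtain ⟨hc1, hc2⟩ := hc
      rw [hb hc1, not_lt] at hc2
      refine ⟨fun e => ?_, fun e => ?_, Or.inr ⟨by simp, i, ?_⟩⟩
      · by_cases he : e = i
        · subst he
          exact ⟨p + 1, hc1, by simp [add_assoc], hc2⟩
        · obtain ⟨q, hq⟩ := hI1 e
          exact ⟨q, by simpa [he] using hq⟩
      · have := hI2 e
        by_cases he : e = i
        · subst he
          simp
          omega
        · simpa [he] using this
      · have := hI2 i
        simp
        omega
    · refine ⟨hI1, hI2, hI3.imp (fun h => ⟨by simpa using h.1, fun e he => ?_⟩) id⟩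
      rcases val_lt_add_one.1 he with he | rfl
      · exact h.2 e he
      · have : P.pieceIndex e (s.b (N.debtor e)) = p := P.pieceIndex_eq e hp1 hp3 fun hlt => by
          have := mt (fun h => And.intro hlt h) hc
          rwa [hb hlt, not_not] at this
        rw [this]
        exact hp2

/-- Enter the slopes into the real array `7` and the active claims into the natural array `9`. -/
def slopesB : Block :=
  .rep 20 1 (.seq
    (.setReal 7 (pos (.get 2 (var 20)) (.get 1 (var 20)))
      (.add (.get 7 (pos (.get 2 (var 20)) (.get 1 (var 20)))) (.get 3 (.get 5 (var 20)))))
    (.ite (.realLt (.lit 0) (.get 3 (.get 5 (var 20))))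
      (.setNat 9 (pos (.get 1 (var 20)) (.get 2 (var 20))) (.lit 1)) skip))

theorem slopesB_spec (h : P.Stores s μ) (hp : P.PointsAt s μ)
    (h0 : ∀ w u : Fin n, μ.real 7 (w * n + u) = 0 ∧
      μ.nat 9 (w * n + u) = if w = u then 1 else 0) (w u : Fin n) :
    (slopesB.run μ).real 7 (w * n + u) = P.slopeMatrix s.b w u ∧
      (0 < (slopesB.run μ).nat 9 (w * n + u) ↔ w = u ∨ P.ActiveAdj s.b w u) := by
  have key := rep_induction_fin (B := slopesB) rfl (by decide) h.claims
    (fun i μ' => ∀ w u : Fin n,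
      μ'.real 7 (w * n + u) = ∑ e : Fin m, (if (e : ℕ) < i then
        if N.creditor e = w ∧ N.debtor e = u then P.slopeIn s.b e else 0 else 0) ∧
      (0 < μ'.nat 9 (w * n + u) ↔ w = u ∨
        ∃ e : Fin m, (e : ℕ) < i ∧ P.Active s.b e ∧ N.debtor e = w ∧ N.creditor e = u))
    (fun w u => ⟨by simp [h0], by
      rw [(h0 w u).2]
      split_ifs <;> simp_all⟩) (fun i μ' hf hi hI w u => ?_)
  · simpa [slopeMatrix, Finset.sum_filter, ActiveAdj] using key w u
  · have h1 := h.frame hf (by decide) (by decide)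
    have hp1 := hp.frame hf (by decide)
    have hs := h1.slopeIn hp1 i
    have h2 := hI w u
    have h3 := hI (N.creditor i) (N.debtor i)
    rw [sum_ite_lt_add_one]
    simp only [val_lt_add_one, or_and_right, exists_or, exists_eq_left, ← or_assoc, ← h2.2]
    simp [hi, h1.debtor, h1.creditor, h1.row, hs, h3.1]
    constructor
    · split_ifs <;> simp <;> grind
    · split_ifs with hlt <;> simp [Active] <;> grind

end RealRAM

/-! ### Detection of flood components and the linear system. -/

namespace RealRAM

open PiecewiseLinearPayments

attribute [local simp] Block.run NatExp.eval RealExp.eval Test.eval Function.update_apply pos_inj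
  Fin.val_inj

variable {n m : ℕ} {N : FinancialNetwork n m} {P : PiecewiseLinearPayments N} {s : AlgState n}
  {μ : Mem}

/-- Test for a bank `u` whether all banks that it reaches reach it, and whether it reaches another
bank; the results are stored in the natural arrays `14` and `15`. -/
def rootEntries : Block :=
  .rep 21 0 (.ite (.natLt (.lit 0) (.get 9 (pos (var 20) (var 21))))
    (.seq (.ite (.natLt (.lit 0) (.get 9 (pos (var 21) (var 20)))) skip
        (.setNat 14 (.lit 0) (.lit 0)))
      (.ite (natEq (var 20) (var 21)) skip (.setNat 15 (.lit 0) (.lit 1)))) skip)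

/-- Look for a bank in a flood component; its successor is stored in the natural array `10`. -/
def rootB : Block :=
  .seq (.setNat 10 (.lit 0) (.lit 0))
    (.rep 20 0 (.seq (.setNat 14 (.lit 0) (.lit 1)) (.seq (.setNat 15 (.lit 0) (.lit 0))
      (.seq rootEntries
        (.ite (.both (.both (.natLt (.lit 0) (var 14)) (.natLt (.lit 0) (var 15)))
          (.natLt (.lit 0) (.get 9 (pos (.sub (var 4) (.lit 1)) (var 20)))))
          (.setNat 10 (.lit 0) (.add (var 20) (.lit 1))) skip)))))

theorem rootEntries_spec (h : HasRows n μ) {u : Fin n} (hu : μ.nat 20 0 = u)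
    (h14 : μ.nat 14 0 = 1) (h15 : μ.nat 15 0 = 0) :
    (0 < (rootEntries.run μ).nat 14 0 ↔ ∀ w : Fin n, 0 < μ.nat 9 (u * n + w) →
      0 < μ.nat 9 (w * n + u)) ∧
    (0 < (rootEntries.run μ).nat 15 0 ↔ ∃ w : Fin n, u ≠ w ∧ 0 < μ.nat 9 (u * n + w)) := by
  have key := rep_induction_fin (B := rootEntries) rfl (by decide) h.size
    (fun i μ' => (0 < μ'.nat 14 0 ↔ ∀ w : Fin n, (w : ℕ) < i → 0 < μ.nat 9 (u * n + w) →
        0 < μ.nat 9 (w * n + u)) ∧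
      (0 < μ'.nat 15 0 ↔ ∃ w : Fin n, (w : ℕ) < i ∧ u ≠ w ∧ 0 < μ.nat 9 (u * n + w)))
    ⟨by simp [h14], by simp [h15]⟩ (fun i μ' hf hi hI => ?_)
  · simpa using key
  · have h1 := h.frame hf (by decide) (by decide)
    have hu' := (congrFun (hf.1 20 (by decide)) 0).trans hu
    have h9 := hf.1 9 (by decide)
    simp only [val_lt_add_one, or_imp, forall_and, forall_eq, or_and_right, exists_or,
      exists_eq_left, ← hI.1, ← hI.2]
    simp only [Block.run, natEq_eval]
    simp [hi, hu', h1.row, h9]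
    split_ifs <;> simp_all

/-- Bank `u` lies in a flood component. -/
def IsRoot (P : PiecewiseLinearPayments N) (b : Fin n → ℝ) (v u : Fin n) : Prop :=
  ((∀ w, P.Reach b u w → P.Reach b w u) ∧ ∃ w, u ≠ w ∧ P.Reach b u w) ∧ P.Reach b v u

theorem rootB_spec (h : P.Stores s μ) {v : Fin n} (hv : s.cur = some v)
    (hr : ∀ u w : Fin n, 0 < μ.nat 9 (u * n + w) ↔ P.Reach s.b u w) :
    ((rootB.run μ).nat 10 0 = 0 ∧ ∀ u, ¬ IsRoot P s.b v u) ∨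
      ∃ u : Fin n, (rootB.run μ).nat 10 0 = u + 1 ∧ IsRoot P s.b v u := by
  have hf0 := Block.frame_run (.setNat 10 (.lit 0) (.lit 0)) μ
  have h1 := h.frame hf0 (by decide) (by decide)
  have key := rep_induction_fin (μ := μ.setNat 10 0 0) (x := 20) (j := 0) rfl (by decide) h1.size
    (c := .seq (.setNat 14 (.lit 0) (.lit 1)) (.seq (.setNat 15 (.lit 0) (.lit 0))
      (.seq rootEntries
        (.ite (.both (.both (.natLt (.lit 0) (var 14)) (.natLt (.lit 0) (var 15)))
          (.natLt (.lit 0) (.get 9 (pos (.sub (var 4) (.lit 1)) (var 20)))))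
          (.setNat 10 (.lit 0) (.add (var 20) (.lit 1))) skip))))
    (fun i μ' => (μ'.nat 10 0 = 0 ∧ ∀ u : Fin n, (u : ℕ) < i → ¬ IsRoot P s.b v u) ∨
      ∃ u : Fin n, μ'.nat 10 0 = u + 1 ∧ IsRoot P s.b v u)
    (Or.inl ⟨by simp, fun v hv => absurd hv (Nat.not_lt_zero _)⟩) (fun i μ' hf hi hI => ?_)
  · exact key.imp (fun h => ⟨h.1, fun u => h.2 u u.2⟩) id
  · have h2 := h1.frame hf (by decide) (by decide)
    obtain ⟨μ₁, hμ₁⟩ : ∃ μ₁, μ₁ = (μ'.setNat 14 0 1).setNat 15 0 0 := ⟨_, rfl⟩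
    have hi1 : μ₁.nat 20 0 = i := by simpa [hμ₁] using hi
    have hr1 : ∀ u w : Fin n, 0 < μ₁.nat 9 (u * n + w) ↔ P.Reach s.b u w := fun u w => by
      rw [← hr, hμ₁]
      simp [hf.1 9 (by decide)]
    have h3 : P.Stores s μ₁ := hμ₁ ▸ h2.frame (Block.frame_run
      (.seq (.setNat 14 (.lit 0) (.lit 1)) (.setNat 15 (.lit 0) (.lit 0))) μ')
      (by decide) (by decide)
    have hs := rootEntries_spec h3.toHasRows hi1 (by simp [hμ₁]) (by simp [hμ₁])
    have hf3 := rootEntries.frame_run μ₁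
    have h4 := h3.frame hf3 (by decide) (by decide)
    have hi2 := (congrFun (hf3.1 20 (by decide)) 0).trans hi1
    have h10 : (rootEntries.run μ₁).nat 10 0 = μ'.nat 10 0 := by
      rw [hf3.1 10 (by decide), hμ₁]
      simp
    have h9 : ∀ u w : Fin n, 0 < (rootEntries.run μ₁).nat 9 (u * n + w) ↔ P.Reach s.b u w :=
      fun u w => by rw [hf3.1 9 (by decide), hr1]
    have hcur : (rootEntries.run μ₁).nat 4 0 = v + 1 := by rw [h4.displays.2.2, hv]; rfl
    simp only [hr1] at hs
    have htest : Test.eval (rootEntries.run μ₁)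
        (.both (.both (.natLt (.lit 0) (var 14)) (.natLt (.lit 0) (var 15)))
          (.natLt (.lit 0) (.get 9 (pos (.sub (var 4) (.lit 1)) (var 20))))) ↔
        IsRoot P s.b v i := by
      simp only [Test.eval, NatExp.eval, hcur, hi2, add_tsub_cancel_right, h4.row]
      rw [hs.1, hs.2, h9, IsRoot]
    subst hμ₁
    simp only [val_lt_add_one]
    by_cases hroot : IsRoot P s.b v i
    · refine Or.inr ⟨i, (congrArg (fun ν : Mem => ν.nat 10 0)
        (Block.run_ite_pos (htest.2 hroot))).trans ?_, hroot⟩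
      simpa using hi2
    · have h10' := (congrArg (fun ν : Mem => ν.nat 10 0)
        (Block.run_ite_neg (c := .setNat 10 (.lit 0) (.add (var 20) (.lit 1))) (d := skip)
          (mt htest.1 hroot))).trans (by simpa using h10)
      refine hI.imp (fun h => ⟨h10'.trans h.1, fun u hu => ?_⟩)
        fun ⟨u, hu⟩ => ⟨u, h10'.trans hu.1, hu.2⟩
      rcases hu with hu | rfl
      exacts [h.2 u hu, hroot]

/-- Choose the source of the linear system (natural array `12`). If a flood component exists, then
entry `0` of the natural array `13` is `0`. Otherwise it is `1`, and entry `0` of the real array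
`10` holds the upper bound for the step length in the Increase-LP. -/
def sourceB : Block :=
  .ite (.natLt (.lit 0) (var 10))
    (.seq (.setNat 12 (.lit 0) (.sub (var 10) (.lit 1))) (.setNat 13 (.lit 0) (.lit 0)))
    (.seq (.setNat 12 (.lit 0) (.sub (var 4) (.lit 1))) (.seq (.setNat 13 (.lit 0) (.lit 1))
      (.setReal 10 (.lit 0) (.sub (.get 0 (var 12)) (.get 4 (var 12))))))

/-- A row of the matrix of the linear system, without the identity matrix. -/
def systemRow : Block :=
  .rep 21 0 (.ite (.both (.natLt (.lit 0) (.get 9 (pos (var 12) (var 21))))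
      (.neg (.both (.natLt (.lit 0) (var 10)) (natEq (var 20) (var 12)))))
    (.setReal 6 (pos (var 20) (var 21)) (.sub (.lit 0) (.get 7 (pos (var 20) (var 21)))))
    (.setReal 6 (pos (var 20) (var 21)) (.lit 0)))

/-- The matrix (real array `6`) and the right-hand side (real array `8`) of the linear system. -/
def systemB : Block :=
  .seq (.rep 20 0 (.seq (.setReal 8 (var 20) (.lit 0)) (.seq systemRow
      (.setReal 6 (pos (var 20) (var 20)) (.add (.get 6 (pos (var 20) (var 20))) (.lit 1))))))
    (.setReal 8 (var 12) (.lit 1))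

open Classical in
/-- The coefficients that `systemB` uses. -/
noncomputable def systemMatrix (n : ℕ) (μ : Mem) (w u : Fin n) : ℝ :=
  if 0 < μ.nat 9 (μ.nat 12 0 * n + u) ∧ ¬ (0 < μ.nat 10 0 ∧ (w : ℕ) = μ.nat 12 0) then
    μ.real 7 (w * n + u) else 0

theorem systemMatrix_frame {c : Block} {μ' : Mem} (hf : c.Frame μ μ')
    (hn : ∀ A ∈ [9, 10, 12], A ∉ c.natWrites) (hr : 7 ∉ c.realWrites) :
    systemMatrix n μ' = systemMatrix n μ := by
  unfold systemMatrix
  rw [hf.1 9 (hn 9 (by simp)), hf.1 10 (hn 10 (by simp)), hf.1 12 (hn 12 (by simp)), hf.2 7 hr]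

theorem systemRow_spec (h : HasRows n μ) {i s : Fin n} (hi : μ.nat 20 0 = i)
    (hs : μ.nat 12 0 = s) (w u : Fin n) :
    (systemRow.run μ).real 6 (w * n + u) =
      if w = i then -systemMatrix n μ w u else μ.real 6 (w * n + u) := by
  have key := rep_induction_fin (B := systemRow) rfl (by decide) h.size
    (fun j μ' => ∀ w u : Fin n, μ'.real 6 (w * n + u) =
      if w = i ∧ (u : ℕ) < j then -systemMatrix n μ w u else μ.real 6 (w * n + u))
    (fun w u => by simp) (fun j μ' hf hj hI w u => ?_)
  · simpa using key w u
  · have h1 := h.frame hf (by decide) (by decide)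
    have hi1 := (congrFun (hf.1 20 (by decide)) 0).trans hi
    have hs1 := (congrFun (hf.1 12 (by decide)) 0).trans hs
    have hm := systemMatrix_frame (n := n) hf (by decide) (by decide)
    have h2 := hI w u
    rw [← hm] at h2 ⊢
    have htest : Test.eval μ' (.both (.natLt (.lit 0) (.get 9 (pos (var 12) (var 21))))
        (.neg (.both (.natLt (.lit 0) (var 10)) (natEq (var 20) (var 12)))))
        ↔ (0 < μ'.nat 9 (s * n + j) ∧ ¬ (0 < μ'.nat 10 0 ∧ (i : ℕ) = s)) := by
      have : (¬ (i : ℕ) < s ∧ ¬ (s : ℕ) < i) ↔ (i : ℕ) = s := by omega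
      simp only [Test.eval, NatExp.eval, hi1, hs1, hj, h1.row, this]
    have hval : systemMatrix n μ' i j = if 0 < μ'.nat 9 (s * n + j) ∧
        ¬ (0 < μ'.nat 10 0 ∧ (i : ℕ) = s) then μ'.real 7 (i * n + j) else 0 := by
      rw [systemMatrix, hs1]
    simp only [val_lt_add_one]
    by_cases hc : 0 < μ'.nat 9 (s * n + j) ∧ ¬ (0 < μ'.nat 10 0 ∧ (i : ℕ) = s)
    · rw [if_pos hc] at hval
      rw [Block.run_ite_pos (htest.2 hc)]
      simp [hi1, hj, h1.row, h2]
      grind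
    · rw [if_neg hc] at hval
      rw [Block.run_ite_neg (mt htest.1 hc)]
      simp [hi1, hj, h1.row, h2]
      grind

theorem systemB_spec (h : HasRows n μ) {s : Fin n} (hs : μ.nat 12 0 = s) (w : Fin n) :
    (∀ u : Fin n, (systemB.run μ).real 6 (w * n + u)
      = (if w = u then 1 else 0) - systemMatrix n μ w u) ∧
    (systemB.run μ).real 8 w = if w = s then 1 else 0 := by
  have key := rep_induction_fin (μ := μ) (x := 20) (j := 0) rfl (by decide) h.size
    (c := .seq (.setReal 8 (var 20) (.lit 0)) (.seq systemRow
      (.setReal 6 (pos (var 20) (var 20)) (.add (.get 6 (pos (var 20) (var 20))) (.lit 1)))))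
    (fun i μ' => ∀ w : Fin n, (w : ℕ) < i → (∀ u : Fin n, μ'.real 6 (w * n + u)
      = (if w = u then 1 else 0) - systemMatrix n μ w u) ∧ μ'.real 8 w = 0)
    (fun w hw => absurd hw (Nat.not_lt_zero _)) (fun i μ' hf hi hI => ?_)
  · have hs' := (congrFun ((Block.frame_run (.rep 20 0 (.seq (.setReal 8 (var 20) (.lit 0))
      (.seq systemRow (.setReal 6 (pos (var 20) (var 20))
        (.add (.get 6 (pos (var 20) (var 20))) (.lit 1)))))) μ).1 12 (by decide)) 0).trans hs
    have := key w w.2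
    rw [systemB, Block.run]
    generalize Block.run _ μ = ν at *
    simp [hs', this]
  · obtain ⟨μ₁, hμ₁⟩ : ∃ μ₁, μ₁ = μ'.setReal 8 i 0 := ⟨_, rfl⟩
    have hf1 := Block.frame_run (.setReal 8 (var 20) (.lit 0)) μ'
    simp only [Block.run, NatExp.eval, RealExp.eval, hi, Int.cast_zero, ← hμ₁] at hf1 ⊢
    have h1 := (h.frame hf (by decide) (by decide)).frame hf1 (by decide) (by decide)
    have hi1 := (congrFun (hf1.1 20 (by decide)) 0).trans hi
    have hs1 := (congrFun (hf1.1 12 (by decide)) 0).trans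
      ((congrFun (hf.1 12 (by decide)) 0).trans hs)
    have hm := (systemMatrix_frame (n := n) hf1 (by decide) (by decide)).trans
      (systemMatrix_frame (n := n) hf (by decide) (by decide))
    have hrow := systemRow_spec h1 hi1 hs1
    have hf2 := systemRow.frame_run μ₁
    have h2 := h1.frame hf2 (by decide) (by decide)
    have hi2 := (congrFun (hf2.1 20 (by decide)) 0).trans hi1
    have h8 : (systemRow.run μ₁).real 8 = Function.update (μ'.real 8) i 0 := by
      rw [hf2.2 8 (by decide), hμ₁]
      simp
    have h6 : μ₁.real 6 = μ'.real 6 := by simp [hμ₁]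
    rw [hm] at hrow
    generalize systemRow.run μ₁ = ν at *
    intro w hw
    have := hI w
    rw [val_lt_add_one] at hw
    simp [hi2, h2.row, h8, hrow, h6]
    grind

end RealRAM

/-! ### The largest feasible step length. -/

namespace RealRAM

open PiecewiseLinearPayments

attribute [local simp] Block.run NatExp.eval RealExp.eval Test.eval Function.update_apply pos_inj
  Fin.val_inj

variable {n m : ℕ} {N : FinancialNetwork n m} {P : PiecewiseLinearPayments N} {s : AlgState n}
  {μ : Mem}

/-- The distance to the next border of the claim whose number is entry `0` of the natural array
`20`. -/
abbrev gapExp : RealExp :=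
  .sub (.get 2 (.add (.get 5 (var 20)) (.lit 1))) (.get 5 (.get 1 (var 20)))

/-- The test whether a claim restricts the step length. -/
abbrev stepTest : Test :=
  .both (.both (.realLt (.lit 0) (.get 3 (.get 5 (var 20))))
      (.realLt (.lit 0) (.get 9 (.get 1 (var 20)))))
    (.neg (.both (.natLt (.lit 0) (var 13))
      (.neg (.realLt gapExp (.mul (.get 10 (.lit 0)) (.get 9 (.get 1 (var 20))))))))

/-- Compute the largest step length for the solution in the real array `9`. -/
def stepB : Block :=
  .rep 20 1 (.ite stepTest
    (.seq (.setReal 10 (.lit 0) (.div gapExp (.get 9 (.get 1 (var 20)))))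
      (.setNat 13 (.lit 0) (.lit 1))) skip)

/-- The claim `e` restricts the step length in the direction `y`. -/
def Restricts (P : PiecewiseLinearPayments N) (b y : Fin n → ℝ) (e : Fin m) : Prop :=
  P.Active b e ∧ 0 < y (N.debtor e)

/-- Ratio test with a flag: entry 0 of natural array 13 is 0 while no upper bound is known. In an
increase step it starts at 1, with the remaining external assets as the bound; in a flood step the
first restricting claim supplies it. -/
theorem stepB_spec (h : P.Stores s μ) (hp : P.PointsAt s μ) (hb : ∀ w, 0 ≤ s.b w)
    {y : Fin n → ℝ} (hy : ∀ w : Fin n, μ.real 9 w = y w) {t : ℝ}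
    (ht : (stepB.run μ).real 10 0 = t) :
    (∀ e, Restricts P s.b y e → t * y (N.debtor e) ≤ P.gap e (s.b (N.debtor e))) ∧
      (0 < μ.nat 13 0 → t ≤ μ.real 10 0) ∧
      ((∃ e, Restricts P s.b y e) ∨ 0 < μ.nat 13 0 → (0 < μ.nat 13 0 ∧ t = μ.real 10 0) ∨
        ∃ e, Restricts P s.b y e ∧ t * y (N.debtor e) = P.gap e (s.b (N.debtor e))) := by
  have key := rep_induction_fin (B := stepB) rfl (by decide) h.claims
    (fun i μ' => (μ'.nat 13 0 = 0 → μ.nat 13 0 = 0 ∧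
        ∀ e : Fin m, (e : ℕ) < i → ¬ Restricts P s.b y e) ∧
      (0 < μ'.nat 13 0 → (∀ e : Fin m, (e : ℕ) < i → Restricts P s.b y e →
          μ'.real 10 0 * y (N.debtor e) ≤ P.gap e (s.b (N.debtor e))) ∧
        (0 < μ.nat 13 0 → μ'.real 10 0 ≤ μ.real 10 0) ∧
        ((0 < μ.nat 13 0 ∧ μ'.real 10 0 = μ.real 10 0) ∨ ∃ e, Restricts P s.b y e ∧
          μ'.real 10 0 * y (N.debtor e) = P.gap e (s.b (N.debtor e)))))
    ⟨fun h0 => ⟨h0, fun e he => absurd he (Nat.not_lt_zero _)⟩,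
      fun h0 => ⟨fun e he => absurd he (Nat.not_lt_zero _), fun _ => le_rfl, Or.inl ⟨h0, rfl⟩⟩⟩
    (fun i μ' hf hi hI => ?_)
  · rw [ht] at key
    rcases Nat.eq_zero_or_pos ((stepB.run μ).nat 13 0) with h0 | h0
    · obtain ⟨h1, h2⟩ := key.1 h0
      refine ⟨fun e he => absurd he (h2 e e.2), fun h => by omega, fun h => ?_⟩
      rcases h with ⟨e, he⟩ | h
      exacts [absurd he (h2 e e.2), by omega]
    · obtain ⟨h1, h2, h3⟩ := key.2 h0
      exact ⟨fun e => h1 e e.2, h2, fun _ => h3⟩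
  · have h1 := h.frame hf (by decide) (by decide)
    have hp1 := hp.frame hf (by decide)
    have hslope := h1.slopeIn hp1 i
    have hyi : μ'.real 9 (N.debtor i) = y (N.debtor i) := by rw [hf.2 9 (by decide), hy]
    have htest : stepTest.eval μ' ↔ Restricts P s.b y i ∧ ¬ (0 < μ'.nat 13 0 ∧
        ¬ P.gap i (s.b (N.debtor i)) < μ'.real 10 0 * y (N.debtor i)) := by
      simp only [Test.eval, NatExp.eval, RealExp.eval, hi, h1.debtor, hslope, hyi, Int.cast_zero]
      -- The stored difference of border and assets is the gap only for active claims, which the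
      -- first conjunct provides.
      refine and_congr_right fun h => ?_
      rw [h1.gap hp1 hb h.1]
    obtain ⟨hI1, hI2⟩ := hI
    simp only [val_lt_add_one]
    by_cases hc : stepTest.eval μ'
    · rw [Block.run_ite_pos hc]
      obtain ⟨hr, hlt⟩ := htest.1 hc
      have hgap := h1.gap hp1 hb hr.1
      have hval : ∀ x : ℝ, x = P.gap i (s.b (N.debtor i)) / y (N.debtor i) →
          x * y (N.debtor i) = P.gap i (s.b (N.debtor i)) := fun x hx => by
        rw [hx, div_mul_cancel₀ _ hr.2.ne']
      simp [hi, h1.debtor, hyi, hgap]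
      refine ⟨fun e he hre => ?_, fun h0 => ?_, Or.inr ⟨i, hr, hval _ rfl⟩⟩
      · rcases he with he | rfl
        · rcases Nat.eq_zero_or_pos (μ'.nat 13 0) with h13 | h13
          · exact absurd hre ((hI1 h13).2 e he)
          · refine le_trans (mul_le_mul_of_nonneg_right ?_ hre.2.le) ((hI2 h13).1 e he hre)
            rw [div_le_iff₀ hr.2]
            exact (not_not.1 fun hn => hlt ⟨h13, hn⟩).le
        · exact (hval _ rfl).le
      · rcases Nat.eq_zero_or_pos (μ'.nat 13 0) with h13 | h13
        · exact absurd (hI1 h13).1 h0.ne'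
        · refine le_trans ?_ ((hI2 h13).2.1 h0)
          rw [div_le_iff₀ hr.2]
          exact (not_not.1 fun hn => hlt ⟨h13, hn⟩).le
    · rw [Block.run_ite_neg hc]
      have hskip := mt htest.2 hc
      rw [not_and, not_not] at hskip
      simp
      refine ⟨fun h0 => ⟨(hI1 h0).1, fun e he hre => ?_⟩,
        fun h0 => ⟨fun e he hre => ?_, (hI2 h0).2.1, (hI2 h0).2.2⟩⟩
      · rcases he with he | rfl
        · exact (hI1 h0).2 e he hre
        · exact (hskip hre).1.ne' h0
      · rcases he with he | rfl
        · exact (hI2 h0).1 e he hre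
        · exact not_lt.1 (hskip hre).2

end RealRAM

/-! ### One complete flood or increase step. -/

namespace RealRAM

open PiecewiseLinearPayments

attribute [local simp] Block.run NatExp.eval RealExp.eval Test.eval Function.update_apply pos_inj
  Fin.val_inj

variable {n m : ℕ} {N : FinancialNetwork n m} {P : PiecewiseLinearPayments N} {s : AlgState n}
  {μ : Mem}

theorem exists_isFloodComponent {b : Fin n → ℝ} {v u : Fin n} (h : IsRoot P b v u) :
    ∃ C, u ∈ C ∧ P.IsFloodComponent b v C := by
  classical
  obtain ⟨⟨hback, w, hne, hw⟩, hv⟩ := h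
  have hmem : ∀ x, x ∈ Finset.univ.filter (P.Reach b u) ↔ P.Reach b u x := fun x => by simp
  have hu := (hmem u).2 (P.reach_refl b u)
  refine ⟨_, hu, ⟨⟨u, hu⟩, fun x hx y => ?_⟩, ⟨u, hu, w, (hmem w).2 hw, hne⟩,
    fun x hx y hxy => ?_, u, hu, hv⟩
  · rw [hmem] at hx ⊢
    exact ⟨fun hy => ⟨(hback x hx).trans hy, (hback y hy).trans hx⟩, fun hy => hx.trans hy.1⟩
  · rw [hmem] at hx ⊢
    exact hx.tail hxy

theorem IsFloodComponent.exists_isRoot {b : Fin n → ℝ} {v : Fin n} {C : Finset (Fin n)}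
    (h : P.IsFloodComponent b v C) : ∃ u, IsRoot P b v u := by
  obtain ⟨u, hu, hv⟩ := h.2.2.2
  obtain ⟨w, hw, hne⟩ := h.2.1.exists_ne u
  exact ⟨u, ⟨fun x hx => h.reach ((h.mem_iff_reach hu x).2 hx) hu, w, hne.symm, h.reach hu hw⟩, hv⟩

/-- Compute the slopes (real array `7`) and the reachability relation (natural array `9`). -/
def graphB : Block := .seq clearB (.seq slopesB closeB)

theorem graphB_spec (h : P.Stores s μ) (hp : P.PointsAt s μ) (w u : Fin n) :
    (graphB.run μ).real 7 (w * n + u) = P.slopeMatrix s.b w u ∧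
      (0 < (graphB.run μ).nat 9 (w * n + u) ↔ P.Reach s.b w u) := by
  have hf1 := clearB.frame_run μ
  have h1 := h.frame hf1 (by decide) (by decide)
  have h2 := slopesB_spec h1 (hp.frame hf1 (by decide)) (clearB_spec h.toHasRows)
  have h3 := h1.frame (slopesB.frame_run _) (by decide) (by decide)
  have hf3 := closeB.frame_run (slopesB.run (clearB.run μ))
  refine ⟨?_, closeB_spec h3.toHasRows (fun u w => (h2 u w).2) w u⟩
  rw [graphB, Block.run, Block.run, hf3.2 7 (by decide)]
  exact (h2 w u).1

/-- Decide which linear program is solved next. -/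
def chooseB : Block := .seq rootB sourceB

theorem chooseB_spec (h : P.Stores s μ) {v : Fin n} (hv : s.cur = some v)
    (hr : ∀ u w : Fin n, 0 < μ.nat 9 (u * n + w) ↔ P.Reach s.b u w) :
    (∃ u, IsRoot P s.b v u ∧ 0 < (chooseB.run μ).nat 10 0 ∧ (chooseB.run μ).nat 12 0 = u ∧
      (chooseB.run μ).nat 13 0 = 0) ∨
    ((∀ u, ¬ IsRoot P s.b v u) ∧ (chooseB.run μ).nat 10 0 = 0 ∧ (chooseB.run μ).nat 12 0 = v ∧
      (chooseB.run μ).nat 13 0 = 1 ∧ (chooseB.run μ).real 10 0 = N.extAssets v - s.bx v) := by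
  have h1 := h.frame (rootB.frame_run μ) (by decide) (by decide)
  have hcur : (rootB.run μ).nat 4 0 = v + 1 := by rw [h1.displays.2.2, hv]; rfl
  have hroot := rootB_spec h hv hr
  rw [chooseB, Block.run]
  generalize rootB.run μ = ν at *
  rcases hroot with ⟨h0, hno⟩ | ⟨u, hu, hroot⟩
  · right
    simp [sourceB, h0, hcur, h1.ext, h1.displays.1]
    exact hno
  · left
    refine ⟨u, hroot, ?_⟩
    simp [sourceB, hu]

/-- Set up and solve the linear system. -/
def solutionB : Block := .seq systemB linearB

theorem solutionB_spec (h : HasRows n μ) {u : Fin n} (hu : μ.nat 12 0 = u)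
    {Q : Fin n → Fin n → ℝ} (hQ : IsTransient Q) (hm : systemMatrix n μ = Q) (w : Fin n) :
    (solutionB.run μ).real 9 w = (if w = u then 1 else 0) +
      ∑ x, Q w x * (solutionB.run μ).real 9 x := by
  have h1 := h.frame (systemB.frame_run μ) (by decide) (by decide)
  refine linearB_spec h1
    (S := fun y => ∀ w, y w = (if w = u then 1 else 0) + ∑ x, Q w x * y x) ?_ w
  simp only [systemB_spec h hu, hm]
  exact hQ.isEliminated _

/-- Add the multiple of the solution to the total assets. -/
def addB : Block :=
  .rep 20 0 (.setReal 5 (var 20)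
    (.add (.get 5 (var 20)) (.mul (.get 10 (.lit 0)) (.get 9 (var 20)))))

theorem addB_spec (h : HasRows n μ) (w : Fin n) :
    (addB.run μ).real 5 w = μ.real 5 w + μ.real 10 0 * μ.real 9 w := by
  have key := rep_induction_fin (B := addB) rfl (by decide) h.size
    (fun i μ' => ∀ w : Fin n, μ'.real 5 w =
      if (w : ℕ) < i then μ.real 5 w + μ.real 10 0 * μ.real 9 w else μ.real 5 w)
    (fun w => by simp) (fun i μ' hf hi hI w => ?_)
  · simpa using key w
  · have h2 := hI w
    simp only [val_lt_add_one]
    simp [hi, hf.2 9 (by decide), hf.2 10 (by decide)]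
    grind

/-- Add the optimal solution of the linear program to the state. -/
def updateB : Block :=
  .seq addB (.ite (.natLt (.lit 0) (var 10)) skip
    (.seq (.setReal 4 (var 12) (.add (.get 4 (var 12)) (.get 10 (.lit 0))))
      (.setNat 4 (.lit 0) (.lit 0))))

theorem updateB_spec_flood (h : P.Stores s μ) (h10 : 0 < μ.nat 10 0) :
    Displays (updateB.run μ)
      ⟨s.bx, s.b + fun w : Fin n => μ.real 10 0 * μ.real 9 w, s.cur⟩ := by
  have hadd := addB_spec h.toHasRows
  have hf := addB.frame_run μ
  rw [updateB, Block.run, Block.run_ite_pos (by simpa [hf.1 10 (by decide)] using h10)]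
  refine ⟨fun w => ?_, fun w => ?_, ?_⟩
  · simpa [hf.2 4 (by decide)] using h.displays.1 w
  · simpa [h.displays.2.1] using hadd w
  · simpa [hf.1 4 (by decide)] using h.displays.2.2

theorem updateB_spec_increase (h : P.Stores s μ) (h10 : μ.nat 10 0 = 0) {v : Fin n}
    (hv : μ.nat 12 0 = v) :
    Displays (updateB.run μ) ⟨Function.update s.bx v (s.bx v + μ.real 10 0),
      s.b + fun w : Fin n => μ.real 10 0 * μ.real 9 w, none⟩ := by
  have hadd := addB_spec h.toHasRows
  have hf := addB.frame_run μ
  have hbx := h.displays.1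
  rw [updateB, Block.run, Block.run_ite_neg (by simp [hf.1 10 (by decide), h10])]
  refine ⟨fun w => ?_, fun w => ?_, by simp⟩
  · simp [hf.2 4 (by decide), hf.1 12 (by decide), hf.2 10 (by decide), hv, hbx]
  · simpa [h.displays.2.1] using hadd w

/-- One flood or increase step of the algorithm. -/
def coreB : Block := .seq graphB (.seq chooseB (.seq solutionB (.seq stepB updateB)))

/-- The sign of the computed solution serves as the reachability test. -/
theorem restricts_iff {b y : Fin n → ℝ} {u : Fin n} (hpos : ∀ w, P.Reach b u w → 0 < y w)
    (hzero : ∀ w, ¬ P.Reach b u w → y w = 0) (e : Fin m) :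
    Restricts P b y e ↔ P.Active b e ∧ P.Reach b u (N.debtor e) :=
  and_congr_right fun _ => ⟨fun h => not_not.1 fun hn => h.ne' (hzero _ hn), hpos _⟩

/-- Both programs share one computation: solve for unit inflow at the source, scale by the ratio
test, add. Only the source, the cut row and the initial bound differ. -/
theorem coreB_spec (hs : P.IsSound s) (h : P.Stores s μ) (hp : P.PointsAt s μ) {v : Fin n}
    (hv : s.cur = some v) :
    ∃ s', P.AlgStep s s' ∧ P.Stores s' (coreB.run μ) ∧ ∀ w, s.b w ≤ s'.b w := by
  have hb := hs.clears.1
  have hf1 := graphB.frame_run μ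
  have h1 := h.frame hf1 (by decide) (by decide)
  have hp1 := hp.frame hf1 (by decide)
  have hg := graphB_spec h hp
  have hr1 := fun w u => (hg w u).2
  have hm1 := fun w u => (hg w u).1
  have hc := chooseB_spec h1 hv hr1
  have hrun : coreB.run μ =
      updateB.run (stepB.run (solutionB.run (chooseB.run (graphB.run μ)))) := rfl
  rw [hrun]
  generalize graphB.run μ = μ₁ at *
  have hf2 := chooseB.frame_run μ₁
  have h2 := h1.frame hf2 (by decide) (by decide)
  have hp2 := hp1.frame hf2 (by decide)
  rw [← hf2.1 9 (by decide)] at hr1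
  rw [← hf2.2 7 (by decide)] at hm1
  generalize chooseB.run μ₁ = μ₂ at *
  have hsol := fun u hu Q hQ hm => solutionB_spec (u := u) h2.toHasRows hu (Q := Q) hQ hm
  have hf3 := solutionB.frame_run μ₂
  have h3 := h2.frame hf3 (by decide) (by decide)
  have hp3 := hp2.frame hf3 (by decide)
  rw [← hf3.1 10 (by decide), ← hf3.1 12 (by decide), ← hf3.1 13 (by decide),
    ← hf3.2 10 (by decide)] at hc
  have h12 := hf3.1 12 (by decide)
  have h10 := hf3.1 10 (by decide)
  generalize solutionB.run μ₂ = μ₃ at *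
  obtain ⟨y, hy⟩ : ∃ y : Fin n → ℝ, ∀ w : Fin n, μ₃.real 9 w = y w := ⟨_, fun _ => rfl⟩
  simp only [hy] at hsol
  have hstep := stepB_spec h3 hp3 hb hy rfl
  have hf4 := stepB.frame_run μ₃
  have h4 := h3.frame hf4 (by decide) (by decide)
  have hy4 : ∀ w : Fin n, (stepB.run μ₃).real 9 w = y w := fun w => by
    rw [hf4.2 9 (by decide), hy]
  have h104 := hf4.1 10 (by decide)
  have h124 := hf4.1 12 (by decide)
  generalize stepB.run μ₃ = μ₄ at *
  have hf5 := updateB.frame_run μ₄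
  obtain ⟨t, ht⟩ : ∃ t, μ₄.real 10 0 = t := ⟨_, rfl⟩
  obtain ⟨bx, b, cur⟩ := s
  simp only at hv hb hs hr1 hm1 hsol hstep hc
  subst hv
  rw [ht] at hstep
  rcases hc with ⟨u, hroot, hc10, hc12, hc13⟩ | ⟨hno, hc10, hc12, hc13, hcr⟩
  · obtain ⟨C, hu, hC⟩ := exists_isFloodComponent hroot
    have hQ := P.isTransient_floodMatrix hb hC hu
    have e12 : μ₂.nat 12 0 = u := by rw [← h12, hc12]
    have e10 : 0 < μ₂.nat 10 0 := by rw [← h10]; exact hc10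
    -- With the row of the source omitted, the coefficients form the flood matrix.
    have hyy := hsol u e12 _ hQ (by
      funext w x
      classical
      refine if_congr ?_ (hm1 w x) rfl
      rw [e12, hr1, Fin.val_inj, and_iff_right e10])
    have hpos := fun w => floodMatrix_solution_pos (w := w) hb hC hu hyy
    have hzero := fun w => floodMatrix_solution_eq_zero (w := w) hyy
    simp only [restricts_iff hpos hzero, hc13, lt_self_iff_false, false_and, false_or,
      or_false] at hstep
    -- An active claim of u itself restricts the step, so the ratio test does find a bound.
    obtain ⟨x, -, e, he, heu, -⟩ := hC.exists_activeAdj hu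
    obtain ⟨e', he', hte⟩ := hstep.2.2 ⟨e, he, heu ▸ P.reach_refl b _⟩
    have hopt := floodOptimal_smul hb hC hu hyy (fun e he hr => hstep.1 e ⟨he, hr⟩)
      ⟨e', he'.1, he'.2, hte⟩
    have hd := updateB_spec_flood h4 (by rw [h104]; exact hc10)
    simp only [ht, hy4] at hd
    exact ⟨_, .flood bx b v C _ hC hopt, h4.redisplay hf5 (by decide) (by decide) hd,
      fun w => le_add_of_nonneg_right (hopt.1.nonneg w)⟩
  · have hC : ∀ C, ¬ P.IsFloodComponent b v C := fun C hC =>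
      (IsFloodComponent.exists_isRoot hC).elim hno
    have hQ := P.isTransient_increaseMatrix hb hC
    have e12 : μ₂.nat 12 0 = v := by rw [← h12, hc12]
    have e10 : μ₂.nat 10 0 = 0 := by rw [← h10, hc10]
    have hyy := hsol v e12 _ hQ (by
      funext w x
      classical
      refine if_congr ?_ (hm1 w x) rfl
      rw [e12, hr1, e10]
      simp)
    have hpos := fun w => increaseMatrix_solution_pos (w := w) hb hC hyy
    have hzero := fun w => increaseMatrix_solution_eq_zero (w := w) hyy
    simp only [restricts_iff hpos hzero, hc13, hcr, Nat.lt_one_iff, or_true, true_and,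
      true_imp_iff] at hstep
    have hopt := increaseOptimal_smul hb hC hyy (hs.bx_le v) hstep.2.1
      (fun e he hr => hstep.1 e ⟨he, hr⟩)
      (hstep.2.2.imp id fun ⟨e, he, hte⟩ => ⟨e, he.1, he.2, hte⟩)
    have hd := updateB_spec_increase h4 (by rw [h104, hc10]) (by rw [h124, hc12])
    simp only [ht, hy4] at hd
    exact ⟨_, .increase bx b v t _ hC hopt, h4.redisplay hf5 (by decide) (by decide) hd,
      fun w => le_add_of_nonneg_right (hopt.1.2.2.2.2.2 w)⟩

end RealRAM

namespace RealRAM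

open PiecewiseLinearPayments

attribute [local simp] Block.run NatExp.eval RealExp.eval Test.eval Function.update_apply pos_inj
  Fin.val_inj

variable {n m : ℕ} {N : FinancialNetwork n m} {P : PiecewiseLinearPayments N} {s : AlgState n}
  {μ : Mem}

/-! ## The initialization -/

/-- Induction on the number of blocks: an index in a later block is shifted by the length of the
first one. -/
theorem getD_flatMap_finRange {m : ℕ} (g : Fin m → List ℝ) (e : Fin m) {i : ℕ}
    (hi : i < (g e).length) :
    ((List.finRange m).flatMap g).getD
      ((∑ x : Fin m, if (x : ℕ) < e then (g x).length else 0) + i) 0 = (g e).getD i 0 := by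
  induction m with
  | zero => exact e.elim0
  | succ m ih =>
    rw [List.finRange_succ, List.flatMap_cons, List.flatMap_map, Fin.sum_univ_succ]
    induction e using Fin.cases with
    | zero => simpa using List.getD_append _ _ _ _ hi
    | succ e =>
      have := ih (fun x => g x.succ) e hi
      simp only [Fin.val_zero, Fin.val_succ, Nat.zero_lt_succ, if_true, add_assoc,
        add_lt_add_iff_right]
      rw [List.getD_append_right _ _ _ _ (Nat.le_add_right _ _), Nat.add_sub_cancel_left]
      exact this

theorem getD_ofFn {α : Type*} {m : ℕ} (f : Fin m → α) (e : Fin m) (d : α) :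
    (List.ofFn f).getD e d = f e := by
  simp [List.getD_eq_getElem?_getD]

theorem getD_flatMap_range (g : Fin m → ℕ → ℝ) (e : Fin m) {i : ℕ} (hi : i ≤ P.numBorders e) :
    ((List.finRange m).flatMap fun e => (List.range (P.numBorders e + 1)).map (g e)).getD
      (P.start e + i) 0 = g e i := by
  have h := getD_flatMap_finRange (fun e => (List.range (P.numBorders e + 1)).map (g e)) e
    (i := i) (by simpa using by omega)
  simp only [List.length_map, List.length_range] at h
  refine h.trans ?_
  rw [List.getD_eq_getElem _ _ (by simpa using by omega)]
  simp

/-- Compute the positions of the rows of a matrix. -/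
def rowsB : Block :=
  .seq (.setNat 16 (.lit 0) (.lit 0)) (.rep 20 0 (.seq (.setNat 7 (var 20) (var 16))
    (.setNat 16 (.lit 0) (.add (var 16) (.get 0 (.lit 0))))))

theorem rowsB_spec (h : μ.nat 0 0 = n) : HasRows n (rowsB.run μ) := by
  have hf := rowsB.frame_run μ
  refine ⟨by rw [hf.1 0 (by decide), h], ?_⟩
  have key := rep_induction_fin (μ := μ.setNat 16 0 0) (x := 20) (j := 0) rfl (by decide)
    (N := n) (by simpa using h)
    (c := .seq (.setNat 7 (var 20) (var 16))
      (.setNat 16 (.lit 0) (.add (var 16) (.get 0 (.lit 0)))))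
    (fun i μ' => μ'.nat 16 0 = i * n ∧ ∀ w : Fin n, (w : ℕ) < i → μ'.nat 7 w = w * n)
    ⟨by simp, fun w hw => absurd hw (Nat.not_lt_zero _)⟩ (fun i μ' hf hi hI => ?_)
  · exact fun w => key.2 w w.2
  · have h0 : μ'.nat 0 0 = n := by
      rw [hf.1 0 (by decide)]
      simpa using h
    simp only [val_lt_add_one]
    simp [hi, hI.1, h0, add_mul]
    grind

/-- Compute the positions of the first and the last borders. -/
def pointersB : Block :=
  .seq (.setNat 16 (.lit 0) (.lit 0)) (.rep 20 1 (.seq (.setNat 5 (var 20) (var 16))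
    (.seq (.setNat 6 (var 20) (.add (var 16) (.get 3 (var 20))))
      (.setNat 16 (.lit 0) (.add (.get 6 (var 20)) (.lit 1))))))

theorem pointersB_spec (h : μ.nat 0 1 = m) (hb : ∀ e : Fin m, μ.nat 3 e = P.numBorders e)
    (e : Fin m) : (pointersB.run μ).nat 5 e = P.start e ∧
      (pointersB.run μ).nat 6 e = P.start e + P.numBorders e := by
  have key := rep_induction_fin (μ := μ.setNat 16 0 0) (x := 20) (j := 1) rfl (by decide)
    (N := m) (by simpa using h)
    (c := .seq (.setNat 5 (var 20) (var 16))
      (.seq (.setNat 6 (var 20) (.add (var 16) (.get 3 (var 20))))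
        (.setNat 16 (.lit 0) (.add (.get 6 (var 20)) (.lit 1)))))
    (fun i μ' => μ'.nat 16 0 = P.start i ∧ ∀ e : Fin m, (e : ℕ) < i →
      μ'.nat 5 e = P.start e ∧ μ'.nat 6 e = P.start e + P.numBorders e)
    ⟨by simp [P.start_zero], fun w hw => absurd hw (Nat.not_lt_zero _)⟩ (fun i μ' hf hi hI => ?_)
  · exact key.2 e e.2
  · have h3 : μ'.nat 3 i = P.numBorders i := by
      rw [hf.1 3 (by decide)]
      simpa using hb i
    have hs := P.start_add_one i
    simp only [val_lt_add_one]
    simp [hi, hI.1, h3]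
    grind

/-- The initialization. -/
def initB : Block := .seq rowsB (.seq pointersB nextB)

/-- The invariant of the main loop of the program. -/
structure Invariant (P : PiecewiseLinearPayments N) (s : AlgState n) (μ : Mem) : Prop where
  sound : P.IsSound s
  stores : P.Stores s μ
  below : P.PointsBelow s μ
  next : P.PointsNext s μ

theorem initB_spec : Invariant P (AlgState.init n) (initB.run P.inputMem) ∧
    ∀ e : Fin m, (initB.run P.inputMem).nat 5 e = P.start e := by
  have hf1 := rowsB.frame_run P.inputMem
  have h1 := rowsB_spec (n := n) (μ := P.inputMem) rfl
  have hp := pointersB_spec (P := P) (μ := rowsB.run P.inputMem)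
    (by rw [hf1.1 0 (by decide)]; rfl)
    (fun e => by rw [hf1.1 3 (by decide)]; exact getD_ofFn _ e 0)
  have hf2 := pointersB.frame_run (rowsB.run P.inputMem)
  have hn : ∀ A, A ∉ rowsB.natWrites → A ∉ pointersB.natWrites →
      (pointersB.run (rowsB.run P.inputMem)).nat A = P.inputMem.nat A := fun A hA hA' => by
    rw [hf2.1 A hA', hf1.1 A hA]
  have hr : ∀ A, (pointersB.run (rowsB.run P.inputMem)).real A = P.inputMem.real A := fun A => by
    rw [hf2.2 A List.not_mem_nil, hf1.2 A List.not_mem_nil]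
  have h2 : P.Stores (AlgState.init n) (pointersB.run (rowsB.run P.inputMem)) :=
    { h1.frame hf2 (by decide) (by decide) with
      claims := by rw [hn 0 (by decide) (by decide)]; rfl
      debtor := fun e => by rw [hn 1 (by decide) (by decide)]; exact getD_ofFn _ e 0
      creditor := fun e => by rw [hn 2 (by decide) (by decide)]; exact getD_ofFn _ e 0
      last := fun e => (hp e).2
      ext := fun v => by rw [hr]; exact getD_ofFn _ v 0
      border := fun e i hi => by rw [hr]; exact getD_flatMap_range _ e hi
      slope := fun e i hi => by rw [hr]; exact getD_flatMap_range _ e hi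
      displays := ⟨fun v => by rw [hr]; rfl, fun v => by rw [hr]; rfl,
        by rw [hn 4 (by decide) (by decide)]; rfl⟩ }
  have hb : P.PointsBelow (AlgState.init n) (pointersB.run (rowsB.run P.inputMem)) := fun e =>
    ⟨0, Nat.zero_le _, (hp e).1, (P.border_zero e).le⟩
  have hf3 := nextB.frame_run (pointersB.run (rowsB.run P.inputMem))
  exact ⟨⟨P.isSound_init, h2.frame hf3 (by decide) (by decide), hb.frame hf3 (by decide),
    nextB_spec h2⟩, fun e => by
      rw [← (hp e).1]
      exact congrFun (hf3.1 5 (by decide)) e⟩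

/-! ## The main loop -/

/-- The body of the main loop. -/
def bodyB : Block :=
  .ite (.natLt (var 4) (.lit 1)) (.setNat 4 (.lit 0) (var 8))
    (.seq advanceB (.seq (.ite (.natLt (var 11) (.lit 1)) coreB skip) nextB))

/-- The test of the main loop. -/
abbrev loopTest : Test := .natLt (.lit 0) (.add (var 8) (var 4))

theorem Invariant.finished (h : Invariant P s μ) (ht : ¬ loopTest.eval μ) : P.Finished s := by
  simp only [Test.eval, NatExp.eval, not_lt, nonpos_iff_eq_zero, Nat.add_eq_zero_iff] at ht
  refine ⟨?_, ?_⟩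
  · have := h.stores.displays.2.2
    rw [ht.2] at this
    rcases hc : s.cur with _ | v
    · rfl
    · simp [hc] at this
  · rcases h.next with ⟨-, h0⟩ | ⟨v, hv, -⟩
    · exact not_exists.2 h0
    · omega

/-- A round either advances pointers and leaves the state alone, or performs one step of the
algorithm. In both cases pointers never move back. -/
theorem bodyB_spec (h : Invariant P s μ) (ht : loopTest.eval μ) :
    ∃ s', Invariant P s' (bodyB.run μ) ∧
      ((s' = s ∧ ∑ e : Fin m, μ.nat 5 e < ∑ e : Fin m, (bodyB.run μ).nat 5 e) ∨
        (P.AlgStep s s' ∧ ∑ e : Fin m, μ.nat 5 e ≤ ∑ e : Fin m, (bodyB.run μ).nat 5 e)) := by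
  have hd := h.stores.displays.2.2
  rcases hc : s.cur with _ | v
  · rw [hc] at hd
    have h40 : μ.nat 4 0 = 0 := hd
    rw [bodyB, Block.run_ite_pos (by simp [h40])]
    rcases h.next with ⟨h0, -⟩ | ⟨v, hv, hlt⟩
    · simp [h0, h40] at ht
    · obtain ⟨bx, b, cur⟩ := s
      simp only at hc hlt
      subst hc
      have hstep := AlgStep.choose (P := P) bx b v hlt
      have hf := (Block.setNat 4 (.lit 0) (var 8)).frame_run μ
      refine ⟨_, ⟨h.sound.step hstep, h.stores.redisplay hf (by decide) (by decide)
        ⟨h.stores.displays.1, h.stores.displays.2.1, by simp [hv]⟩, h.below.frame hf (by decide),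
        Or.inr ⟨v, by simpa using hv, hlt⟩⟩, Or.inr ⟨hstep, by simp⟩⟩
  · rw [hc] at hd
    have h40 : μ.nat 4 0 = v + 1 := hd
    have hadv := advanceB_spec h.stores h.below
    have h1 := h.stores.frame (advanceB.frame_run μ) (by decide) (by decide)
    rw [bodyB, Block.run_ite_neg (by simp [h40]), Block.run, Block.run]
    generalize advanceB.run μ = μ₁ at *
    obtain ⟨hb, hle, hadv⟩ := hadv
    have hsum : ∑ e : Fin m, μ.nat 5 e ≤ ∑ e : Fin m, μ₁.nat 5 e :=
      Finset.sum_le_sum fun e _ => hle e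
    rcases hadv with ⟨h11, hp⟩ | ⟨h11, e, he⟩
    · rw [Block.run_ite_pos (by simp [h11])]
      obtain ⟨s', hstep, h2, hbb⟩ := coreB_spec h.sound h1 hp hc
      have hb2 := (hp.pointsBelow h.sound.clears.1 hbb).frame (coreB.frame_run μ₁) (by decide)
      have h5 := (coreB.frame_run μ₁).1 5 (by decide)
      have hf3 := nextB.frame_run (coreB.run μ₁)
      refine ⟨s', ⟨h.sound.step hstep, h2.frame hf3 (by decide) (by decide),
        hb2.frame hf3 (by decide), nextB_spec h2⟩, Or.inr ⟨hstep, ?_⟩⟩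
      rw [hf3.1 5 (by decide), h5]
      exact hsum
    · rw [Block.run_ite_neg (by simpa using h11.ne')]
      have hf2 := skip.frame_run μ₁
      have h2 := h1.frame hf2 (by decide) (by decide)
      have hf3 := nextB.frame_run (skip.run μ₁)
      refine ⟨s, ⟨h.sound, h2.frame hf3 (by decide) (by decide),
        (hb.frame hf2 (by decide)).frame hf3 (by decide), nextB_spec h2⟩, Or.inl ⟨rfl, ?_⟩⟩
      rw [hf3.1 5 (by decide), hf2.1 5 (by decide)]
      exact Finset.sum_lt_sum (fun e _ => hle e) ⟨e, Finset.mem_univ e, he⟩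

/-- An upper bound for the number of remaining rounds of the main loop. -/
noncomputable def remaining (P : PiecewiseLinearPayments N) (s : AlgState n) (μ : Mem) : ℕ :=
  (3 * (n + P.totalBorders) - P.rank s) +
    (∑ e : Fin m, (P.start e + P.numBorders e) - ∑ e : Fin m, μ.nat 5 e)

theorem Invariant.sum_le (h : Invariant P s μ) :
    ∑ e : Fin m, μ.nat 5 e ≤ ∑ e : Fin m, (P.start e + P.numBorders e) :=
  Finset.sum_le_sum fun e _ => by
    obtain ⟨p, hp, he, -⟩ := h.below e
    omega

theorem exists_remaining_lt (h : Invariant P s μ) (ht : loopTest.eval μ) :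
    ∃ s', Invariant P s' (bodyB.run μ) ∧ (s' = s ∨ P.AlgStep s s') ∧
      remaining P s' (bodyB.run μ) < remaining P s μ := by
  obtain ⟨s', h', hs⟩ := bodyB_spec h ht
  have h1 := h'.sum_le
  have h2 := P.rank_le s'
  unfold remaining
  rcases hs with ⟨rfl, hlt⟩ | ⟨hstep, hle⟩
  · exact ⟨s', h', Or.inl rfl, by omega⟩
  · have := h.sound.rank_lt hstep
    exact ⟨s', h', Or.inr hstep, by omega⟩

/-- The main loop of the program. -/
def mainLoop : Cmd := .loop loopTest bodyB.toCmd

/-- Rounds that only move pointers change no displayed state; they are absorbed into the execution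
up to the next displayed configuration. Each round costs the body plus 8 for the loop test. -/
theorem exists_run {N₀ : ℕ → ℕ} (F : ℕ) : ∀ (s : AlgState n) (μ : Mem) (t : ℕ),
    Invariant P s μ → μ.nat 0 = N₀ → remaining P s μ ≤ F →
    ∃ (r : ℕ) (σ : ℕ → AlgState n) (c : ℕ → Config),
      σ 0 = s ∧ (∀ i < r, P.AlgStep (σ i) (σ (i + 1))) ∧ P.Finished (σ r) ∧
      Steps ⟨[mainLoop], μ, t⟩ (c 0) ∧ (∀ i < r, Steps (c i) (c (i + 1))) ∧
      (∀ i ≤ r, Displays (c i).mem (σ i)) ∧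
      (c r).todo = [] ∧ (c r).clock ≤ t + F * (bodyB.cost N₀ + 8) + 8 := by
  induction F with
  | zero =>
    intro s μ t h _ hF
    have ht : ¬ loopTest.eval μ := fun ht => by
      obtain ⟨s', -, -, hlt⟩ := exists_remaining_lt h ht
      omega
    exact ⟨0, fun _ => s, fun _ => ⟨[], μ, _⟩, rfl, by simp, h.finished ht,
      .single (.loopFalse _ _ _ μ t ht), by simp, fun _ _ => h.stores.displays, rfl,
      by simp [Test.cost, NatExp.cost]⟩
  | succ F ih =>
    intro s μ t h hN hF
    by_cases ht : loopTest.eval μ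
    · obtain ⟨s', h', hs, hlt⟩ := exists_remaining_lt h ht
      obtain ⟨t', ht', hexec⟩ := bodyB.exec (by decide) (by decide) μ [mainLoop]
        (t + (1 + loopTest.cost))
      obtain ⟨r, σ, c, h0, hstep, hfin, hc0, hc, hdisp, htodo, hclock⟩ := ih s' _ t' h'
        (((bodyB.frame_run μ).1 0 (by decide)).trans hN) (by omega)
      have hpre : Steps ⟨[mainLoop], μ, t⟩ (c 0) :=
        .head (.loopTrue _ _ _ μ t ht) (hexec.trans hc0)
      have hcl : (c r).clock ≤ t + (F + 1) * (bodyB.cost N₀ + 8) + 8 := by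
        rw [hN] at ht'
        simp only [Test.cost, NatExp.cost] at ht'
        rw [add_mul]
        omega
      rcases hs with rfl | hs
      · exact ⟨r, σ, c, h0, hstep, hfin, hpre, hc, hdisp, htodo, hcl⟩
      -- A genuine step puts the present state and configuration in front of the run obtained by
      -- induction.
      · refine ⟨r + 1, fun i => Nat.casesOn i s σ, fun i => Nat.casesOn i ⟨[mainLoop], μ, t⟩ c, rfl,
          fun i hi => ?_, hfin, ?_, fun i hi => ?_, fun i hi => ?_, htodo, hcl⟩
        · rcases i with _ | i
          · change P.AlgStep s (σ 0)
            rwa [h0]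
          · exact hstep i (by omega)
        · exact Relation.ReflTransGen.refl
        · rcases i with _ | i
          · exact hpre
          · exact hc i (by omega)
        · rcases i with _ | i
          · exact h.stores.displays
          · exact hdisp i (by omega)
    · exact ⟨0, fun _ => s, fun _ => ⟨[], μ, _⟩, rfl, by simp, h.finished ht,
        .single (.loopFalse _ _ _ μ t ht), by simp, fun _ _ => h.stores.displays, rfl,
        by simp [Test.cost, NatExp.cost]⟩

end RealRAM

/-! ### The total cost. -/

namespace RealRAM

open PiecewiseLinearPayments

variable {n m : ℕ} {N : FinancialNetwork n m} {P : PiecewiseLinearPayments N}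

theorem initB_cost_le : ∃ K, ∀ N₀ : ℕ → ℕ, 0 < N₀ 0 → initB.cost N₀ ≤ K * (N₀ 0 ^ 3 + N₀ 1) := by
  refine ⟨1000, fun N₀ hn => ?_⟩
  simp only [initB, rowsB, pointersB, nextB, Block.cost, NatExp.cost, RealExp.cost, Test.cost]
  have : N₀ 0 ≤ N₀ 0 ^ 3 := Nat.le_self_pow (by norm_num) _
  omega

/-- Transitive closure and elimination are the triple loops over banks, and loops over claims are
never nested. The assumption n ≥ 1 lets n³ absorb constants and lower powers. -/
theorem bodyB_cost_le : ∃ K, ∀ N₀ : ℕ → ℕ, 0 < N₀ 0 → bodyB.cost N₀ ≤ K * (N₀ 0 ^ 3 + N₀ 1) := by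
  refine ⟨100000, fun N₀ hn => ?_⟩
  simp only [bodyB, advanceB, nextB, coreB, graphB, clearB, clearRow, slopesB, closeB, closeRow,
    closeEntries, chooseB, rootB, rootEntries, sourceB, solutionB, systemB, systemRow, linearB,
    elimB, elimRow, elimEntries, solveB, stepB, updateB, addB, Block.cost, NatExp.cost,
    RealExp.cost, Test.cost]
  have h1 : N₀ 0 ≤ N₀ 0 ^ 3 := Nat.le_self_pow (by norm_num) _
  have h2 : N₀ 0 * N₀ 0 ≤ N₀ 0 ^ 3 := by
    rw [pow_succ, pow_two]
    exact Nat.le_mul_of_pos_right _ hn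
  ring_nf at h2 ⊢
  omega

/-- The program. -/
def program : Cmd := .seq initB.toCmd mainLoop

theorem exists_runsWithin_program : ∃ c : ℕ, ∀ (n m : ℕ) (N : FinancialNetwork n m)
    (P : PiecewiseLinearPayments N), 0 < n →
      P.RunsWithin program (c * ((n + P.totalBorders) * (n ^ 3 + m))) := by
  obtain ⟨K₁, hK₁⟩ := initB_cost_le
  obtain ⟨K₂, hK₂⟩ := bodyB_cost_le
  refine ⟨K₁ + 4 * (K₂ + 8) + 9, fun n m N P hn => ?_⟩
  obtain ⟨hI, h5⟩ := initB_spec (P := P)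
  obtain ⟨t, ht, hexec⟩ := initB.exec (by decide) (by decide) P.inputMem [mainLoop] 1
  -- At most 3(n + k) algorithm steps, and k pointer moves since each pointer starts at its first
  -- border and stops at its last.
  have hrem : remaining P (AlgState.init n) (initB.run P.inputMem) ≤
      4 * (n + P.totalBorders) := by
    simp only [remaining, h5, Finset.sum_add_distrib, Nat.add_sub_cancel_left]
    unfold totalBorders
    omega
  obtain ⟨r, σ, c, h0, hstep, hfin, hc0, hc, hdisp, htodo, hclock⟩ :=
    exists_run _ _ _ t hI ((initB.frame_run P.inputMem).1 0 (by decide)) hrem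
  refine ⟨r, σ, c, ⟨h0, hstep⟩, hfin, .head (.seq _ _ _ _ _) ?_, hc, hdisp, htodo,
    hclock.trans ?_⟩
  · rw [zero_add]
    exact hexec.trans hc0
  · have e₁ := ht.trans (Nat.add_le_add_left (hK₁ (P.inputMem.nat 0) hn) 1)
    have e₂ := hK₂ (P.inputMem.nat 0) hn
    change t ≤ 1 + K₁ * (n ^ 3 + m) at e₁
    change _ ≤ K₂ * (n ^ 3 + m) at e₂
    have hX : 1 ≤ n ^ 3 + m := (Nat.one_le_pow _ _ hn).trans (Nat.le_add_right _ _)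
    have hY : 1 ≤ n + P.totalBorders := hn.trans_le (Nat.le_add_right _ _)
    generalize n ^ 3 + m = X at *
    generalize n + P.totalBorders = Y at *
    have hXY : X ≤ Y * X := Nat.le_mul_of_pos_left _ hY
    calc t + 4 * Y * (bodyB.cost (P.inputMem.nat 0) + 8) + 8
        ≤ (1 + K₁ * X) + 4 * Y * (K₂ * X + 8 * X) + 8 := by gcongr; omega
      -- The 9 consists of the initial sequencing, 1, and the last failing loop test, 8.
      _ = K₁ * X + 4 * (K₂ + 8) * (Y * X) + 9 := by ring
      _ ≤ K₁ * (Y * X) + 4 * (K₂ + 8) * (Y * X) + 9 * (Y * X) := by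
        gcongr
        exact Nat.le_mul_of_pos_right _ (Nat.mul_pos hY hX)
      _ = (K₁ + 4 * (K₂ + 8) + 9) * (Y * X) := by ring

end RealRAM

theorem mainTheorem1 :
    -- On every network, whatever choices the algorithm makes, it never gets stuck, it finishes
    -- after `O(n + k)` steps, and it returns the minimal clearing state.
    (∃ c : ℕ, ∀ (n m : ℕ) (N : FinancialNetwork n m) (P : PiecewiseLinearPayments N),
      ∀ (r : ℕ) (s : ℕ → PiecewiseLinearPayments.AlgState n), P.IsRun r s →
        r ≤ c * (n + P.totalBorders) ∧
        (¬ P.Finished (s r) → ∃ s', P.AlgStep (s r) s') ∧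
        (P.Finished (s r) → P.IsMinimalClearing (s r).b)) ∧
    -- A real RAM carries out the algorithm in time `O((n + k) * (n ^ 3 + m))`.
    (∃ (prog : RealRAM.Cmd) (c : ℕ),
      ∀ (n m : ℕ) (N : FinancialNetwork n m) (P : PiecewiseLinearPayments N), 0 < n →
        P.RunsWithin prog (c * ((n + P.totalBorders) * (n ^ 3 + m)))) :=
  ⟨⟨3, fun _ _ _ _ _ _ h => PiecewiseLinearPayments.run_correct h⟩,
    ⟨RealRAM.program, RealRAM.exists_runsWithin_program⟩⟩
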